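/- **Setting.** Let $\mathcal F_{\rm conv}$ be the set of convex functions $f:[0,1]\to\mathbb R$. For an interval $I=[l,r]\subseteq[0,1]$ with midpoint $m$ put $\mathrm{Sec}[f,I](x)=\frac{r-x}{r-l}f(l)+\frac{x-l}{r-l}f(r)$, $\Delta(f,I)=\frac{f(l)+f(r)}2-f(m)$ and $\Delta(f,x,t)=\Delta(f,[x-t,x+t])$. For $\epsilon>0$ let $\omega(f,x,\epsilon)=\inf\{t\in[0,\min\{x,1-x\}]:\Delta(f,x,t)\ge\epsilon\}$, $t_{\rm left}(f,\epsilon)=\inf\{t\in[0,\frac12]:\Delta(f,t,t)\ge\epsilon\}$, $t_{\rm right}(f,\epsilon)=\inf\{t\in[0,\frac12]:\Delta(f,1-t,t)\ge\epsilon\}$ (with $\inf\emptyset=\infty$), and $$\Lambda_{\rm avg}(f,\epsilon)=1+\int_{t_{\rm left}(f,\epsilon)}^{1-t_{\rm right}(f,\epsilon)}\omega(f,x,\epsilon)^{-1}\,dx\in[1,\infty]$$ (the integral is $0$ if the range is empty). **Oracle.** Fix $f_\star\in\mathcal F_{\rm conv}$ and $\sigma\ge0$. The $i$-th sample, at a design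 point $x_i$, returns $y_i=f_\star(x_i)+w_i$. There is a filtration $(\mathcal F_t)$ such that $w_t$ is $\mathcal F_t$-measurable and, conditionally on $\mathcal F_{t-1}$, has mean zero and is $\sigma^2$-subgaussian: $\mathbb E[e^{\lambda w_t}\mid\mathcal F_{t-1}]\le e^{\lambda^2\sigma^2/2}$ for all $\lambda\in\mathbb R$. The choices of the algorithm before sample $t$ is observed are $\mathcal F_{t-1}$-measurable. **Algorithm** (recursive secant approximation with noise; parameters $\beta>0$, $\delta\in(0,1/2)$). Let $\varphi(n,\eta)=\sqrt{16\sigma^2\log(\log_2(2n)/\eta)/n}$ for $n\ge1$ and $\varphi(0,\eta)=\infty$. Sample once at $0$ and once at $1$. Start with the tree whose only leaf is $[0,1]$, with $\delta^{\rm pnt}(x)=\delta/6$ for $x\in\{0,\frac12,1\}$, and with $\epsilon_1=\infty$. In round $t=2,3,\dots$, when $t$ samples have been taken, let $N_t(x)$ be the number of samples taken at $x$, $f_t^{\rm pnt}(x)$ their average ($-\infty$ if $N_t(x)=0$), $\mathcal L_t$ the set of leaves, and for $I=[l,r]\in\mathcal L_t$ with midpoint $m$ $$B_t(I)=\varphi(N_t(m),\delta^{\rm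 pnt}(m))+\tfrac12\max\{\varphi(N_t(l),\delta^{\rm pnt}(l)),\varphi(N_t(r),\delta^{\rm pnt}(r))\}.$$ (1) Set $\epsilon_t=\min\{\epsilon_{t-1},\,4\max_{I\in\mathcal L_t}(B_t(I)+\max\{0,\Delta(f_t^{\rm pnt},I)\})\}$. (2) If $\epsilon_t<\epsilon_{t-1}$, let $\widehat f_t$ be a minimizer of $\|f-f_t^{\rm sec}\|_\infty$ over $f\in\mathcal F_{\rm conv}$, where $f^{\rm sec}_t=\mathrm{Sec}[f_t^{\rm pnt},I]$ on each $I\in\mathcal L_t$; otherwise $\widehat f_t=\widehat f_{t-1}$. (3) Choose $I_t^*\in\mathcal L_t$ maximizing $B_t(I)+\max\{0,\Delta(f_t^{\rm pnt},I)\}$, and take the next sample at a point $x$ among the two endpoints and the midpoint of $I^*_t$ that maximizes $\varphi(N_t(x),\delta^{\rm pnt}(x))$. (4) If $(1+\beta)B_t(I^*_t)<\Delta(f_t^{\rm pnt},I_t^*)$, replace the leaf $I_t^*$ by its two halves and set $\delta^{\rm pnt}=\delta/(2|\mathcal L_t|^2)$ at the midpoints of these halves. Ties and minimizers are chosen arbitrarily.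 **Theorem.** For every $\alpha\in(0,1)$ there is a constant $C>0$, depending only on $\alpha$, such that the following holds for all $f_\star\in\mathcal F_{\rm conv}$, $\sigma\ge0$, $\beta>0$, $\delta\in(0,1/2)$ and every run of the algorithm on such an oracle. Put $c_\beta=(1-\alpha)\frac{\beta}{4(2+\beta)}$ and $$\overline N_\beta(f_\star,\epsilon,\delta)=C\,\Lambda_{\rm avg}(f_\star,c_\beta\epsilon)\,\max\Big\{1,\frac{(1+\beta)^2\sigma^2}{\epsilon^2}\Big\}\,\log\Big(\frac1\delta\,\Lambda_{\rm avg}(f_\star,c_\beta\epsilon)\,\log\Big(e+\frac{\sigma(1+\beta)}{\epsilon}\Big)\Big)$$ (which is $\infty$ if $\Lambda_{\rm avg}(f_\star,c_\beta\epsilon)=\infty$). Then, with probability at least $1-\delta$, simultaneously for all integers $t\ge2$ and all $\epsilon>0$ with $t\ge\overline N_\beta(f_\star,\epsilon,\delta)$, one has $\widehat f_t\in\mathcal F_{\rm conv}$ and $$\|\widehat f_t-f_\star\|_\infty\le\epsilon_t\le\epsilon.$$ -/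

import Mathlib

open MeasureTheory Set
open scoped ENNReal

noncomputable section

namespace ConvexRegression

/-! ## Secant approximation and the approximation modulus

Intervals `[a, b]` are represented by the pair `(a, b)`; functions on `[0,1]` by functions
`ℝ → ℝ` of which only the restriction to `Icc 0 1` matters. -/

/-- The class of convex functions on `[0,1]`. No continuity at the endpoints is required. -/
def ConvexClass (f : ℝ → ℝ) : Prop := ConvexOn ℝ (Icc (0 : ℝ) 1) f

/-- The midpoint of an interval. -/
def mid (I : ℝ × ℝ) : ℝ := (I.1 + I.2) / 2

/-- The secant approximation of `f` on the interval `I`. -/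
def sec (f : ℝ → ℝ) (I : ℝ × ℝ) (x : ℝ) : ℝ :=
  (I.2 - x) / (I.2 - I.1) * f I.1 + (x - I.1) / (I.2 - I.1) * f I.2

/-- `Δ(f, I)`: the error of the secant approximation at the midpoint of `I`. -/
def secErr (f : ℝ → ℝ) (I : ℝ × ℝ) : ℝ := (f I.1 + f I.2) / 2 - f (mid I)

/-- `Δ(f, x, t) = Δ(f, [x - t, x + t])`. -/
def secErrAt (f : ℝ → ℝ) (x t : ℝ) : ℝ := secErr f (x - t, x + t)

/-- The local approximation modulus `ω(f, x, ε)`; it is `∞` if no admissible `t` exists. -/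
def omega (f : ℝ → ℝ) (x ε : ℝ) : ℝ≥0∞ :=
  ⨅ t ∈ {t : ℝ | t ∈ Icc 0 (min x (1 - x)) ∧ ε ≤ secErrAt f x t}, ENNReal.ofReal t

/-- The left approximation point; it is `∞` if no admissible `t` exists. -/
def tLeft (f : ℝ → ℝ) (ε : ℝ) : ℝ≥0∞ :=
  ⨅ t ∈ {t : ℝ | t ∈ Icc (0 : ℝ) (1 / 2) ∧ ε ≤ secErrAt f t t}, ENNReal.ofReal t

/-- The right approximation point; it is `∞` if no admissible `t` exists. -/
def tRight (f : ℝ → ℝ) (ε : ℝ) : ℝ≥0∞ :=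
  ⨅ t ∈ {t : ℝ | t ∈ Icc (0 : ℝ) (1 / 2) ∧ ε ≤ secErrAt f (1 - t) t}, ENNReal.ofReal t

/-- The average approximation modulus: `1 + ∫ ω(f, x, ε)⁻¹ dx` over those `x ∈ [0,1]` with
`tLeft ≤ x ≤ 1 - tRight`. It may be infinite (when `f` jumps at an endpoint). -/
def lambdaAvg (f : ℝ → ℝ) (ε : ℝ) : ℝ≥0∞ :=
  1 + ∫⁻ x in {x : ℝ | x ∈ Icc (0 : ℝ) 1 ∧ tLeft f ε ≤ ENNReal.ofReal x ∧
        tRight f ε ≤ ENNReal.ofReal (1 - x)}, (omega f x ε)⁻¹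

/-- The uniform distance on `[0,1]`. -/
def supDist (f g : ℝ → ℝ) : ℝ≥0∞ := ⨆ x ∈ Icc (0 : ℝ) 1, edist (f x) (g x)

/-- `h` is a uniform-norm projection of `g` onto the convex functions on `[0,1]`. -/
def IsConvexProjection (h g : ℝ → ℝ) : Prop :=
  ConvexClass h ∧ ∀ k : ℝ → ℝ, ConvexClass k → supDist h g ≤ supDist k g

/-! ## The algorithm -/

/-- The anytime confidence width `φ(n, η) = √(16 σ² log(log₂(2n)/η) / n)`, with
`φ(0, η) = ∞`. -/
def phi (σ : ℝ) (n : ℕ) (η : ℝ) : EReal :=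
  if n = 0 then ⊤
  else ((√(16 * σ ^ 2 * Real.log (Real.logb 2 (2 * (n : ℝ)) / η) / (n : ℝ)) : ℝ) : EReal)

/-- Everything recorded along one execution. The index `t` counts the samples taken so far:
`x i` and `y i` (`i ≥ 1`) are the `i`-th design point and measurement; the objects with index
`t ≥ 2` are those of round `t`, which starts with `t` samples available and takes sample
number `t + 1`. The algorithm uses its tree only through the set of leaves. -/
structure Transcript where
  /-- design points -/
  x : ℕ → ℝ
  /-- measurements -/
  y : ℕ → ℝ
  /-- the leaves of the current tree of intervals -/
  leaves : ℕ → Finset (ℝ × ℝ)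
  /-- the confidence parameter attached to each point -/
  dpnt : ℕ → ℝ → ℝ
  /-- the interval selected in round `t` -/
  Istar : ℕ → ℝ × ℝ
  /-- the confidence levels `ε_t` -/
  eps : ℕ → EReal
  /-- the secant estimators -/
  fsec : ℕ → ℝ → ℝ
  /-- the convex estimators -/
  fhat : ℕ → ℝ → ℝ

namespace Transcript

variable (R : Transcript)

/-- `N_t(p)`: the number of the first `t` samples that were taken at `p`. -/
def count (t : ℕ) (p : ℝ) : ℕ := ((Finset.Icc 1 t).filter (fun i => R.x i = p)).card

/-- The average of those of the first `t` measurements that were taken at `p`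
(to be used at sampled points only). -/
def fpnt (t : ℕ) (p : ℝ) : ℝ :=
  (∑ i ∈ (Finset.Icc 1 t).filter (fun i => R.x i = p), R.y i) / (R.count t p : ℝ)

/-- `Δ(f_t^pnt, I)` for an interval whose endpoints were sampled. The point estimate is `-∞` at
a point that was not sampled, so the value is `+∞` if the midpoint was not sampled. -/
def secErrHat (t : ℕ) (I : ℝ × ℝ) : EReal :=
  if R.count t (mid I) = 0 then ⊤ else ((secErr (R.fpnt t) I : ℝ) : EReal)

/-- The confidence width at the point `p` in round `t`. -/
def width (σ : ℝ) (t : ℕ) (p : ℝ) : EReal := phi σ (R.count t p) (R.dpnt t p)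

/-- The confidence bound `B_t(I)`. -/
def bound (σ : ℝ) (t : ℕ) (I : ℝ × ℝ) : EReal :=
  R.width σ t (mid I) + ((1 / 2 : ℝ) : EReal) * max (R.width σ t I.1) (R.width σ t I.2)

/-- The quantity `B_t(I) + max {0, Δ(f_t^pnt, I)}`. -/
def score (σ : ℝ) (t : ℕ) (I : ℝ × ℝ) : EReal := R.bound σ t I + max 0 (R.secErrHat t I)

/-- The condition under which the selected interval is bisected at the end of round `t`. -/
def Splits (σ β : ℝ) (t : ℕ) : Prop :=
  ((1 + β : ℝ) : EReal) * R.bound σ t (R.Istar t) < R.secErrHat t (R.Istar t)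

/-- The left half of the interval selected in round `t`. -/
def leftHalf (t : ℕ) : ℝ × ℝ := ((R.Istar t).1, mid (R.Istar t))

/-- The right half of the interval selected in round `t`. -/
def rightHalf (t : ℕ) : ℝ × ℝ := (mid (R.Istar t), (R.Istar t).2)

end Transcript

/-- `R` is an execution of the recursive secant approximation algorithm with noise, with noise
parameter `σ`, trade-off parameter `β` and confidence parameter `δ`. All maximizers and
projections are arbitrary ones. -/
structure IsExecution (σ β δ : ℝ) (R : Transcript) : Prop where
  x_one : R.x 1 = 0
  x_two : R.x 2 = 1
  leaves_two : R.leaves 2 = {((0 : ℝ), (1 : ℝ))}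
  dpnt_two : ∀ p ∈ ({0, 1 / 2, 1} : Set ℝ), R.dpnt 2 p = δ / 6
  eps_one : R.eps 1 = ⊤
  eps_succ : ∀ t, 1 ≤ t → R.eps (t + 1) = min (R.eps t)
    ((R.leaves (t + 1)).sup fun I => ((4 : ℝ) : EReal) * R.score σ (t + 1) I)
  fsec_eq : ∀ t, 2 ≤ t → ∀ I ∈ R.leaves t, ∀ x ∈ Icc I.1 I.2,
    R.fsec t x = sec (R.fpnt t) I x
  fhat_new : ∀ t, 1 ≤ t → R.eps (t + 1) < R.eps t →
    IsConvexProjection (R.fhat (t + 1)) (R.fsec (t + 1))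
  fhat_old : ∀ t, 1 ≤ t → ¬ R.eps (t + 1) < R.eps t → R.fhat (t + 1) = R.fhat t
  Istar_mem : ∀ t, 2 ≤ t → R.Istar t ∈ R.leaves t
  Istar_max : ∀ t, 2 ≤ t → ∀ I ∈ R.leaves t, R.score σ t I ≤ R.score σ t (R.Istar t)
  x_mem : ∀ t, 2 ≤ t →
    R.x (t + 1) ∈ ({(R.Istar t).1, (R.Istar t).2, mid (R.Istar t)} : Set ℝ)
  x_max : ∀ t, 2 ≤ t → ∀ p ∈ ({(R.Istar t).1, (R.Istar t).2, mid (R.Istar t)} : Set ℝ),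
    R.width σ t p ≤ R.width σ t (R.x (t + 1))
  leaves_split : ∀ t, 2 ≤ t → R.Splits σ β t → R.leaves (t + 1) =
    insert (R.leftHalf t) (insert (R.rightHalf t) ((R.leaves t).erase (R.Istar t)))
  leaves_keep : ∀ t, 2 ≤ t → ¬ R.Splits σ β t → R.leaves (t + 1) = R.leaves t
  dpnt_split : ∀ t, 2 ≤ t → R.Splits σ β t → R.dpnt (t + 1) =
    Function.update
      (Function.update (R.dpnt t) (mid (R.leftHalf t))
        (δ / (2 * ((R.leaves t).card : ℝ) ^ 2)))
      (mid (R.rightHalf t)) (δ / (2 * ((R.leaves t).card : ℝ) ^ 2))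
  dpnt_keep : ∀ t, 2 ≤ t → ¬ R.Splits σ β t → R.dpnt (t + 1) = R.dpnt t

/-! ## The noisy oracle -/

/-- The noise variables `w 1, w 2, …` are adapted to `ℱ`, and, conditionally on `ℱ t`, the
variable `w (t + 1)` has mean zero and is `σ²`-subgaussian. -/
structure IsSubgaussianNoise {Ω : Type*} [mΩ : MeasurableSpace Ω] (μ : Measure Ω)
    (ℱ : Filtration ℕ mΩ) (σ : ℝ) (w : ℕ → Ω → ℝ) : Prop where
  adapted : ∀ t, Measurable[ℱ (t + 1)] (w (t + 1))
  condMean : ∀ t, μ[w (t + 1) | ℱ t] =ᵐ[μ] 0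
  integrable_exp : ∀ t (r : ℝ), Integrable (fun ω => Real.exp (r * w (t + 1) ω)) μ
  condExp_le : ∀ t (r : ℝ), μ[fun ω => Real.exp (r * w (t + 1) ω) | ℱ t] ≤ᵐ[μ]
    fun _ => Real.exp (r ^ 2 * σ ^ 2 / 2)

/-- The algorithm is run on the oracle `F(x) = f(x) + noise`: every outcome is an execution, the
measurements are those of the oracle, and the choices made in round `t` (the selected interval
and the design point of sample `t + 1`) are determined by the information `ℱ t`, which contains
the first `t` measurements and possibly the randomness used to break ties. -/
structure IsRunOnOracle {Ω : Type*} [mΩ : MeasurableSpace Ω] (ℱ : Filtration ℕ mΩ)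
    (f : ℝ → ℝ) (w : ℕ → Ω → ℝ) (σ β δ : ℝ) (R : Ω → Transcript) : Prop where
  execution : ∀ ω, IsExecution σ β δ (R ω)
  oracle : ∀ ω i, 1 ≤ i → (R ω).y i = f ((R ω).x i) + w i ω
  x_predictable : ∀ t, 2 ≤ t → Measurable[ℱ t] (fun ω => (R ω).x (t + 1))
  Istar_predictable : ∀ t, 2 ≤ t → Measurable[ℱ t] (fun ω => (R ω).Istar t)

/-! ## The sample complexity -/

/-- The scale factor `c = (1 - α) β / (4 (2 + β))`. -/
def cScale (α β : ℝ) : ℝ := (1 - α) * (β / (4 * (2 + β)))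

/-- The sample complexity `C Λ max{1, (1+β)²σ²/ε²} log((1/δ) Λ log(e + σ(1+β)/ε))` with
`Λ = Λ_avg(f, c ε)`; it is infinite if `Λ` is. -/
def nBar (C c σ β δ : ℝ) (f : ℝ → ℝ) (ε : ℝ) : ℝ≥0∞ :=
  if lambdaAvg f (c * ε) = ⊤ then ⊤
  else ENNReal.ofReal (C * (lambdaAvg f (c * ε)).toReal
    * max 1 ((1 + β) ^ 2 * σ ^ 2 / ε ^ 2)
    * Real.log (1 / δ * (lambdaAvg f (c * ε)).toReal
        * Real.log (Real.exp 1 + σ * (1 + β) / ε)))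

end ConvexRegression

end

/-!
Two mechanisms carry the result, one probabilistic and one deterministic.

*Concentration.* The `k`-th distinct design point receives the deterministic confidence parameter
`rankParam δ k`, and the event that a sample is taken there is predictable. For fixed `k` the noise
at that point, weighted exponentially, is therefore a supermartingale, and Ville's inequality with
peeling over the blocks `2 ^ j ≤ N < 2 ^ (j + 1)` bounds its deviations at all times
(`IsSubgaussianNoise.measure_deviation_le`). The constant `16` in the width leaves room for
deviations smaller by the factor `√2`, and the failure probabilities over all `k` still sum to at
most `δ` (`IsSubgaussianNoise.exists_good_event`). No measurability of the tree is needed, since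
leaves with an unsampled midpoint are always served first: the rank of a point then determines
how many leaves there were when it was created (`RoundInvariant`).

*Correctness.* If all averages are within their widths, the secant estimator is within twice the
largest score of the regression function (`ConvexClass.abs_sec_sub_le`); projecting onto the
convex functions at most doubles the error (`IsExecution.fhat_accurate`).

*Complexity.* As long as `ε_t > ε`, every bisected interval has secant error at least
`β / (4 * (2 + β)) * ε` (`IsExecution.le_secErr_of_splits`). Here the factor `√2` is used: within a
leaf the midpoint is sampled only when its width is the largest, so its width stays at least
`1 / √2` times the widths at the endpoints. Bisected intervals are distinct dyadic intervals, and
each of them other than `[0,1]` has, next to its midpoint and on at least one side, a fixed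
fraction of its length on which the modulus `ω` at the level lowered by `1 - α` is at most its
length. Integrating `1 / ω` bounds the number of leaves by a multiple of `Λ_avg`
(`ConvexClass.card_le_lambdaAvg`). In a round without bisection the sampled point has width at
least of order `ε / (2 + β)`, which bounds the number of such rounds per point
(`le_of_lt_phiSq`), and there are at most `2 * L + 1` points for `L` leaves
(`IsExecution.le_of_lt_eps`).
-/

noncomputable section

namespace ConvexRegression

/-! ### A maximal inequality and anytime concentration -/

section Concentration

variable {Ω : Type*} {mΩ : MeasurableSpace Ω} {μ : Measure Ω} {ℱ : Filtration ℕ mΩ}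

/-- Ville's maximal inequality for a nonnegative supermartingale, with all integrals taken in
`ℝ≥0∞` so that no integrability has to be checked. -/
theorem mul_measure_exists_le_lintegral {Z : ℕ → Ω → ℝ≥0∞}
    (hZ : ∀ n, Measurable[ℱ n] (Z n))
    (hsuper : ∀ n A, MeasurableSet[ℱ n] A → ∫⁻ ω in A, Z (n + 1) ω ∂μ ≤ ∫⁻ ω in A, Z n ω ∂μ)
    (c : ℝ≥0∞) : c * μ {ω | ∃ n, c ≤ Z n ω} ≤ ∫⁻ ω, Z 0 ω ∂μ := by
  set U : ℕ → Set Ω := fun n => ⋃ m ∈ Finset.range (n + 1), {ω | c ≤ Z m ω} with hU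
  have hlev : ∀ m n, m ≤ n → MeasurableSet[ℱ n] {ω | c ≤ Z m ω} := fun m n hmn =>
    ℱ.mono hmn _ (hZ m measurableSet_Ici)
  have hUm : ∀ n, MeasurableSet[ℱ n] (U n) := fun n =>
    Finset.measurableSet_biUnion _ fun m hm => hlev m n (Nat.lt_succ_iff.1 (Finset.mem_range.1 hm))
  have hUs : ∀ n, U (n + 1) = U n ∪ {ω | c ≤ Z (n + 1) ω} := by
    intro n
    ext ω
    simp only [hU, mem_iUnion, Finset.mem_range, mem_union, mem_ofPred_eq, exists_prop]
    constructor
    · rintro ⟨m, hm, h⟩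
      rcases Nat.lt_succ_iff_lt_or_eq.1 hm with h' | h'
      · exact Or.inl ⟨m, h', h⟩
      · exact Or.inr (h' ▸ h)
    · rintro (⟨m, hm, h⟩ | h)
      · exact ⟨m, by omega, h⟩
      · exact ⟨n + 1, by omega, h⟩
  -- The paths that have already crossed the level keep weight `c`, the others keep `Z n`.
  have key : ∀ n, c * μ (U n) + ∫⁻ ω in (U n)ᶜ, Z n ω ∂μ ≤ ∫⁻ ω, Z 0 ω ∂μ := by
    intro n
    induction n with
    | zero =>
      have h0 : U 0 = {ω | c ≤ Z 0 ω} := by ext ω; simp [hU]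
      have hm : MeasurableSet (U 0) := ℱ.le 0 _ (hUm 0)
      rw [← lintegral_add_compl (μ := μ) (Z 0) hm]
      gcongr
      rw [← setLIntegral_const]
      exact setLIntegral_mono' hm fun ω hω => by rw [h0] at hω; exact hω
    | succ n ih =>
      refine le_trans ?_ ih
      have hm : MeasurableSet (U n) := ℱ.le n _ (hUm n)
      have hm1 : MeasurableSet (U (n + 1)) := ℱ.le (n + 1) _ (hUm (n + 1))
      have h1 := hsuper n (U n)ᶜ (hUm n).compl
      have hsub : U n ⊆ U (n + 1) := by rw [hUs]; exact subset_union_left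
      have h2 : ∫⁻ ω in (U n)ᶜ, Z (n + 1) ω ∂μ
          = ∫⁻ ω in (U (n + 1) \ U n), Z (n + 1) ω ∂μ + ∫⁻ ω in (U (n + 1))ᶜ, Z (n + 1) ω ∂μ := by
        rw [← lintegral_union hm1.compl]
        · congr 2
          ext ω
          have := @hsub ω
          simp only [mem_compl_iff, mem_union, mem_sdiff]
          tauto
        · rw [Set.disjoint_left]
          intro ω h h'
          exact h' h.1
      have h3 : c * μ (U (n + 1) \ U n) ≤ ∫⁻ ω in (U (n + 1) \ U n), Z (n + 1) ω ∂μ := by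
        rw [← setLIntegral_const]
        refine setLIntegral_mono' (hm1.diff hm) fun ω hω => ?_
        rw [hUs] at hω
        exact hω.1.resolve_left hω.2
      have h4 : μ (U (n + 1)) = μ (U n) + μ (U (n + 1) \ U n) := by
        rw [← measure_union disjoint_sdiff_right (hm1.diff hm), union_sdiff_cancel hsub]
      rw [h4, mul_add, add_assoc]
      gcongr
      refine le_trans ?_ h1
      rw [h2]
      gcongr
  have hmono : Monotone U := by
    refine monotone_nat_of_le_succ fun n => ?_
    rw [hUs]
    exact subset_union_left
  have hun : {ω | ∃ n, c ≤ Z n ω} = ⋃ n, U n := by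
    ext ω
    simp only [hU, mem_iUnion, Finset.mem_range, mem_ofPred_eq, exists_prop]
    constructor
    · rintro ⟨n, h⟩
      exact ⟨n, n, by omega, h⟩
    · rintro ⟨_, n, _, h⟩
      exact ⟨n, h⟩
  rw [hun, hmono.measure_iUnion, ENNReal.mul_iSup]
  exact iSup_le fun n => le_trans le_self_add (key n)

variable {σ : ℝ} {w : ℕ → Ω → ℝ}

theorem IsSubgaussianNoise.measurable (hw : IsSubgaussianNoise μ ℱ σ w) (t : ℕ) :
    Measurable (w (t + 1)) := (hw.adapted t).mono (ℱ.le _) le_rfl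

/-- The conditional moment bound, integrated against a nonnegative predictable weight. -/
theorem IsSubgaussianNoise.lintegral_mul_exp_le [IsProbabilityMeasure μ]
    (hw : IsSubgaussianNoise μ ℱ σ w) (t : ℕ) (r : ℝ) {g : Ω → ℝ≥0∞} (hg : Measurable[ℱ t] g) :
    ∫⁻ ω, ENNReal.ofReal (Real.exp (r * w (t + 1) ω)) * g ω ∂μ
      ≤ ENNReal.ofReal (Real.exp (r ^ 2 * σ ^ 2 / 2)) * ∫⁻ ω, g ω ∂μ := by
  have hmeas : Measurable fun ω => ENNReal.ofReal (Real.exp (r * w (t + 1) ω)) :=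
    (Real.measurable_exp.comp ((hw.measurable t).const_mul r)).ennreal_ofReal
  set E := Real.exp (r ^ 2 * σ ^ 2 / 2) with hE
  set ν := μ.withDensity fun ω => ENNReal.ofReal (Real.exp (r * w (t + 1) ω)) with hν
  have hle : ν.trim (ℱ.le t) ≤ (ENNReal.ofReal E • μ).trim (ℱ.le t) := by
    rw [Measure.le_iff]
    intro A hA
    rw [trim_measurableSet_eq _ hA, trim_measurableSet_eq _ hA, hν,
      withDensity_apply _ (ℱ.le t _ hA), Measure.smul_apply, smul_eq_mul,
      ← ofReal_integral_eq_lintegral_ofReal (hw.integrable_exp t r).integrableOn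
        (Filter.Eventually.of_forall fun ω => (Real.exp_pos _).le),
      ← setIntegral_condExp (ℱ.le t) (hw.integrable_exp t r) hA]
    have h1 : ∫ ω in A, (μ[fun ω => Real.exp (r * w (t + 1) ω) | ℱ t]) ω ∂μ ≤ ∫ ω in A, E ∂μ :=
      integral_mono_ae integrable_condExp.integrableOn (integrable_const _)
        (ae_restrict_of_ae (hw.condExp_le t r))
    rw [setIntegral_const, smul_eq_mul] at h1
    calc _ ≤ ENNReal.ofReal (μ.real A * E) := ENNReal.ofReal_le_ofReal h1
      _ = _ := by
        rw [mul_comm, ENNReal.ofReal_mul (Real.exp_pos _).le, ofReal_measureReal]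
  calc ∫⁻ ω, ENNReal.ofReal (Real.exp (r * w (t + 1) ω)) * g ω ∂μ = ∫⁻ ω, g ω ∂ν := by
        rw [hν, lintegral_withDensity_eq_lintegral_mul _ hmeas (hg.mono (ℱ.le t) le_rfl)]
        rfl
    _ = ∫⁻ ω, g ω ∂(ν.trim (ℱ.le t)) := (lintegral_trim _ hg).symm
    _ ≤ ∫⁻ ω, g ω ∂((ENNReal.ofReal E • μ).trim (ℱ.le t)) := lintegral_mono' hle le_rfl
    _ = ∫⁻ ω, g ω ∂(ENNReal.ofReal E • μ) := lintegral_trim _ hg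
    _ = _ := by rw [lintegral_smul_measure, smul_eq_mul]

open Classical in
/-- The number of selected samples among the first `n`, where `A i` is the event that sample `i`
is selected. -/
def selCount (A : ℕ → Set Ω) (n : ℕ) (ω : Ω) : ℕ :=
  ((Finset.Icc 1 n).filter fun i => ω ∈ A i).card

open Classical in
/-- The sum of the noise over the selected samples among the first `n`. -/
def selSum (A : ℕ → Set Ω) (w : ℕ → Ω → ℝ) (n : ℕ) (ω : Ω) : ℝ :=
  ∑ i ∈ (Finset.Icc 1 n).filter (fun i => ω ∈ A i), w i ω

open Classical in
theorem selCount_succ (A : ℕ → Set Ω) (n : ℕ) (ω : Ω) :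
    selCount A (n + 1) ω = selCount A n ω + if ω ∈ A (n + 1) then 1 else 0 := by
  unfold selCount
  rw [Finset.card_filter, Finset.card_filter, Finset.sum_Icc_succ_top (by omega)]

open Classical in
theorem selSum_succ (A : ℕ → Set Ω) (w : ℕ → Ω → ℝ) (n : ℕ) (ω : Ω) :
    selSum A w (n + 1) ω = selSum A w n ω + if ω ∈ A (n + 1) then w (n + 1) ω else 0 := by
  unfold selSum
  rw [Finset.sum_filter, Finset.sum_filter, Finset.sum_Icc_succ_top (by omega)]

theorem measurable_add_ite {M : Type*} [AddMonoid M] [MeasurableSpace M] [MeasurableAdd₂ M]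
    {m : MeasurableSpace Ω} {A : Set Ω} {g h : Ω → M} [DecidablePred (· ∈ A)]
    (hA : MeasurableSet A) (hg : Measurable g) (hh : Measurable h) :
    Measurable fun ω => g ω + if ω ∈ A then h ω else 0 :=
  hg.add (Measurable.ite hA hh measurable_const)

theorem measurable_selCount {A : ℕ → Set Ω} (hA : ∀ n, MeasurableSet[ℱ n] (A (n + 1))) (n : ℕ) :
    Measurable[ℱ n] (selCount A n) := by
  classical
  induction n with
  | zero =>
    have : selCount A 0 = fun _ => 0 := by ext ω; simp [selCount]
    rw [this]; exact measurable_const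
  | succ n ih =>
    have : selCount A (n + 1) = fun ω => selCount A n ω + if ω ∈ A (n + 1) then 1 else 0 :=
      funext fun ω => selCount_succ A n ω
    rw [this]
    have hA' : MeasurableSet[ℱ (n + 1)] (A (n + 1)) := ℱ.mono n.le_succ _ (hA n)
    have ih' : Measurable[ℱ (n + 1)] (selCount A n) := ih.mono (ℱ.mono n.le_succ) le_rfl
    exact measurable_add_ite hA' ih' measurable_const

theorem IsSubgaussianNoise.measurable_selSum (hw : IsSubgaussianNoise μ ℱ σ w)
    {A : ℕ → Set Ω} (hA : ∀ n, MeasurableSet[ℱ n] (A (n + 1))) (n : ℕ) :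
    Measurable[ℱ n] (selSum A w n) := by
  classical
  induction n with
  | zero =>
    have : selSum A w 0 = fun _ => 0 := by ext ω; simp [selSum]
    rw [this]; exact measurable_const
  | succ n ih =>
    have : selSum A w (n + 1) =
        fun ω => selSum A w n ω + if ω ∈ A (n + 1) then w (n + 1) ω else 0 :=
      funext fun ω => selSum_succ A w n ω
    rw [this]
    have hA' : MeasurableSet[ℱ (n + 1)] (A (n + 1)) := ℱ.mono n.le_succ _ (hA n)
    have ih' : Measurable[ℱ (n + 1)] (selSum A w n) := ih.mono (ℱ.mono n.le_succ) le_rfl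
    exact measurable_add_ite hA' ih' (hw.adapted n)

/-- The exponential supermartingale of the selected noise. -/
def expProcess (A : ℕ → Set Ω) (w : ℕ → Ω → ℝ) (σ r : ℝ) (n : ℕ) (ω : Ω) : ℝ≥0∞ :=
  ENNReal.ofReal (Real.exp (r * selSum A w n ω - r ^ 2 * σ ^ 2 / 2 * selCount A n ω))

theorem IsSubgaussianNoise.measurable_expProcess (hw : IsSubgaussianNoise μ ℱ σ w)
    {A : ℕ → Set Ω} (hA : ∀ n, MeasurableSet[ℱ n] (A (n + 1))) (r : ℝ) (n : ℕ) :
    Measurable[ℱ n] (expProcess A w σ r n) := by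
  have h1 := hw.measurable_selSum hA n
  have h2 : Measurable[ℱ n] fun ω => (selCount A n ω : ℝ) :=
    (measurable_from_nat (f := fun k : ℕ => (k : ℝ))).comp (measurable_selCount hA n)
  exact ENNReal.measurable_ofReal.comp
    (Real.measurable_exp.comp ((h1.const_mul r).sub (h2.const_mul _)))

theorem IsSubgaussianNoise.setLIntegral_expProcess_le [IsProbabilityMeasure μ]
    (hw : IsSubgaussianNoise μ ℱ σ w)
    {A : ℕ → Set Ω} (hA : ∀ n, MeasurableSet[ℱ n] (A (n + 1))) (r : ℝ) (n : ℕ)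
    {B : Set Ω} (hB : MeasurableSet[ℱ n] B) :
    ∫⁻ ω in B, expProcess A w σ r (n + 1) ω ∂μ ≤ ∫⁻ ω in B, expProcess A w σ r n ω ∂μ := by
  have hA' : MeasurableSet (A (n + 1)) := ℱ.le n _ (hA n)
  have hB' : MeasurableSet B := ℱ.le n _ hB
  rw [← lintegral_inter_add_sdiff (fun ω => expProcess A w σ r (n + 1) ω) B hA',
    ← lintegral_inter_add_sdiff (fun ω => expProcess A w σ r n ω) B hA']
  refine add_le_add ?_ (le_of_eq ?_)
  · set Z := (B ∩ A (n + 1)).indicator (expProcess A w σ r n) with hZ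
    have hZm : Measurable[ℱ n] Z :=
      (hw.measurable_expProcess hA r n).indicator (hB.inter (hA n))
    set E := Real.exp (r ^ 2 * σ ^ 2 / 2) with hE
    have hEpos : 0 < E := Real.exp_pos _
    have h1 := hw.lintegral_mul_exp_le n r hZm
    rw [← lintegral_indicator (hB'.inter hA'), ← lintegral_indicator (hB'.inter hA')]
    calc ∫⁻ ω, (B ∩ A (n + 1)).indicator (expProcess A w σ r (n + 1)) ω ∂μ
        = ∫⁻ ω, ENNReal.ofReal E⁻¹ * (ENNReal.ofReal (Real.exp (r * w (n + 1) ω)) * Z ω) ∂μ := by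
          refine lintegral_congr fun ω => ?_
          by_cases hω : ω ∈ B ∩ A (n + 1)
          · rw [hZ, indicator_of_mem hω, indicator_of_mem hω, expProcess, expProcess,
              ← ENNReal.ofReal_mul (Real.exp_pos _).le,
              ← ENNReal.ofReal_mul (inv_pos.2 hEpos).le, hE, ← Real.exp_neg, ← Real.exp_add,
              ← Real.exp_add, selCount_succ, selSum_succ, if_pos hω.2, if_pos hω.2]
            congr 2
            push_cast
            ring
          · rw [hZ, indicator_of_notMem hω, indicator_of_notMem hω]
            simp
      _ = ENNReal.ofReal E⁻¹ * ∫⁻ ω, ENNReal.ofReal (Real.exp (r * w (n + 1) ω)) * Z ω ∂μ :=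
          lintegral_const_mul' _ _ ENNReal.ofReal_ne_top
      _ ≤ ENNReal.ofReal E⁻¹ * (ENNReal.ofReal E * ∫⁻ ω, Z ω ∂μ) := by gcongr
      _ = _ := by
          rw [← mul_assoc, ← ENNReal.ofReal_mul (inv_pos.2 hEpos).le,
            inv_mul_cancel₀ hEpos.ne', ENNReal.ofReal_one, one_mul]
  · refine setLIntegral_congr_fun (hB'.diff hA') fun ω hω => ?_
    simp only [expProcess]
    rw [selCount_succ, selSum_succ, if_neg hω.2, if_neg hω.2]
    simp

/-- Ville's inequality for the exponential process. -/
theorem IsSubgaussianNoise.measure_exists_exp_le [IsProbabilityMeasure μ]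
    (hw : IsSubgaussianNoise μ ℱ σ w)
    {A : ℕ → Set Ω} (hA : ∀ n, MeasurableSet[ℱ n] (A (n + 1))) (r v : ℝ) :
    μ {ω | ∃ n, v ≤ r * selSum A w n ω - r ^ 2 * σ ^ 2 / 2 * selCount A n ω}
      ≤ ENNReal.ofReal (Real.exp (-v)) := by
  have h := mul_measure_exists_le_lintegral (μ := μ) (ℱ := ℱ) (hw.measurable_expProcess hA r)
    (fun n B hB => hw.setLIntegral_expProcess_le hA r n hB) (ENNReal.ofReal (Real.exp v))
  have h0 : ∫⁻ ω, expProcess A w σ r 0 ω ∂μ = 1 := by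
    simp [expProcess, selSum, selCount]
  have hset : {ω | ∃ n, ENNReal.ofReal (Real.exp v) ≤ expProcess A w σ r n ω}
      = {ω | ∃ n, v ≤ r * selSum A w n ω - r ^ 2 * σ ^ 2 / 2 * selCount A n ω} := by
    ext ω
    simp only [mem_ofPred_eq, expProcess, ENNReal.ofReal_le_ofReal_iff (Real.exp_pos _).le,
      Real.exp_le_exp]
  rw [h0, hset] at h
  rw [Real.exp_neg, ENNReal.ofReal_inv_of_pos (Real.exp_pos _), ← one_div,
    ENNReal.le_div_iff_mul_le (Or.inl (by simp [Real.exp_pos])) (Or.inl ENNReal.ofReal_ne_top),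
    mul_comm]
  exact h

end Concentration

section Anytime

variable {Ω : Type*} {mΩ : MeasurableSpace Ω} {μ : Measure Ω} {ℱ : Filtration ℕ mΩ}
variable {σ : ℝ} {w : ℕ → Ω → ℝ}

/-- On the block `2 ^ j ≤ N < 2 ^ (j + 1)`, a deviation beyond the anytime width forces the
exponential process with parameter `√(8 ℓ / 2 ^ j) / σ` beyond `exp (3 ℓ)`. -/
theorem block_exponent_le {σ ℓ S : ℝ} {N j : ℕ} (hσ : 0 < σ) (hℓ : 0 < ℓ) (hj : 2 ^ j ≤ N)
    (hj' : N < 2 ^ (j + 1)) (hS : 0 ≤ S) (h : 8 * σ ^ 2 * N * ℓ ≤ S ^ 2) :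
    3 * ℓ ≤ √(8 * ℓ / 2 ^ j) / σ * S - (√(8 * ℓ / 2 ^ j) / σ) ^ 2 * σ ^ 2 / 2 * N := by
  have hp : (0 : ℝ) < 2 ^ j := by positivity
  set q : ℝ := N / 2 ^ j with hq
  have hN : (N : ℝ) = q * 2 ^ j := by rw [hq]; field_simp
  have hq1 : 1 ≤ q := by
    rw [hq, le_div_iff₀ hp, one_mul]; exact_mod_cast hj
  have hq2 : q ≤ 2 := by
    rw [hq, div_le_iff₀ hp]
    have : (N : ℝ) < 2 ^ (j + 1) := by exact_mod_cast hj'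
    rw [pow_succ] at this; linarith
  set z := √q with hz
  have hzq : z ^ 2 = q := Real.sq_sqrt (by linarith)
  have hz0 : 0 ≤ z := Real.sqrt_nonneg _
  have hz1 : 1 ≤ z := by rw [hz]; exact Real.one_le_sqrt.2 hq1
  have hz2 : z ≤ 3 / 2 := by nlinarith
  have hlin : 8 * ℓ * z ≤ √(8 * ℓ / 2 ^ j) / σ * S := by
    have hS' : σ * √(8 * (q * 2 ^ j) * ℓ) ≤ S := by
      refine le_of_sq_le_sq ?_ hS
      rw [mul_pow, Real.sq_sqrt (by positivity)]
      rw [hN] at h; linarith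
    calc 8 * ℓ * z = √(8 * ℓ / 2 ^ j) * √(8 * (q * 2 ^ j) * ℓ) := by
          rw [← Real.sqrt_mul (by positivity)]
          have : 8 * ℓ / 2 ^ j * (8 * (q * 2 ^ j) * ℓ) = (8 * ℓ * z) ^ 2 := by
            rw [mul_pow, hzq]; field_simp
          rw [this, Real.sqrt_sq (by positivity)]
      _ = √(8 * ℓ / 2 ^ j) / σ * (σ * √(8 * (q * 2 ^ j) * ℓ)) := by field_simp
      _ ≤ _ := by gcongr
  have hquad : (√(8 * ℓ / 2 ^ j) / σ) ^ 2 * σ ^ 2 / 2 * N = 4 * ℓ * z ^ 2 := by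
    rw [div_pow, Real.sq_sqrt (by positivity), hN, hzq]
    field_simp
    ring
  rw [hquad]
  nlinarith [mul_nonneg hℓ.le (mul_nonneg (sub_nonneg.2 hz1) (sub_nonneg.2 hz2)),
    mul_nonneg hℓ.le (sub_nonneg.2 hz2), mul_nonneg hℓ.le (sub_nonneg.2 hz1)]

theorem tsum_inv_sq_le_two : ∑' j : ℕ, (1 / ((j : ℝ) + 1) ^ 2) ≤ 2 ∧
    Summable fun j : ℕ => 1 / ((j : ℝ) + 1) ^ 2 := by
  have h := hasSum_zeta_two
  have hs : Summable fun j : ℕ => 1 / ((j : ℝ) + 1) ^ 2 := by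
    have := (summable_nat_add_iff 1).2 h.summable
    simpa using this
  refine ⟨?_, hs⟩
  have h1 := h.summable.tsum_eq_zero_add
  rw [h.tsum_eq] at h1
  have h2 : ∑' j : ℕ, (1 / ((j : ℝ) + 1) ^ 2) = Real.pi ^ 2 / 6 := by
    rw [h1]; simp
  rw [h2]
  have := Real.pi_lt_d2
  have := Real.pi_pos
  nlinarith

/-- Without noise amplitude the noise vanishes: `exp w + exp (-w) ≥ 2`, with equality only
at `0`. -/
theorem IsSubgaussianNoise.ae_eq_zero [IsProbabilityMeasure μ]
    (hw : IsSubgaussianNoise μ ℱ 0 w) (t : ℕ) : w (t + 1) =ᵐ[μ] 0 := by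
  have hint : ∀ r : ℝ, ∫ ω, Real.exp (r * w (t + 1) ω) ∂μ ≤ 1 := by
    intro r
    rw [← integral_condExp (ℱ.le t)]
    calc _ ≤ ∫ ω, (1 : ℝ) ∂μ := integral_mono_ae integrable_condExp (integrable_const _) (by
            filter_upwards [hw.condExp_le t r] with ω hω
            simpa using hω)
      _ = 1 := by simp
  have hi := ((hw.integrable_exp t 1).add (hw.integrable_exp t (-1))).sub (integrable_const 2)
  have hge : ∀ z : ℝ, z ≠ 0 → 0 < Real.exp (1 * z) + Real.exp (-1 * z) - 2 := by
    intro z hz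
    have h1 := Real.add_one_lt_exp (x := 1 * z) (by simpa using hz)
    have h2 := Real.add_one_lt_exp (x := -1 * z) (by simpa using hz)
    linarith
  have hnn : 0 ≤ᵐ[μ] fun ω => Real.exp (1 * w (t + 1) ω) + Real.exp (-1 * w (t + 1) ω) - 2 := by
    refine Filter.Eventually.of_forall fun ω => ?_
    by_cases h : w (t + 1) ω = 0
    · simp [h]; norm_num
    · exact (hge _ h).le
  have hzero : ∫ ω, (Real.exp (1 * w (t + 1) ω) + Real.exp (-1 * w (t + 1) ω) - 2) ∂μ = 0 := by
    refine le_antisymm ?_ (integral_nonneg_of_ae hnn)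
    have h3 := integral_add (hw.integrable_exp t 1) (hw.integrable_exp t (-1))
    have h4 := integral_sub ((hw.integrable_exp t 1).add (hw.integrable_exp t (-1)))
      (integrable_const (μ := μ) (2 : ℝ))
    simp only [Pi.add_apply] at h4
    rw [h4, h3]
    have := hint 1
    have := hint (-1)
    simp only [integral_const, probReal_univ, smul_eq_mul]
    linarith
  have h0 := (integral_eq_zero_iff_of_nonneg_ae hnn hi).1 hzero
  filter_upwards [h0] with ω hω
  by_contra h
  exact (hge _ h).ne' hω

/-- Anytime concentration of the selected noise, uniformly over the sample size. The squared
deviation allowed here is half of the square of the confidence width `phi`. -/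
theorem IsSubgaussianNoise.measure_deviation_le [IsProbabilityMeasure μ]
    (hw : IsSubgaussianNoise μ ℱ σ w) (hσ : 0 ≤ σ)
    {A : ℕ → Set Ω} (hA : ∀ n, MeasurableSet[ℱ n] (A (n + 1))) {η : ℝ} (hη : 0 < η)
    (hη' : η ≤ 1 / 4) :
    μ {ω | ∃ n, 0 < selCount A n ω ∧ 8 * σ ^ 2 * selCount A n ω
        * Real.log (Real.logb 2 (2 * (selCount A n ω : ℝ)) / η) < selSum A w n ω ^ 2}
      ≤ ENNReal.ofReal (η ^ 2) := by
  rcases hσ.eq_or_lt with rfl | hσ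
  · have h0 : ∀ᵐ ω ∂μ, ∀ t, w (t + 1) ω = 0 := ae_all_iff.2 fun t => hw.ae_eq_zero t
    refine le_trans (le_of_eq ?_) zero_le
    rw [measure_eq_zero_iff_ae_notMem]
    filter_upwards [h0] with ω hω
    rintro ⟨n, -, h⟩
    have : selSum A w n ω = 0 := by
      classical
      refine Finset.sum_eq_zero fun i hi => ?_
      rw [Finset.mem_filter, Finset.mem_Icc] at hi
      have := hω (i - 1)
      rwa [Nat.sub_add_cancel hi.1.1] at this
    simp [this] at h
  set ℓ : ℕ → ℝ := fun j => Real.log (((j : ℝ) + 1) / η) with hℓ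
  have hℓpos : ∀ j, 0 < ℓ j := fun j => Real.log_pos (by
    rw [one_lt_div hη]
    have : (0 : ℝ) ≤ j := j.cast_nonneg
    linarith)
  set r : ℕ → ℝ := fun j => √(8 * ℓ j / 2 ^ j) / σ with hr
  set E : ℝ → ℕ → Set Ω := fun s j => {ω | ∃ n, 3 * ℓ j ≤
    s * r j * selSum A w n ω - (s * r j) ^ 2 * σ ^ 2 / 2 * selCount A n ω} with hE
  have hEμ : ∀ s j, μ (E s j) ≤ ENNReal.ofReal (η ^ 3 * (1 / ((j : ℝ) + 1) ^ 2)) := by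
    intro s j
    refine (hw.measure_exists_exp_le hA (s * r j) (3 * ℓ j)).trans (ENNReal.ofReal_le_ofReal ?_)
    have h1 : Real.exp (-(3 * ℓ j)) = (η / ((j : ℝ) + 1)) ^ 3 := by
      have : -(3 * ℓ j) = (3 : ℕ) * (-ℓ j) := by push_cast; ring
      rw [this, Real.exp_nat_mul, hℓ, Real.exp_neg, Real.exp_log (by positivity), inv_div]
    rw [h1, div_pow, mul_one_div]
    gcongr
    · have : (0 : ℝ) ≤ j := j.cast_nonneg
      linarith
    · norm_num
  have hsub : {ω | ∃ n, 0 < selCount A n ω ∧ 8 * σ ^ 2 * selCount A n ω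
      * Real.log (Real.logb 2 (2 * (selCount A n ω : ℝ)) / η) < selSum A w n ω ^ 2}
      ⊆ ⋃ j, (E 1 j ∪ E (-1) j) := by
    rintro ω ⟨n, hN, hdev⟩
    set N := selCount A n ω
    set S := selSum A w n ω
    set j := Nat.log 2 N
    have hj : 2 ^ j ≤ N := Nat.pow_log_le_self 2 hN.ne'
    have hj' : N < 2 ^ (j + 1) := Nat.lt_pow_succ_log_self (by norm_num) N
    have hlog : ℓ j ≤ Real.log (Real.logb 2 (2 * (N : ℝ)) / η) := by
      refine Real.log_le_log (by positivity) ?_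
      gcongr
      rw [Real.le_logb_iff_rpow_le (by norm_num) (by positivity)]
      have : ((2 : ℝ) ^ ((j : ℝ) + 1)) = 2 * 2 ^ j := by
        rw [Real.rpow_add (by norm_num), Real.rpow_natCast]; simp [mul_comm]
      rw [this]
      have : (2 : ℝ) ^ j ≤ N := by exact_mod_cast hj
      linarith
    have hdev' : 8 * σ ^ 2 * N * ℓ j ≤ |S| ^ 2 := by
      rw [sq_abs]
      refine le_trans ?_ hdev.le
      gcongr
    have hb := block_exponent_le hσ (hℓpos j) hj hj' (abs_nonneg S) hdev'
    rw [mem_iUnion]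
    refine ⟨j, ?_⟩
    rcases abs_cases S with ⟨hs, -⟩ | ⟨hs, -⟩ <;> rw [hs] at hb
    · refine Or.inl ⟨n, ?_⟩
      simpa [hr] using hb
    · refine Or.inr ⟨n, ?_⟩
      have : -1 * r j * S - (-1 * r j) ^ 2 * σ ^ 2 / 2 * N
        = r j * -S - (r j) ^ 2 * σ ^ 2 / 2 * N := by ring
      exact hb.trans_eq this.symm
  obtain ⟨h2, hs⟩ := tsum_inv_sq_le_two
  calc _ ≤ μ (⋃ j, (E 1 j ∪ E (-1) j)) := measure_mono hsub
    _ ≤ ∑' j, μ (E 1 j ∪ E (-1) j) := measure_iUnion_le _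
    _ ≤ ∑' j : ℕ, ENNReal.ofReal (2 * η ^ 3 * (1 / ((j : ℝ) + 1) ^ 2)) := by
        refine ENNReal.tsum_le_tsum fun j => (measure_union_le _ _).trans ?_
        refine (add_le_add (hEμ 1 j) (hEμ (-1) j)).trans ?_
        rw [← ENNReal.ofReal_add (by positivity) (by positivity)]
        exact ENNReal.ofReal_le_ofReal (by linarith)
    _ = ENNReal.ofReal (∑' j : ℕ, 2 * η ^ 3 * (1 / ((j : ℝ) + 1) ^ 2)) :=
        (ENNReal.ofReal_tsum_of_nonneg (fun j => by positivity) (hs.mul_left _)).symm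
    _ ≤ _ := by
        refine ENNReal.ofReal_le_ofReal ?_
        rw [tsum_mul_left]
        calc 2 * η ^ 3 * _ ≤ 2 * η ^ 3 * 2 := by gcongr
          _ = (4 * η) * η ^ 2 := by ring
          _ ≤ 1 * η ^ 2 := by gcongr; linarith
          _ = η ^ 2 := one_mul _

end Anytime

/-! ### The sequence of distinct design points -/

/-- Sample `j` is the first one at its design point. -/
def Fresh (x : ℕ → ℝ) (j : ℕ) : Prop := ∀ b ∈ Finset.Ico 1 j, x b ≠ x j

open Classical in
/-- The number of distinct points among the first `t` design points. -/
def distinctCount (x : ℕ → ℝ) (t : ℕ) : ℕ := ((Finset.Icc 1 t).filter (Fresh x)).card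

/-- The confidence parameter of the `k`-th distinct design point. A tree with `L ≥ 2` leaves
receives its last two midpoints, of ranks `2 * L` and `2 * L + 1`, from the bisection of a leaf
of a tree with `L - 1` leaves. -/
def rankParam (δ : ℝ) (k : ℕ) : ℝ :=
  if k ≤ 3 then δ / 6 else δ / (2 * ((k / 2 - 1 : ℕ) : ℝ) ^ 2)

theorem distinctCount_mono (x : ℕ → ℝ) : Monotone (distinctCount x) := fun s t h => by
  classical
  exact Finset.card_le_card (Finset.filter_subset_filter _ (Finset.Icc_subset_Icc_right h))

theorem distinctCount_succ_of_fresh {x : ℕ → ℝ} {t : ℕ} (h : Fresh x (t + 1)) :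
    distinctCount x (t + 1) = distinctCount x t + 1 := by
  classical
  unfold distinctCount
  rw [Finset.card_filter, Finset.card_filter, Finset.sum_Icc_succ_top (by omega), if_pos h]

theorem distinctCount_succ_of_not_fresh {x : ℕ → ℝ} {t : ℕ} (h : ¬ Fresh x (t + 1)) :
    distinctCount x (t + 1) = distinctCount x t := by
  classical
  unfold distinctCount
  rw [Finset.card_filter, Finset.card_filter, Finset.sum_Icc_succ_top (by omega), if_neg h,
    add_zero]

theorem distinctCount_lt {x : ℕ → ℝ} {s t : ℕ} (hst : s < t) (h : Fresh x t) :
    distinctCount x s < distinctCount x t := by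
  obtain ⟨t, rfl⟩ : ∃ u, t = u + 1 := ⟨t - 1, by omega⟩
  rw [distinctCount_succ_of_fresh h]
  exact Nat.lt_succ_of_le (distinctCount_mono x (by omega))

theorem eq_of_distinctCount_eq {x : ℕ → ℝ} {s t : ℕ} (hs : Fresh x s) (ht : Fresh x t)
    (h : distinctCount x s = distinctCount x t) : s = t := by
  rcases lt_trichotomy s t with hst | hst | hst
  · exact absurd h (distinctCount_lt hst ht).ne
  · exact hst
  · exact absurd h (distinctCount_lt hst hs).ne'

theorem one_le_distinctCount {x : ℕ → ℝ} {t : ℕ} (ht : 1 ≤ t) : 1 ≤ distinctCount x t := by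
  have h : distinctCount x (0 + 1) = distinctCount x 0 + 1 :=
    distinctCount_succ_of_fresh fun b hb => by simp at hb
  have := distinctCount_mono x ht
  simp only [zero_add] at h
  omega

theorem exists_fresh {x : ℕ → ℝ} {i : ℕ} (hi : 1 ≤ i) :
    ∃ j ∈ Finset.Icc 1 i, Fresh x j ∧ x j = x i := by
  classical
  have hex : ∃ j, 1 ≤ j ∧ x j = x i := ⟨i, hi, rfl⟩
  obtain ⟨h1, h2⟩ := Nat.find_spec hex
  refine ⟨Nat.find hex, Finset.mem_Icc.2 ⟨h1, Nat.find_min' hex ⟨hi, rfl⟩⟩,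
    fun b hb hxb => ?_, h2⟩
  rw [Finset.mem_Ico] at hb
  exact Nat.find_min hex hb.2 ⟨hb.1, hxb.trans h2⟩

section GoodEvent

variable {Ω : Type*} {mΩ : MeasurableSpace Ω} {μ : Measure Ω} {ℱ : Filtration ℕ mΩ}
variable {σ δ : ℝ} {w x : ℕ → Ω → ℝ}

theorem measurableSet_fresh (hx : ∀ n, Measurable[ℱ n] (x (n + 1))) (n : ℕ) :
    MeasurableSet[ℱ n] {ω | Fresh (fun i => x i ω) (n + 1)} := by
  have : {ω | Fresh (fun i => x i ω) (n + 1)}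
      = ⋂ b ∈ Finset.Ico 1 (n + 1), {ω | x b ω = x (n + 1) ω}ᶜ := by
    ext ω; simp [Fresh]
  rw [this]
  refine Finset.measurableSet_biInter _ fun b hb => ?_
  rw [Finset.mem_Ico] at hb
  have hb' : Measurable[ℱ n] (x b) := by
    have := hx (b - 1)
    rw [Nat.sub_add_cancel hb.1] at this
    exact this.mono (ℱ.mono (by omega)) le_rfl
  exact MeasurableSet.compl (measurableSet_eq_fun hb' (hx n))

theorem measurable_distinctCount (hx : ∀ n, Measurable[ℱ n] (x (n + 1))) (n : ℕ) :
    Measurable[ℱ n] fun ω => distinctCount (fun i => x i ω) (n + 1) := by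
  classical
  have h : ∀ n, (fun ω => distinctCount (fun i => x i ω) (n + 1)) =
      fun ω => distinctCount (fun i => x i ω) n +
        if ω ∈ {ω | Fresh (fun i => x i ω) (n + 1)} then 1 else 0 := by
    intro n
    ext ω
    split_ifs with h
    · exact distinctCount_succ_of_fresh h
    · exact distinctCount_succ_of_not_fresh h
  induction n with
  | zero =>
    rw [h]
    refine measurable_add_ite (measurableSet_fresh hx 0) ?_ measurable_const
    simp only [distinctCount, Finset.Icc_eq_empty_of_lt zero_lt_one, Finset.filter_empty,
      Finset.card_empty]
    exact measurable_const
  | succ n ih =>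
    rw [h]
    exact measurable_add_ite (measurableSet_fresh hx (n + 1))
      (ih.mono (ℱ.mono n.le_succ) le_rfl) measurable_const

/-- The event that sample `i` is taken at the `k`-th distinct design point. -/
def rankEvent (x : ℕ → Ω → ℝ) (k i : ℕ) : Set Ω :=
  {ω | ∃ j ∈ Finset.Icc 1 i, Fresh (fun i => x i ω) j ∧ distinctCount (fun i => x i ω) j = k
    ∧ x i ω = x j ω}

theorem measurableSet_rankEvent (hx : ∀ n, Measurable[ℱ n] (x (n + 1))) (k n : ℕ) :
    MeasurableSet[ℱ n] (rankEvent x k (n + 1)) := by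
  have : rankEvent x k (n + 1) = ⋃ j ∈ Finset.Icc 1 (n + 1),
      ({ω | Fresh (fun i => x i ω) j} ∩ ({ω | distinctCount (fun i => x i ω) j = k}
        ∩ {ω | x (n + 1) ω = x j ω})) := by
    ext ω
    simp only [rankEvent, mem_ofPred_eq, mem_iUnion, mem_inter_iff, exists_prop]
  rw [this]
  refine Finset.measurableSet_biUnion _ fun j hj => ?_
  rw [Finset.mem_Icc] at hj
  obtain ⟨j, rfl⟩ : ∃ u, j = u + 1 := ⟨j - 1, by omega⟩
  have hle : ℱ j ≤ ℱ n := ℱ.mono (by omega)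
  have h1 : MeasurableSet[ℱ n] {ω | Fresh (fun i => x i ω) (j + 1)} :=
    hle _ (measurableSet_fresh hx j)
  have h2 : MeasurableSet[ℱ n] {ω | distinctCount (fun i => x i ω) (j + 1) = k} :=
    hle _ (measurable_distinctCount hx j (measurableSet_singleton k))
  have h3 : MeasurableSet[ℱ n] {ω | x (n + 1) ω = x (j + 1) ω} :=
    measurableSet_eq_fun (hx n) ((hx j).mono hle le_rfl)
  exact h1.inter (h2.inter h3)

theorem rankParam_pos (hδ : 0 < δ) (k : ℕ) : 0 < rankParam δ k := by
  unfold rankParam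
  split_ifs with h
  · positivity
  · have : 1 ≤ k / 2 - 1 := by omega
    have : (1 : ℝ) ≤ ((k / 2 - 1 : ℕ) : ℝ) := by exact_mod_cast this
    positivity

theorem rankParam_le (hδ : 0 < δ) (hδ' : δ < 1 / 2) (k : ℕ) : rankParam δ k ≤ 1 / 4 := by
  unfold rankParam
  split_ifs with h
  · linarith
  · have : 1 ≤ k / 2 - 1 := by omega
    have : (1 : ℝ) ≤ ((k / 2 - 1 : ℕ) : ℝ) := by exact_mod_cast this
    rw [div_le_iff₀ (by positivity)]
    nlinarith

/-- The failure probabilities of all design points together are at most `δ`. -/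
theorem tsum_rankParam_sq_le (hδ : 0 < δ) (hδ' : δ < 1 / 2) :
    ∑' k, ENNReal.ofReal (rankParam δ (k + 1) ^ 2) ≤ ENNReal.ofReal δ := by
  obtain ⟨h2, hs⟩ := tsum_inv_sq_le_two
  -- For `k ≥ 3` the pairs of equal terms are bounded by multiples of `1 / (j + 1) ^ 2`.
  have hodd : ∀ j : ℕ, rankParam δ (2 * j + 3 + 1) ^ 2 ≤ δ ^ 2 / 4 * (1 / ((j : ℝ) + 1) ^ 2) ∧
      rankParam δ (2 * j + 1 + 3 + 1) ^ 2 ≤ δ ^ 2 / 4 * (1 / ((j : ℝ) + 1) ^ 2) := by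
    intro j
    have e1 : (2 * j + 3 + 1) / 2 - 1 = j + 1 := by omega
    have e2 : (2 * j + 1 + 3 + 1) / 2 - 1 = j + 1 := by omega
    have hb : (δ / (2 * ((j + 1 : ℕ) : ℝ) ^ 2)) ^ 2 ≤ δ ^ 2 / 4 * (1 / ((j : ℝ) + 1) ^ 2) := by
      push_cast
      have h1 : (1 : ℝ) ≤ (j : ℝ) + 1 := by
        have : (0 : ℝ) ≤ j := j.cast_nonneg
        linarith
      rw [div_pow, mul_pow, div_mul_div_comm, mul_one]
      refine div_le_div_of_nonneg_left (by positivity) (by positivity) ?_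
      nlinarith [one_le_pow₀ h1 (n := 2)]
    constructor
    · rw [rankParam, if_neg (by omega), e1]; exact hb
    · rw [rankParam, if_neg (by omega), e2]; exact hb
  have hsplit := Summable.sum_add_tsum_nat_add' (k := 3)
    (f := fun k => ENNReal.ofReal (rankParam δ (k + 1) ^ 2)) ENNReal.summable
  have hpair := tsum_even_add_odd (f := fun k => ENNReal.ofReal (rankParam δ (k + 3 + 1) ^ 2))
    ENNReal.summable ENNReal.summable
  have hhalf : ENNReal.ofReal (∑' j : ℕ, δ ^ 2 / 4 * (1 / ((j : ℝ) + 1) ^ 2))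
      ≤ ENNReal.ofReal (δ ^ 2 / 2) := by
    refine ENNReal.ofReal_le_ofReal ?_
    rw [tsum_mul_left]
    nlinarith [sq_nonneg δ]
  have hA : ∑' j : ℕ, ENNReal.ofReal (rankParam δ (2 * j + 3 + 1) ^ 2)
      ≤ ENNReal.ofReal (δ ^ 2 / 2) := by
    refine le_trans ?_ hhalf
    rw [ENNReal.ofReal_tsum_of_nonneg (fun j => by positivity) (hs.mul_left _)]
    exact ENNReal.tsum_le_tsum fun j => ENNReal.ofReal_le_ofReal (hodd j).1
  have hB : ∑' j : ℕ, ENNReal.ofReal (rankParam δ (2 * j + 1 + 3 + 1) ^ 2)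
      ≤ ENNReal.ofReal (δ ^ 2 / 2) := by
    refine le_trans ?_ hhalf
    rw [ENNReal.ofReal_tsum_of_nonneg (fun j => by positivity) (hs.mul_left _)]
    exact ENNReal.tsum_le_tsum fun j => ENNReal.ofReal_le_ofReal (hodd j).2
  have h3 : ∑ k ∈ Finset.range 3, ENNReal.ofReal (rankParam δ (k + 1) ^ 2)
      = ENNReal.ofReal (δ ^ 2 / 12) := by
    simp only [Finset.sum_range_succ, Finset.sum_range_zero, rankParam]
    norm_num
    rw [← ENNReal.ofReal_add (by positivity) (by positivity),
      ← ENNReal.ofReal_add (by positivity) (by positivity)]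
    congr 1
    ring
  rw [← hsplit, ← hpair, h3]
  refine (add_le_add le_rfl (add_le_add hA hB)).trans ?_
  rw [← ENNReal.ofReal_add (by positivity) (by positivity),
    ← ENNReal.ofReal_add (by positivity) (by positivity)]
  refine ENNReal.ofReal_le_ofReal ?_
  nlinarith

open Classical in
/-- With probability at least `1 - δ`, the averages at all design points respect, at all times,
the anytime confidence widths reduced by the factor `√2`. -/
theorem IsSubgaussianNoise.exists_good_event [IsProbabilityMeasure μ]
    (hw : IsSubgaussianNoise μ ℱ σ w) (hσ : 0 ≤ σ) (hδ : 0 < δ) (hδ' : δ < 1 / 2)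
    (hx : ∀ n, Measurable[ℱ n] (x (n + 1))) :
    ∃ G : Set Ω, MeasurableSet G ∧ ENNReal.ofReal (1 - δ) ≤ μ G ∧
      ∀ ω ∈ G, ∀ t j, j ∈ Finset.Icc 1 t → Fresh (fun i => x i ω) j →
        (∑ i ∈ (Finset.Icc 1 t).filter (fun i => x i ω = x j ω), w i ω) ^ 2 ≤
          8 * σ ^ 2 * ((Finset.Icc 1 t).filter fun i => x i ω = x j ω).card *
            Real.log (Real.logb 2
              (2 * (((Finset.Icc 1 t).filter fun i => x i ω = x j ω).card : ℝ))
              / rankParam δ (distinctCount (fun i => x i ω) j)) := by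
  set bad : ℕ → Set Ω := fun k => {ω | ∃ n, 0 < selCount (rankEvent x (k + 1)) n ω ∧
    8 * σ ^ 2 * selCount (rankEvent x (k + 1)) n ω
        * Real.log
          (Real.logb 2 (2 * (selCount (rankEvent x (k + 1)) n ω : ℝ)) / rankParam δ (k + 1))
      < selSum (rankEvent x (k + 1)) w n ω ^ 2} with hbad
  have hbm : ∀ k, MeasurableSet (bad k) := by
    intro k
    have : bad k = ⋃ n, ({ω | 0 < selCount (rankEvent x (k + 1)) n ω} ∩
        {ω | 8 * σ ^ 2 * selCount (rankEvent x (k + 1)) n ω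
        * Real.log
          (Real.logb 2 (2 * (selCount (rankEvent x (k + 1)) n ω : ℝ)) / rankParam δ (k + 1))
      < selSum (rankEvent x (k + 1)) w n ω ^ 2}) := by
      ext ω; simp [hbad]
    rw [this]
    refine MeasurableSet.iUnion fun n => ?_
    have hc : Measurable (selCount (rankEvent x (k + 1)) n) :=
      (measurable_selCount (measurableSet_rankEvent hx (k + 1)) n).mono (ℱ.le n) le_rfl
    have hS : Measurable (selSum (rankEvent x (k + 1)) w n) :=
      (hw.measurable_selSum (measurableSet_rankEvent hx (k + 1)) n).mono (ℱ.le n) le_rfl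
    refine (hc (measurableSet_Ioi (a := 0))).inter (measurableSet_lt ?_ (hS.pow_const 2))
    exact (measurable_from_nat (f := fun N : ℕ => 8 * σ ^ 2 * (N : ℝ) *
      Real.log (Real.logb 2 (2 * (N : ℝ)) / rankParam δ (k + 1)))).comp hc
  refine ⟨(⋃ k, bad k)ᶜ, (MeasurableSet.iUnion hbm).compl, ?_, ?_⟩
  · have hle : μ (⋃ k, bad k) ≤ ENNReal.ofReal δ :=
      (measure_iUnion_le _).trans ((ENNReal.tsum_le_tsum fun k =>
        hw.measure_deviation_le hσ (measurableSet_rankEvent hx (k + 1)) (rankParam_pos hδ _)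
          (rankParam_le hδ hδ' _)).trans (tsum_rankParam_sq_le hδ hδ'))
    rw [prob_compl_eq_one_sub (MeasurableSet.iUnion hbm), ENNReal.ofReal_sub _ hδ.le,
      ENNReal.ofReal_one]
    exact tsub_le_tsub_left hle 1
  · intro ω hω t j hj hf
    obtain ⟨k, hk⟩ : ∃ k, distinctCount (fun i => x i ω) j = k + 1 :=
      ⟨distinctCount (fun i => x i ω) j - 1, by
        have := one_le_distinctCount (x := fun i => x i ω) (Finset.mem_Icc.1 hj).1
        omega⟩
    have hfil : (Finset.Icc 1 t).filter (fun i => ω ∈ rankEvent x (k + 1) i)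
        = (Finset.Icc 1 t).filter fun i => x i ω = x j ω := by
      refine Finset.filter_congr fun i hi => ⟨?_, fun h => ?_⟩
      · rintro ⟨j', -, hf', hk', h⟩
        rwa [eq_of_distinctCount_eq hf' hf (hk'.trans hk.symm)] at h
      · refine ⟨j, ?_, hf, hk, h⟩
        rw [Finset.mem_Icc] at hi hj ⊢
        refine ⟨hj.1, ?_⟩
        by_contra hlt
        exact hf i (Finset.mem_Ico.2 ⟨hi.1, by omega⟩) h
    have hnot : ω ∉ bad k := fun h => hω (mem_iUnion.2 ⟨k, h⟩)
    have hcard : selCount (rankEvent x (k + 1)) t ω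
        = ((Finset.Icc 1 t).filter fun i => x i ω = x j ω).card := by
      rw [selCount, ← hfil]
    have hsum : selSum (rankEvent x (k + 1)) w t ω
        = ∑ i ∈ (Finset.Icc 1 t).filter (fun i => x i ω = x j ω), w i ω := by
      rw [selSum, ← hfil]
    rw [← hcard, ← hsum, hk]
    by_contra hlt
    refine hnot ⟨t, ?_, not_le.1 hlt⟩
    rw [hcard]
    exact Finset.card_pos.2 ⟨j, Finset.mem_filter.2 ⟨hj, rfl⟩⟩

end GoodEvent

/-! ### Intervals with a large secant error and the average approximation modulus -/

/-- `I` is a dyadic subinterval of `[0,1]`. -/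
def IsDyadic (I : ℝ × ℝ) : Prop :=
  ∃ k j : ℕ, j < 2 ^ k ∧ I = ((j : ℝ) / 2 ^ k, ((j : ℝ) + 1) / 2 ^ k)

theorem ConvexClass.le_combination {f : ℝ → ℝ} (hf : ConvexClass f) {a b x θ : ℝ} (ha : 0 ≤ a)
    (ha' : a ≤ 1) (hb : 0 ≤ b) (hb' : b ≤ 1) (hθ : 0 ≤ θ) (hθ' : θ ≤ 1)
    (hx : x = θ * a + (1 - θ) * b) : f x ≤ θ * f a + (1 - θ) * f b := by
  have := hf.2 ⟨ha, ha'⟩ ⟨hb, hb'⟩ hθ (sub_nonneg.2 hθ') (by ring)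
  simpa [hx] using this

theorem ConvexClass.comp_one_sub {f : ℝ → ℝ} (hf : ConvexClass f) :
    ConvexClass fun x => f (1 - x) := by
  refine ⟨convex_Icc 0 1, fun x hx y hy a b ha hb hab => ?_⟩
  have h := hf.2 (x := 1 - x) (y := 1 - y) ⟨by linarith [hx.2], by linarith [hx.1]⟩
    ⟨by linarith [hy.2], by linarith [hy.1]⟩ ha hb hab
  have e : a • (1 - x) + b • (1 - y) = 1 - (a • x + b • y) := by
    simp only [smul_eq_mul]; linear_combination hab
  rwa [e] at h

/-- Moving one endpoint of an interval outwards by `2 * s` costs at most the stated factor of the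
secant error: the error of the larger secant is at least that of the smaller one, and it is
concave along the larger interval. -/
theorem ConvexClass.mul_secErr_le_extend_right {f : ℝ → ℝ} (hf : ConvexClass f) {l r s : ℝ}
    (hl : 0 ≤ l) (hlr : l < r) (hs : 0 ≤ s) (hr : r + 2 * s ≤ 1) :
    ((r - l) / 2 + s) * secErr f (l, r) ≤ ((r - l) / 2 + 2 * s) * secErr f (l, r + 2 * s) := by
  set h := r - l with hh
  have hpos : 0 < h := by rw [hh]; linarith
  clear_value h
  have hrl : r = l + h := by linarith
  have hr1 := hf.le_combination (a := l) (b := r + 2 * s) (x := r) (θ := 2 * s / (h + 2 * s)) hl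
    (by linarith) (by linarith) hr (by positivity) ((div_le_one (by positivity)).2 (by linarith))
    (by rw [hrl]; field_simp; ring)
  have hm1 := hf.le_combination (a := (l + r) / 2) (b := r + 2 * s) (x := (l + (r + 2 * s)) / 2)
    (θ := (h / 2 + s) / (h / 2 + 2 * s)) (by linarith) (by linarith) (by linarith) hr
    (by positivity) ((div_le_one (by positivity)).2 (by linarith)) (by rw [hrl]; field_simp; ring)
  have e1 : (h + 2 * s) * f r ≤ 2 * s * f l + h * f (r + 2 * s) := by
    calc (h + 2 * s) * f r ≤ (h + 2 * s) * (2 * s / (h + 2 * s) * f l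
          + (1 - 2 * s / (h + 2 * s)) * f (r + 2 * s)) := by gcongr
      _ = _ := by field_simp; ring
  have e2 : (h / 2 + 2 * s) * f ((l + (r + 2 * s)) / 2) ≤
      (h / 2 + s) * f ((l + r) / 2) + s * f (r + 2 * s) := by
    calc _ ≤ (h / 2 + 2 * s) * ((h / 2 + s) / (h / 2 + 2 * s) * f ((l + r) / 2)
          + (1 - (h / 2 + s) / (h / 2 + 2 * s)) * f (r + 2 * s)) := by gcongr
      _ = _ := by field_simp; ring
  simp only [secErr, mid]
  linarith

theorem ConvexClass.mul_secErr_le_extend_left {f : ℝ → ℝ} (hf : ConvexClass f) {l r s : ℝ}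
    (hl : 0 ≤ l - 2 * s) (hlr : l < r) (hs : 0 ≤ s) (hr : r ≤ 1) :
    ((r - l) / 2 + s) * secErr f (l, r) ≤ ((r - l) / 2 + 2 * s) * secErr f (l - 2 * s, r) := by
  have h := hf.comp_one_sub.mul_secErr_le_extend_right (l := 1 - r) (r := 1 - l) (s := s)
    (by linarith) (by linarith) hs (by linarith)
  simp only [secErr, mid] at h ⊢
  have e1 : 1 - (1 - r + (1 - l)) / 2 = (l + r) / 2 := by ring
  have e2 : 1 - (1 - r + (1 - l + 2 * s)) / 2 = (l - 2 * s + r) / 2 := by ring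
  have e3 : 1 - (1 - l + 2 * s) = l - 2 * s := by ring
  rw [e1, e2, e3, sub_sub_cancel, sub_sub_cancel] at h
  have e4 : 1 - l - (1 - r) = r - l := by ring
  rw [e4] at h
  linarith

theorem ConvexClass.secErrAt_mono {f : ℝ → ℝ} (hf : ConvexClass f) {x t t' : ℝ} (ht : 0 ≤ t)
    (htt : t ≤ t') (h0 : 0 ≤ x - t') (h1 : x + t' ≤ 1) : secErrAt f x t ≤ secErrAt f x t' := by
  rcases ht.eq_or_lt with rfl | ht
  · have := hf.le_combination (a := x - t') (b := x + t') (x := x) (θ := 1 / 2) h0 (by linarith)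
      (by linarith) h1 (by norm_num) (by norm_num) (by ring)
    simp only [secErrAt, secErr, mid]
    rw [show (x - t' + (x + t')) / 2 = x by ring, show (x - 0 + (x + 0)) / 2 = x by ring]
    simp only [sub_zero, add_zero]
    linarith
  · have ht' : 0 < t' := ht.trans_le htt
    have hθ : 0 ≤ (t' + t) / (2 * t') := by positivity
    have hθ' : (t' + t) / (2 * t') ≤ 1 := (div_le_one (by positivity)).2 (by linarith)
    have a1 := hf.le_combination (a := x - t') (b := x + t') (x := x - t) (θ := (t' + t) / (2 * t'))
      h0 (by linarith) (by linarith) h1 hθ hθ' (by field_simp; ring)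
    have a2 := hf.le_combination (a := x + t') (b := x - t') (x := x + t) (θ := (t' + t) / (2 * t'))
      (by linarith) h1 h0 (by linarith) hθ hθ' (by field_simp; ring)
    simp only [secErrAt, secErr, mid]
    rw [show (x - t' + (x + t')) / 2 = x by ring, show (x - t + (x + t)) / 2 = x by ring]
    linarith

/-- The domain of integration in `lambdaAvg`. -/
def modulusRange (f : ℝ → ℝ) (a : ℝ) : Set ℝ :=
  {x : ℝ | x ∈ Icc (0 : ℝ) 1 ∧ tLeft f a ≤ ENNReal.ofReal x ∧ tRight f a ≤ ENNReal.ofReal (1 - x)}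

theorem ConvexClass.mem_modulusRange {f : ℝ → ℝ} (hf : ConvexClass f) {a x t : ℝ}
    (hroot : a ≤ secErr f (0, 1)) (ht : 0 ≤ t) (h0 : 0 ≤ x - t) (h1 : x + t ≤ 1)
    (h : a ≤ secErrAt f x t) : x ∈ modulusRange f a := by
  have hhalf : a ≤ secErrAt f (1 / 2) (1 / 2) := by
    simpa [secErrAt, show (2⁻¹ + 2⁻¹ : ℝ) = 1 by norm_num] using hroot
  refine ⟨⟨by linarith, by linarith⟩, ?_, ?_⟩
  · rcases le_total x (1 / 2) with hx | hx
    · exact iInf₂_le x ⟨⟨by linarith, hx⟩,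
        h.trans (hf.secErrAt_mono ht (by linarith) (by linarith) (by linarith))⟩
    · exact (iInf₂_le (1 / 2 : ℝ) ⟨⟨by norm_num, le_rfl⟩, hhalf⟩).trans
        (ENNReal.ofReal_le_ofReal hx)
  · rcases le_total x (1 / 2) with hx | hx
    · refine (iInf₂_le (1 / 2 : ℝ) ⟨⟨by norm_num, le_rfl⟩, ?_⟩).trans
        (ENNReal.ofReal_le_ofReal (by linarith : (1 / 2 : ℝ) ≤ 1 - x))
      rw [show (1 : ℝ) - 1 / 2 = 1 / 2 by norm_num]
      exact hhalf
    · refine iInf₂_le (1 - x) ⟨⟨by linarith, by linarith⟩, ?_⟩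
      rw [sub_sub_cancel]
      exact h.trans (hf.secErrAt_mono ht (by linarith) (by linarith) (by linarith))

/-- Around the midpoint of a dyadic interval with a large secant error, on at least one side, the
modulus is at most the length of the interval on a set that fills a fixed fraction of it. -/
theorem ConvexClass.exists_omega_le {f : ℝ → ℝ} (hf : ConvexClass f) {α e : ℝ} (hα : 0 < α)
    (hα' : α < 1) (he : 0 < e) (hroot : e ≤ secErr f (0, 1)) {k j : ℕ} (hj : j < 2 ^ k)
    (hk : k ≠ 0) (hI : e ≤ secErr f ((j : ℝ) / 2 ^ k, ((j : ℝ) + 1) / 2 ^ k)) :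
    ∃ A : Set ℝ, MeasurableSet A ∧ volume A = ENNReal.ofReal (α / 4 / 2 ^ k) ∧
      ∀ x ∈ A, ((j : ℝ) / 2 ^ k < x ∧ x < ((j : ℝ) + 1) / 2 ^ k) ∧
        x ∈ modulusRange f ((1 - α) * e) ∧ omega f x ((1 - α) * e) ≤ ((2 : ℝ≥0∞) ^ k)⁻¹ := by
  have hp : (0 : ℝ) < 2 ^ k := by positivity
  set h : ℝ := 1 / 2 ^ k with hh
  have hpos : 0 < h := by positivity
  set l : ℝ := (j : ℝ) / 2 ^ k with hl
  have hr : ((j : ℝ) + 1) / 2 ^ k = l + h := by rw [hl, hh]; ring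
  rw [hr] at hI ⊢
  have hl0 : 0 ≤ l := by positivity
  have hlr1 : l + h ≤ 1 := by
    rw [← hr, div_le_one hp]; exact_mod_cast hj
  have hroot' : (1 - α) * e ≤ secErr f (0, 1) := by nlinarith
  have hinv : ENNReal.ofReal h = ((2 : ℝ≥0∞) ^ k)⁻¹ := by
    rw [hh, one_div, ENNReal.ofReal_inv_of_pos hp, ENNReal.ofReal_pow (by norm_num)]
    norm_num
  have hvol : α / 4 / 2 ^ k = α / 4 * h := by rw [hh]; ring
  -- An interval of half-length `h / 2 + s` around `x` on which the secant error is still large.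
  have core : ∀ x s, 0 ≤ s → s ≤ α / 4 * h → 0 ≤ x - (h / 2 + s) → x + (h / 2 + s) ≤ 1 →
      (h / 2 + s) * e ≤ (h / 2 + 2 * s) * secErrAt f x (h / 2 + s) →
      x ∈ modulusRange f ((1 - α) * e) ∧ omega f x ((1 - α) * e) ≤ ((2 : ℝ≥0∞) ^ k)⁻¹ := by
    intro x s hs hs' hx0 hx1 hmul
    have hge : (1 - α) * e ≤ secErrAt f x (h / 2 + s) := by
      have : (h / 2 + 2 * s) * ((1 - α) * e) ≤ (h / 2 + s) * e := by
        have : (h / 2 + 2 * s) * (1 - α) ≤ h / 2 + s := by nlinarith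
        nlinarith
      exact le_of_mul_le_mul_left (this.trans hmul) (by positivity)
    refine ⟨hf.mem_modulusRange hroot' (by positivity) hx0 hx1 hge, ?_⟩
    rw [← hinv]
    refine (iInf₂_le (h / 2 + s) ⟨⟨by positivity, le_min (by linarith) (by linarith)⟩, hge⟩).trans
      (ENNReal.ofReal_le_ofReal ?_)
    nlinarith
  rcases eq_or_ne (j + 1) (2 ^ k) with hj1 | hj1
  · -- the interval touches `1`, hence not `0`: extend to the left
    have hl1 : h ≤ l := by
      rw [hl, hh]
      gcongr
      have : 2 ≤ 2 ^ k := by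
        calc 2 = 2 ^ 1 := rfl
          _ ≤ 2 ^ k := Nat.pow_le_pow_right (by norm_num) (by omega)
      exact_mod_cast (by omega : 1 ≤ j)
    refine ⟨Icc (l + h / 2 - α / 4 * h) (l + h / 2), measurableSet_Icc, ?_, fun x hx => ?_⟩
    · rw [Real.volume_Icc, hvol]; congr 1; ring
    · have hs0 : 0 ≤ l + h / 2 - x := by linarith [hx.2]
      have hs1 : l + h / 2 - x ≤ α / 4 * h := by linarith [hx.1]
      have hαh : α / 4 * h ≤ h / 4 := by nlinarith
      refine ⟨⟨by linarith, by linarith⟩, core x (l + h / 2 - x) hs0 hs1 (by linarith) (by linarith)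
        ?_⟩
      have := hf.mul_secErr_le_extend_left (l := l) (r := l + h) (s := l + h / 2 - x)
        (by linarith) (by linarith) hs0 hlr1
      have e1 : (x - (h / 2 + (l + h / 2 - x)), x + (h / 2 + (l + h / 2 - x)))
          = (l - 2 * (l + h / 2 - x), l + h) := by ext <;> simp <;> ring
      rw [secErrAt, e1]
      rw [add_sub_cancel_left] at this
      refine le_trans ?_ this
      gcongr
  · have hr1 : l + h + h ≤ 1 := by
      have e2 : l + h + h = ((j : ℝ) + 2) / 2 ^ k := by rw [hl, hh]; ring
      rw [e2, div_le_one hp]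
      exact_mod_cast (by omega : j + 2 ≤ 2 ^ k)
    refine ⟨Icc (l + h / 2) (l + h / 2 + α / 4 * h), measurableSet_Icc, ?_, fun x hx => ?_⟩
    · rw [Real.volume_Icc, hvol]; congr 1; ring
    · have hs0 : 0 ≤ x - (l + h / 2) := by linarith [hx.1]
      have hs1 : x - (l + h / 2) ≤ α / 4 * h := by linarith [hx.2]
      have hαh : α / 4 * h ≤ h / 4 := by nlinarith
      refine ⟨⟨by linarith, by linarith⟩, core x (x - (l + h / 2)) hs0 hs1 (by linarith)
        (by linarith) ?_⟩
      have := hf.mul_secErr_le_extend_right (l := l) (r := l + h) (s := x - (l + h / 2))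
        hl0 (by linarith) hs0 (by linarith)
      have e1 : (x - (h / 2 + (x - (l + h / 2))), x + (h / 2 + (x - (l + h / 2))))
          = (l, l + h + 2 * (x - (l + h / 2))) := by ext <;> simp <;> ring
      rw [secErrAt, e1]
      rw [add_sub_cancel_left] at this
      refine le_trans ?_ this
      gcongr

/-- The number of dyadic intervals, of any sizes and possibly nested, on which the secant error is
at least `e` is controlled by the average modulus at a slightly smaller level: each interval other
than `[0,1]` contributes a fixed amount to the integral, because the contributions `2 ^ k` of the
intervals containing a given point form a geometric sum dominated by the smallest interval. -/
theorem ConvexClass.card_le_lambdaAvg {f : ℝ → ℝ} (hf : ConvexClass f) {α e : ℝ} (hα : 0 < α)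
    (hα' : α < 1) (he : 0 < e) (hroot : e ≤ secErr f (0, 1)) {K : Finset (ℝ × ℝ)}
    (hd : ∀ I ∈ K, IsDyadic I) (hK : ∀ I ∈ K, e ≤ secErr f I) :
    (K.card : ℝ≥0∞) ≤ ENNReal.ofReal (8 / α) * lambdaAvg f ((1 - α) * e) := by
  classical
  set a := (1 - α) * e with ha
  set K' := K.erase (0, 1) with hK'
  have hcard : K.card ≤ K'.card + 1 := by
    have := Finset.pred_card_le_card_erase (s := K) (a := ((0 : ℝ), (1 : ℝ)))
    rw [hK']
    omega
  have hex : ∀ I : ℝ × ℝ, ∃ (k j : ℕ) (A : Set ℝ), I ∈ K' →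
      (I = ((j : ℝ) / 2 ^ k, ((j : ℝ) + 1) / 2 ^ k)) ∧ MeasurableSet A ∧
        volume A = ENNReal.ofReal (α / 4 / 2 ^ k) ∧
      ∀ x ∈ A, ((j : ℝ) / 2 ^ k < x ∧ x < ((j : ℝ) + 1) / 2 ^ k) ∧
        x ∈ modulusRange f a ∧ omega f x a ≤ ((2 : ℝ≥0∞) ^ k)⁻¹ := by
    intro I
    by_cases hI : I ∈ K'
    · rw [hK', Finset.mem_erase] at hI
      obtain ⟨k, j, hj, rfl⟩ := hd I hI.2
      have hk : k ≠ 0 := by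
        rintro rfl
        have : j = 0 := by simpa using hj
        subst this
        exact hI.1 (by simp)
      obtain ⟨A, h⟩ := hf.exists_omega_le hα hα' he hroot hj hk (hK _ hI.2)
      exact ⟨k, j, A, fun _ => ⟨rfl, h⟩⟩
    · exact ⟨0, 0, ∅, fun h => absurd h hI⟩
  choose k j A hA using hex
  set V := ⋃ I ∈ K', A I with hV
  have hsub : ∀ I ∈ K', A I ⊆ V := fun I hI => subset_biUnion_of_mem hI
  have hpt : ∀ x ∈ V, ∑ I ∈ K', (A I).indicator (fun _ => (2 : ℝ≥0∞) ^ k I) x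
      ≤ 2 * (omega f x a)⁻¹ := by
    intro x hx
    set T := K'.filter fun I => x ∈ A I with hT
    have hsum : ∑ I ∈ K', (A I).indicator (fun _ => (2 : ℝ≥0∞) ^ k I) x
        = ∑ I ∈ T, (2 : ℝ≥0∞) ^ k I := by
      rw [hT, Finset.sum_filter]
      rfl
    have hTne : T.Nonempty := by
      simp only [hV, mem_iUnion] at hx
      obtain ⟨I, hI, hx⟩ := hx
      exact ⟨I, Finset.mem_filter.2 ⟨hI, hx⟩⟩
    obtain ⟨I0, hI0, hmax⟩ := T.exists_max_image k hTne
    have hinj : Set.InjOn k T := by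
      intro I hI I' hI' hkk
      rw [Finset.mem_coe, hT, Finset.mem_filter] at hI hI'
      have b1 := ((hA I hI.1).2.2.2 x hI.2).1
      have b2 := ((hA I' hI'.1).2.2.2 x hI'.2).1
      rw [hkk] at b1
      have hp : (0 : ℝ) < 2 ^ k I' := by positivity
      rw [div_lt_iff₀ hp, lt_div_iff₀ hp] at b1 b2
      have c1 : (j I : ℝ) < j I' + 1 := b1.1.trans b2.2
      have c2 : (j I' : ℝ) < j I + 1 := b2.1.trans b1.2
      have d1 : j I < j I' + 1 := by exact_mod_cast c1
      have d2 : j I' < j I + 1 := by exact_mod_cast c2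
      have d3 : j I = j I' := by omega
      rw [(hA I hI.1).1, (hA I' hI'.1).1, hkk, d3]
    have hgeom : ∑ I ∈ T, (2 : ℝ≥0∞) ^ k I ≤ 2 * 2 ^ k I0 := by
      have h1 : ∑ I ∈ T, 2 ^ k I ≤ 2 * 2 ^ k I0 := by
        calc ∑ I ∈ T, 2 ^ k I = ∑ n ∈ T.image k, 2 ^ n := (Finset.sum_image hinj).symm
          _ ≤ ∑ n ∈ Finset.range (k I0 + 1), 2 ^ n := by
              refine Finset.sum_le_sum_of_subset fun n hn => ?_
              obtain ⟨I, hI, rfl⟩ := Finset.mem_image.1 hn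
              exact Finset.mem_range.2 (Nat.lt_succ_of_le (hmax I hI))
          _ ≤ 2 ^ (k I0 + 1) := by
              have := Nat.geomSum_eq (le_refl 2) (k I0 + 1)
              rw [this]; simp
          _ = _ := by rw [pow_succ, mul_comm]
      exact_mod_cast h1
    rw [hsum]
    refine hgeom.trans ?_
    gcongr
    rw [hT, Finset.mem_filter] at hI0
    have := ((hA I0 hI0.1).2.2.2 x hI0.2).2.2
    exact ENNReal.le_inv_iff_le_inv.1 this
  have hint : ENNReal.ofReal (α / 4) * K'.card
      ≤ 2 * ∫⁻ x in modulusRange f a, (omega f x a)⁻¹ := by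
    have hVS : V ⊆ modulusRange f a := by
      intro x hx
      simp only [hV, mem_iUnion] at hx
      obtain ⟨I, hI, hx⟩ := hx
      exact ((hA I hI).2.2.2 x hx).2.1
    have hVm : MeasurableSet V := Finset.measurableSet_biUnion _ fun I hI => (hA I hI).2.1
    calc ENNReal.ofReal (α / 4) * K'.card
        = ∑ I ∈ K', ∫⁻ x in V, (A I).indicator (fun _ => (2 : ℝ≥0∞) ^ k I) x := by
          rw [mul_comm, ← nsmul_eq_mul, ← Finset.sum_const]
          refine Finset.sum_congr rfl fun I hI => ?_
          rw [lintegral_indicator (hA I hI).2.1, setLIntegral_const,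
            Measure.restrict_apply (hA I hI).2.1, inter_eq_left.2 (hsub I hI), (hA I hI).2.2.1]
          have : (2 : ℝ≥0∞) ^ k I = ENNReal.ofReal (2 ^ k I) := by
            rw [ENNReal.ofReal_pow (by norm_num)]; norm_num
          rw [this, ← ENNReal.ofReal_mul (by positivity)]
          congr 1
          field_simp
      _ = ∫⁻ x in V, ∑ I ∈ K', (A I).indicator (fun _ => (2 : ℝ≥0∞) ^ k I) x :=
          (lintegral_finsetSum' _ fun I hI =>
            (measurable_const.indicator (hA I hI).2.1).aemeasurable).symm
      _ ≤ ∫⁻ x in V, 2 * (omega f x a)⁻¹ := setLIntegral_mono' hVm hpt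
      _ = 2 * ∫⁻ x in V, (omega f x a)⁻¹ := lintegral_const_mul' _ _ (by norm_num)
      _ ≤ _ := by gcongr
  have hαpos : 0 < 8 / α := by positivity
  have h1 : (K'.card : ℝ≥0∞) ≤
      ENNReal.ofReal (8 / α) * ∫⁻ x in modulusRange f a, (omega f x a)⁻¹ := by
    calc (K'.card : ℝ≥0∞) = ENNReal.ofReal (4 / α) * (ENNReal.ofReal (α / 4) * K'.card) := by
          rw [← mul_assoc, ← ENNReal.ofReal_mul (by positivity)]
          rw [show 4 / α * (α / 4) = 1 by field_simp]
          simp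
      _ ≤ ENNReal.ofReal (4 / α) * (2 * ∫⁻ x in modulusRange f a, (omega f x a)⁻¹) := by gcongr
      _ = _ := by
          rw [← mul_assoc]
          congr 1
          rw [show (2 : ℝ≥0∞) = ENNReal.ofReal 2 by simp, ← ENNReal.ofReal_mul (by positivity)]
          congr 1
          ring
  calc (K.card : ℝ≥0∞) ≤ 1 + K'.card := by rw [add_comm]; exact_mod_cast hcard
    _ ≤ ENNReal.ofReal (8 / α) * 1 +
        ENNReal.ofReal (8 / α) * ∫⁻ x in modulusRange f a, (omega f x a)⁻¹ := by
        gcongr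
        rw [mul_one, ← ENNReal.ofReal_one]
        refine ENNReal.ofReal_le_ofReal ?_
        rw [le_div_iff₀ hα]
        linarith
    _ = _ := by rw [← mul_add]; rfl

/-! ### Confidence widths -/

/-- The square of the confidence width `phi`, for a positive number of samples. -/
def phiSq (σ : ℝ) (n : ℕ) (η : ℝ) : ℝ :=
  16 * σ ^ 2 * Real.log (Real.logb 2 (2 * (n : ℝ)) / η) / n

theorem one_le_logb_two_mul {n : ℕ} (hn : 1 ≤ n) : 1 ≤ Real.logb 2 (2 * (n : ℝ)) := by
  have hn' : (1 : ℝ) ≤ n := by exact_mod_cast hn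
  rw [Real.le_logb_iff_rpow_le (by norm_num) (by positivity), Real.rpow_one]
  linarith

theorem log_two_le_log_div {n : ℕ} {η : ℝ} (hn : 1 ≤ n) (hη : 0 < η) (hη' : η ≤ 1 / 4) :
    2 * Real.log 2 ≤ Real.log (Real.logb 2 (2 * (n : ℝ)) / η) := by
  have h1 := one_le_logb_two_mul hn
  rw [show 2 * Real.log 2 = Real.log 4 by
    rw [show (4 : ℝ) = 2 ^ 2 by norm_num, Real.log_pow]; norm_num]
  refine Real.log_le_log (by norm_num) ?_
  rw [le_div_iff₀ hη]
  linarith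

theorem phiSq_nonneg {σ η : ℝ} {n : ℕ} (hn : 1 ≤ n) (hη : 0 < η) (hη' : η ≤ 1 / 4) :
    0 ≤ phiSq σ n η := by
  have := log_two_le_log_div hn hη hη'
  have := Real.log_pos one_lt_two
  have h : 0 ≤ Real.log (Real.logb 2 (2 * (n : ℝ)) / η) := by linarith
  unfold phiSq
  positivity

/-- The logarithm grows slower than the sample size. Only the first step needs the exact value of
the iterated logarithm. -/
theorem phiSq_succ_le {σ η : ℝ} {n : ℕ} (hn : 1 ≤ n) (hη : 0 < η) (hη' : η ≤ 1 / 4) :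
    phiSq σ (n + 1) η ≤ phiSq σ n η := by
  have hn' : (0 : ℝ) < n := by exact_mod_cast hn
  have hu := one_le_logb_two_mul hn
  have hv := one_le_logb_two_mul (n := n + 1) (by omega)
  have hlog := log_two_le_log_div hn hη hη'
  have hl2 := Real.log_pos one_lt_two
  set u := Real.logb 2 (2 * (n : ℝ)) with hu'
  set v := Real.logb 2 (2 * ((n + 1 : ℕ) : ℝ)) with hv'
  have hvu : v = u + Real.logb 2 (1 + 1 / (n : ℝ)) := by
    rw [hu', hv', ← Real.logb_mul (by positivity) (by positivity)]
    congr 1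
    push_cast
    field_simp
  have key : n * (Real.log (v / η) - Real.log (u / η)) ≤ Real.log (u / η) := by
    have hdiff : Real.log (v / η) - Real.log (u / η) = Real.log (v / u) := by
      rw [← Real.log_div (by positivity) (by positivity)]
      congr 1
      field_simp
    rw [hdiff]
    rcases hn.eq_or_lt with rfl | hn2
    · have e1 : u = 1 := by rw [hu']; norm_num
      have e2 : v = 2 := by rw [hvu, e1]; norm_num
      rw [e1, e2]
      rw [e1] at hlog
      norm_num at hlog ⊢
      linarith
    · have hu2 : 2 ≤ u := by
        rw [hu', Real.le_logb_iff_rpow_le (by norm_num) (by positivity)]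
        have : (2 : ℝ) ≤ n := by exact_mod_cast hn2
        norm_num
        linarith
      have h1 : Real.log (v / u) ≤ v / u - 1 := Real.log_le_sub_one_of_pos (by positivity)
      have h2 : v / u - 1 = Real.logb 2 (1 + 1 / (n : ℝ)) / u := by
        rw [hvu]; field_simp; ring
      have h3 : Real.logb 2 (1 + 1 / (n : ℝ)) ≤ 1 / n / Real.log 2 := by
        rw [Real.logb]
        gcongr
        have := Real.log_le_sub_one_of_pos (x := 1 + 1 / (n : ℝ)) (by positivity)
        linarith
      have h4 : Real.log (v / u) ≤ 1 / n / Real.log 2 / 2 := by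
        rw [h2] at h1
        refine h1.trans ?_
        have : 0 ≤ 1 / (n : ℝ) / Real.log 2 := by positivity
        calc _ ≤ 1 / (n : ℝ) / Real.log 2 / u := by gcongr
          _ ≤ _ := by gcongr
      have h5 : n * Real.log (v / u) ≤ 1 / Real.log 2 / 2 := by
        calc n * Real.log (v / u) ≤ n * (1 / n / Real.log 2 / 2) := by gcongr
          _ = _ := by field_simp
      refine h5.trans (le_trans ?_ hlog)
      have := Real.log_two_gt_d9
      rw [div_div, div_le_iff₀ (by positivity)]
      nlinarith
  have : Real.log (v / η) / ((n + 1 : ℕ) : ℝ) ≤ Real.log (u / η) / n := by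
    rw [div_le_div_iff₀ (by positivity) hn']
    push_cast
    linarith
  unfold phiSq
  rw [mul_div_assoc, mul_div_assoc]
  gcongr

theorem phiSq_anti {σ η : ℝ} {m n : ℕ} (hm : 1 ≤ m) (hmn : m ≤ n) (hη : 0 < η)
    (hη' : η ≤ 1 / 4) : phiSq σ n η ≤ phiSq σ m η := by
  induction n, hmn using Nat.le_induction with
  | base => exact le_rfl
  | succ n hmn ih => exact (phiSq_succ_le (hm.trans hmn) hη hη').trans ih

theorem phiSq_le_two_mul_succ {σ η : ℝ} {n : ℕ} (hn : 1 ≤ n) (hη : 0 < η) (hη' : η ≤ 1 / 4) :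
    phiSq σ n η ≤ 2 * phiSq σ (n + 1) η := by
  have hn' : (1 : ℝ) ≤ n := by exact_mod_cast hn
  have hlog := log_two_le_log_div hn hη hη'
  have hl2 := Real.log_pos one_lt_two
  have hu := one_le_logb_two_mul hn
  have hle : Real.log (Real.logb 2 (2 * (n : ℝ)) / η)
      ≤ Real.log (Real.logb 2 (2 * ((n + 1 : ℕ) : ℝ)) / η) := by
    refine Real.log_le_log (by positivity) ?_
    gcongr
    · norm_num
    · omega
  have : Real.log (Real.logb 2 (2 * (n : ℝ)) / η) / n
      ≤ 2 * (Real.log (Real.logb 2 (2 * ((n + 1 : ℕ) : ℝ)) / η) / ((n + 1 : ℕ) : ℝ)) := by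
    rw [← mul_div_assoc, div_le_div_iff₀ (by positivity) (by positivity)]
    push_cast at hle ⊢
    nlinarith
  unfold phiSq
  rw [mul_div_assoc, mul_div_assoc]
  nlinarith [mul_le_mul_of_nonneg_left this (by positivity : 0 ≤ 16 * σ ^ 2)]

theorem phiSq_le_two_mul_one {σ η η' : ℝ} {n : ℕ} (hn : 1 ≤ n) (hη : 0 < η) (hη' : η ≤ 1 / 4)
    (hp : 0 < η') (hηη : η' ^ 2 ≤ η) : phiSq σ n η ≤ 2 * phiSq σ 1 η' := by
  refine (phiSq_anti le_rfl hn hη hη').trans ?_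
  have h1 : Real.logb 2 (2 * ((1 : ℕ) : ℝ)) = 1 := by norm_num
  have h2 : Real.log (1 / η) ≤ 2 * Real.log (1 / η') := by
    have : 2 * Real.log (1 / η') = Real.log (1 / η' ^ 2) := by
      rw [← one_div_pow, Real.log_pow]; norm_num
    rw [this]
    exact Real.log_le_log (by positivity) (one_div_le_one_div_of_le (by positivity) hηη)
  unfold phiSq
  rw [h1]
  simp only [Nat.cast_one, div_one]
  nlinarith [mul_le_mul_of_nonneg_left h2 (by positivity : 0 ≤ 16 * σ ^ 2)]

theorem rankParam_ge {δ : ℝ} (hδ : 0 < δ) {L k : ℕ} (hL : 1 ≤ L) (hk : k ≤ 2 * L + 1) :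
    δ / (6 * (L : ℝ) ^ 2) ≤ rankParam δ k := by
  have hL' : (1 : ℝ) ≤ L := by exact_mod_cast hL
  unfold rankParam
  split_ifs with h
  · refine div_le_div_of_nonneg_left hδ.le (by norm_num) ?_
    nlinarith
  · have h1 : 1 ≤ k / 2 - 1 := by omega
    have h2 : k / 2 - 1 ≤ L := by omega
    have h1' : (1 : ℝ) ≤ ((k / 2 - 1 : ℕ) : ℝ) := by exact_mod_cast h1
    have h2' : ((k / 2 - 1 : ℕ) : ℝ) ≤ L := by exact_mod_cast h2
    refine div_le_div_of_nonneg_left hδ.le (by positivity) ?_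
    nlinarith

theorem rankParam_two_mul_add_three {δ : ℝ} {L : ℕ} (hL : 1 ≤ L) :
    rankParam δ (2 * L + 3) = δ / (2 * (L : ℝ) ^ 2) := by
  rw [rankParam, if_neg (by omega), show (2 * L + 3) / 2 - 1 = L by omega]

theorem rankParam_two_mul {δ : ℝ} {L : ℕ} (hL : 2 ≤ L) :
    rankParam δ (2 * L) = rankParam δ (2 * L + 1) := by
  rw [rankParam, rankParam, if_neg (by omega), if_neg (by omega),
    show (2 * L) / 2 - 1 = (2 * L + 1) / 2 - 1 by omega]

/-! ### Bookkeeping of an execution -/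

namespace Transcript

variable {R : Transcript} {σ : ℝ} {t : ℕ}

/-- The confidence width at a sampled point, as a real number. -/
def rwidth (R : Transcript) (σ : ℝ) (t : ℕ) (p : ℝ) : ℝ :=
  √(phiSq σ (R.count t p) (R.dpnt t p))

/-- The confidence bound of a sampled leaf, as a real number. -/
def rbound (R : Transcript) (σ : ℝ) (t : ℕ) (I : ℝ × ℝ) : ℝ :=
  R.rwidth σ t (mid I) + 1 / 2 * max (R.rwidth σ t I.1) (R.rwidth σ t I.2)

theorem rwidth_nonneg (R : Transcript) (σ : ℝ) (t : ℕ) (p : ℝ) : 0 ≤ R.rwidth σ t p :=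
  Real.sqrt_nonneg _

theorem rbound_nonneg (R : Transcript) (σ : ℝ) (t : ℕ) (I : ℝ × ℝ) : 0 ≤ R.rbound σ t I := by
  have h1 := R.rwidth_nonneg σ t (mid I)
  have h2 := (R.rwidth_nonneg σ t I.1).trans (le_max_left _ (R.rwidth σ t I.2))
  unfold rbound
  positivity

theorem count_succ (R : Transcript) (t : ℕ) (p : ℝ) :
    R.count (t + 1) p = R.count t p + if R.x (t + 1) = p then 1 else 0 := by
  unfold count
  rw [Finset.card_filter, Finset.card_filter, Finset.sum_Icc_succ_top (by omega)]

theorem count_mono (R : Transcript) (p : ℝ) : Monotone fun t => R.count t p := fun _ _ h =>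
  Finset.card_le_card (Finset.filter_subset_filter _ (Finset.Icc_subset_Icc_right h))

theorem count_pos_iff {p : ℝ} : 0 < R.count t p ↔ ∃ i ∈ Finset.Icc 1 t, R.x i = p := by
  rw [count, Finset.card_pos, Finset.filter_nonempty_iff]

theorem fresh_succ_iff : Fresh R.x (t + 1) ↔ R.count t (R.x (t + 1)) = 0 := by
  rw [← not_iff_not, ← Ne, ← Nat.pos_iff_ne_zero, count_pos_iff]
  simp only [Fresh, not_forall, Finset.mem_Ico, Finset.mem_Icc, Nat.lt_succ_iff, exists_prop,
    not_not, ne_eq]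

theorem width_of_pos {p : ℝ} (h : 0 < R.count t p) :
    R.width σ t p = ((R.rwidth σ t p : ℝ) : EReal) := by
  rw [width, phi, if_neg h.ne']
  rfl

theorem width_of_zero {p : ℝ} (h : R.count t p = 0) : R.width σ t p = ⊤ := by
  rw [width, phi, if_pos h]

theorem coe_max (a b : ℝ) : max (a : EReal) (b : EReal) = ((max a b : ℝ) : EReal) :=
  EReal.coe_strictMono.monotone.map_max.symm

theorem half_mul_max {I : ℝ × ℝ} (h1 : 0 < R.count t I.1) (h2 : 0 < R.count t I.2) :
    ((1 / 2 : ℝ) : EReal) * max (R.width σ t I.1) (R.width σ t I.2)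
      = ((1 / 2 * max (R.rwidth σ t I.1) (R.rwidth σ t I.2) : ℝ) : EReal) := by
  rw [width_of_pos h1, width_of_pos h2, coe_max, ← EReal.coe_mul]

theorem bound_of_pos {I : ℝ × ℝ} (h1 : 0 < R.count t I.1) (h2 : 0 < R.count t I.2)
    (h3 : 0 < R.count t (mid I)) : R.bound σ t I = ((R.rbound σ t I : ℝ) : EReal) := by
  rw [bound, half_mul_max h1 h2, width_of_pos h3, ← EReal.coe_add]
  rfl

theorem bound_of_zero {I : ℝ × ℝ} (h1 : 0 < R.count t I.1) (h2 : 0 < R.count t I.2)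
    (h3 : R.count t (mid I) = 0) : R.bound σ t I = ⊤ := by
  rw [bound, half_mul_max h1 h2, width_of_zero h3, EReal.top_add_coe]

theorem secErrHat_of_pos {I : ℝ × ℝ} (h3 : 0 < R.count t (mid I)) :
    R.secErrHat t I = ((secErr (R.fpnt t) I : ℝ) : EReal) := by
  rw [secErrHat, if_neg h3.ne']

theorem score_of_pos {I : ℝ × ℝ} (h1 : 0 < R.count t I.1) (h2 : 0 < R.count t I.2)
    (h3 : 0 < R.count t (mid I)) :
    R.score σ t I = ((R.rbound σ t I + max 0 (secErr (R.fpnt t) I) : ℝ) : EReal) := by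
  rw [score, bound_of_pos h1 h2 h3, secErrHat_of_pos h3, ← EReal.coe_zero, coe_max,
    ← EReal.coe_add]

theorem score_of_zero {I : ℝ × ℝ} (h1 : 0 < R.count t I.1) (h2 : 0 < R.count t I.2)
    (h3 : R.count t (mid I) = 0) : R.score σ t I = ⊤ := by
  rw [score, bound_of_zero h1 h2 h3, secErrHat, if_pos h3]
  simp

end Transcript

theorem mid_mem {I : ℝ × ℝ} (h : I.1 < I.2) : I.1 < mid I ∧ mid I < I.2 := by
  unfold mid; constructor <;> linarith

theorem IsDyadic.lt {I : ℝ × ℝ} (h : IsDyadic I) : I.1 < I.2 := by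
  obtain ⟨k, j, -, rfl⟩ := h
  simp only
  gcongr
  linarith

theorem IsDyadic.nonneg {I : ℝ × ℝ} (h : IsDyadic I) : 0 ≤ I.1 := by
  obtain ⟨k, j, -, rfl⟩ := h
  positivity

theorem IsDyadic.le_one {I : ℝ × ℝ} (h : IsDyadic I) : I.2 ≤ 1 := by
  obtain ⟨k, j, hj, rfl⟩ := h
  rw [div_le_one (by positivity)]
  exact_mod_cast hj

theorem IsDyadic.left_half {I : ℝ × ℝ} (h : IsDyadic I) : IsDyadic (I.1, mid I) := by
  obtain ⟨k, j, hj, rfl⟩ := h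
  refine ⟨k + 1, 2 * j, by rw [pow_succ]; omega, ?_⟩
  simp only [mid, Prod.mk.injEq]
  push_cast
  rw [pow_succ]
  constructor <;> field_simp
  ring

theorem IsDyadic.right_half {I : ℝ × ℝ} (h : IsDyadic I) : IsDyadic (mid I, I.2) := by
  obtain ⟨k, j, hj, rfl⟩ := h
  refine ⟨k + 1, 2 * j + 1, by rw [pow_succ]; omega, ?_⟩
  simp only [mid, Prod.mk.injEq]
  push_cast
  rw [pow_succ]
  constructor <;> field_simp <;> ring

/-- The state of an execution at the start of round `t`: the leaves are dyadic intervals that tile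
`[0,1]`, their endpoints have been sampled, at most two of their midpoints have not, and the
confidence parameter of each design point is determined by its rank among the distinct design
points. By `width_ratio` the confidence width at the midpoint of a leaf is at least `1 / √2` times
those at its endpoints; `dpnt_sq` ensures this for the first sample at the midpoint. -/
structure RoundInvariant (σ δ : ℝ) (R : Transcript) (t : ℕ) : Prop where
  dyadic : ∀ I ∈ R.leaves t, IsDyadic I
  disjoint : ∀ I ∈ R.leaves t, ∀ J ∈ R.leaves t, I ≠ J → I.2 ≤ J.1 ∨ J.2 ≤ I.1
  cover : ∀ x ∈ Icc (0 : ℝ) 1, ∃ I ∈ R.leaves t, x ∈ Icc I.1 I.2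
  ends_pos : ∀ I ∈ R.leaves t, 0 < R.count t I.1 ∧ 0 < R.count t I.2
  sampled : ∀ i ∈ Finset.Icc 1 t, ∃ I ∈ R.leaves t, R.x i = I.1 ∨ R.x i = I.2 ∨ R.x i = mid I
  distinct : distinctCount R.x t + ((R.leaves t).filter fun I => R.count t (mid I) = 0).card
    = 2 * (R.leaves t).card + 1
  unsampled_le : ((R.leaves t).filter fun I => R.count t (mid I) = 0).card ≤ 2
  two_le : 2 ≤ distinctCount R.x t
  dpnt_unsampled : ∀ I ∈ R.leaves t, R.count t (mid I) = 0 →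
    R.dpnt t (mid I) = rankParam δ (2 * (R.leaves t).card + 1)
  dpnt_fresh : ∀ j ∈ Finset.Icc 1 t, Fresh R.x j →
    R.dpnt t (R.x j) = rankParam δ (distinctCount R.x j)
  dpnt_sq : ∀ I ∈ R.leaves t,
    R.dpnt t (mid I) ^ 2 ≤ R.dpnt t I.1 ∧ R.dpnt t (mid I) ^ 2 ≤ R.dpnt t I.2
  width_ratio : ∀ I ∈ R.leaves t, 0 < R.count t (mid I) →
    phiSq σ (R.count t I.1) (R.dpnt t I.1) ≤ 2 * phiSq σ (R.count t (mid I)) (R.dpnt t (mid I)) ∧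
    phiSq σ (R.count t I.2) (R.dpnt t I.2) ≤ 2 * phiSq σ (R.count t (mid I)) (R.dpnt t (mid I))

namespace RoundInvariant

variable {σ β δ : ℝ} {R : Transcript} {t : ℕ}

theorem eq_of_interior (h : RoundInvariant σ δ R t) {I J : ℝ × ℝ} (hI : I ∈ R.leaves t)
    (hJ : J ∈ R.leaves t) {p : ℝ} (h1 : I.1 < p) (h2 : p < I.2) (h3 : J.1 ≤ p) (h4 : p ≤ J.2) :
    J = I := by
  by_contra hne
  rcases h.disjoint J hJ I hI hne with h' | h' <;> linarith

theorem card_pos (h : RoundInvariant σ δ R t) : 1 ≤ (R.leaves t).card := by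
  obtain ⟨I, hI, -⟩ := h.cover 0 (by simp)
  exact Finset.card_pos.2 ⟨I, hI⟩

theorem exists_dpnt_eq (h : RoundInvariant σ δ R t) {p : ℝ} (hp : 0 < R.count t p) :
    ∃ k ≤ distinctCount R.x t, R.dpnt t p = rankParam δ k := by
  obtain ⟨i, hi, rfl⟩ := Transcript.count_pos_iff.1 hp
  rw [Finset.mem_Icc] at hi
  obtain ⟨j, hj, hf, hji⟩ := exists_fresh (x := R.x) hi.1
  rw [Finset.mem_Icc] at hj
  have := h.dpnt_fresh j (Finset.mem_Icc.2 ⟨hj.1, hj.2.trans hi.2⟩) hf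
  rw [hji] at this
  exact ⟨_, distinctCount_mono _ (hj.2.trans hi.2), this⟩

theorem dpnt_mem (h : RoundInvariant σ δ R t) (hδ : 0 < δ) (hδ' : δ < 1 / 2) {p : ℝ}
    (hp : 0 < R.count t p) : 0 < R.dpnt t p ∧ R.dpnt t p ≤ 1 / 4 := by
  obtain ⟨k, -, hk⟩ := h.exists_dpnt_eq hp
  rw [hk]
  exact ⟨rankParam_pos hδ k, rankParam_le hδ hδ' k⟩

theorem dpnt_ge (h : RoundInvariant σ δ R t) (hδ : 0 < δ) {p : ℝ} (hp : 0 < R.count t p) :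
    δ / (6 * ((R.leaves t).card : ℝ) ^ 2) ≤ R.dpnt t p := by
  obtain ⟨k, hk, hk'⟩ := h.exists_dpnt_eq hp
  rw [hk']
  have := h.distinct
  exact rankParam_ge hδ h.card_pos (by omega)

theorem dpnt_mid_mem (h : RoundInvariant σ δ R t) (hδ : 0 < δ) (hδ' : δ < 1 / 2) {I : ℝ × ℝ}
    (hI : I ∈ R.leaves t) : 0 < R.dpnt t (mid I) ∧ R.dpnt t (mid I) ≤ 1 / 4 := by
  rcases Nat.eq_zero_or_pos (R.count t (mid I)) with h0 | h0
  · rw [h.dpnt_unsampled I hI h0]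
    exact ⟨rankParam_pos hδ _, rankParam_le hδ hδ' _⟩
  · exact h.dpnt_mem hδ hδ' h0

theorem base (hR : IsExecution σ β δ R) (hδ : 0 < δ) (hδ' : δ < 1 / 2) :
    RoundInvariant σ δ R 2 := by
  have hIcc : Finset.Icc 1 2 = {1, 2} := rfl
  have hmem : ∀ i ∈ Finset.Icc 1 2, i = 1 ∧ R.x i = 0 ∨ i = 2 ∧ R.x i = 1 := by
    intro i hi
    rw [hIcc, Finset.mem_insert, Finset.mem_singleton] at hi
    rcases hi with rfl | rfl
    · exact Or.inl ⟨rfl, hR.x_one⟩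
    · exact Or.inr ⟨rfl, hR.x_two⟩
  have c0 : 0 < R.count 2 0 := Transcript.count_pos_iff.2 ⟨1, by simp, hR.x_one⟩
  have c1 : 0 < R.count 2 1 := Transcript.count_pos_iff.2 ⟨2, by simp, hR.x_two⟩
  have cm : R.count 2 (mid (0, 1)) = 0 := by
    by_contra hne
    obtain ⟨i, hi, h⟩ := Transcript.count_pos_iff.1 (Nat.pos_of_ne_zero hne)
    rcases hmem i hi with ⟨-, h'⟩ | ⟨-, h'⟩ <;> rw [h'] at h <;> norm_num [mid] at h
  have d1 : distinctCount R.x 1 = 1 := by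
    rw [distinctCount_succ_of_fresh (t := 0) (fun b hb => by simp at hb)]
    simp [distinctCount]
  have d2 : distinctCount R.x 2 = 2 := by
    rw [distinctCount_succ_of_fresh (t := 1), d1]
    intro b hb
    have : b = 1 := by rw [Finset.mem_Ico] at hb; omega
    rw [this, hR.x_one, hR.x_two]
    norm_num
  have hd := hR.dpnt_two
  have hm : mid (0, 1) = 1 / 2 := by norm_num [mid]
  have dm := hd (1 / 2) (by simp)
  have e0 := hd 0 (by simp)
  have e1 := hd 1 (by simp)
  have hfil : ({((0 : ℝ), (1 : ℝ))} : Finset (ℝ × ℝ)).filter (fun I => R.count 2 (mid I) = 0)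
      = {((0 : ℝ), (1 : ℝ))} := by
    rw [Finset.filter_singleton, if_pos cm]
  constructor <;> try rw [hR.leaves_two]
  all_goals try simp only [Finset.mem_singleton, forall_eq, exists_eq_left]
  · exact ⟨0, 0, by simp, by simp⟩
  · exact fun h => absurd rfl h
  · exact fun x hx => hx
  · exact ⟨c0, c1⟩
  · intro i hi
    rcases hmem i hi with ⟨-, h⟩ | ⟨-, h⟩ <;> simp [h]
  · rw [hfil, d2]; simp
  · rw [hfil]; simp
  · exact d2.ge
  · intro _
    rw [hm, dm]
    simp [rankParam]
  · intro j hj _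
    rcases hmem j hj with ⟨rfl, h⟩ | ⟨rfl, h⟩
    · rw [h, e0, d1]; simp [rankParam]
    · rw [h, e1, d2]; simp [rankParam]
  · rw [hm, dm, e0, e1]
    constructor <;> nlinarith
  · intro h
    omega

end RoundInvariant

namespace RoundInvariant

variable {σ β δ : ℝ} {R : Transcript} {t : ℕ}

theorem score_sampled (h : RoundInvariant σ δ R t) {I : ℝ × ℝ} (hI : I ∈ R.leaves t)
    (hm : 0 < R.count t (mid I)) :
    R.score σ t I = ((R.rbound σ t I + max 0 (secErr (R.fpnt t) I) : ℝ) : EReal) :=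
  Transcript.score_of_pos (h.ends_pos I hI).1 (h.ends_pos I hI).2 hm

/-- Leaves with an unsampled midpoint have score `⊤` and are therefore selected first. -/
theorem count_mid_Istar_eq_zero (h : RoundInvariant σ δ R t) (hR : IsExecution σ β δ R)
    (ht : 2 ≤ t) {J : ℝ × ℝ} (hJ : J ∈ R.leaves t) (hJ0 : R.count t (mid J) = 0) :
    R.count t (mid (R.Istar t)) = 0 := by
  by_contra hne
  have hle := hR.Istar_max t ht J hJ
  rw [Transcript.score_of_zero (h.ends_pos J hJ).1 (h.ends_pos J hJ).2 hJ0,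
    h.score_sampled (hR.Istar_mem t ht) (Nat.pos_of_ne_zero hne), top_le_iff] at hle
  exact EReal.coe_ne_top _ hle

theorem not_splits_of_unsampled (h : RoundInvariant σ δ R t) (hR : IsExecution σ β δ R)
    (hβ : 0 < β) (ht : 2 ≤ t) (h0 : R.count t (mid (R.Istar t)) = 0) : ¬ R.Splits σ β t := by
  have he := h.ends_pos _ (hR.Istar_mem t ht)
  rw [Transcript.Splits, Transcript.bound_of_zero he.1 he.2 h0,
    EReal.coe_mul_top_of_pos (by linarith)]
  exact not_top_lt

theorem x_succ_of_unsampled (h : RoundInvariant σ δ R t) (hR : IsExecution σ β δ R)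
    (ht : 2 ≤ t) (h0 : R.count t (mid (R.Istar t)) = 0) : R.x (t + 1) = mid (R.Istar t) := by
  have he := h.ends_pos _ (hR.Istar_mem t ht)
  have hle := hR.x_max t ht (mid (R.Istar t)) (by simp)
  rw [Transcript.width_of_zero h0, top_le_iff] at hle
  have hx := hR.x_mem t ht
  simp only [mem_insert_iff, mem_singleton_iff] at hx
  rcases hx with hx | hx | hx
  · rw [hx, Transcript.width_of_pos he.1] at hle
    exact absurd hle (EReal.coe_ne_top _)
  · rw [hx, Transcript.width_of_pos he.2] at hle
    exact absurd hle (EReal.coe_ne_top _)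
  · exact hx

theorem count_x_succ_pos (h : RoundInvariant σ δ R t) (hR : IsExecution σ β δ R)
    (ht : 2 ≤ t) (h0 : 0 < R.count t (mid (R.Istar t))) : 0 < R.count t (R.x (t + 1)) := by
  have he := h.ends_pos _ (hR.Istar_mem t ht)
  have hx := hR.x_mem t ht
  simp only [mem_insert_iff, mem_singleton_iff] at hx
  rcases hx with hx | hx | hx <;> rw [hx]
  exacts [he.1, he.2, h0]

theorem mid_sampled_of_splits (h : RoundInvariant σ δ R t) (hR : IsExecution σ β δ R)
    (hβ : 0 < β) (ht : 2 ≤ t) (hs : R.Splits σ β t) {J : ℝ × ℝ} (hJ : J ∈ R.leaves t) :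
    0 < R.count t (mid J) := by
  by_contra hne
  exact h.not_splits_of_unsampled hR hβ ht
    (h.count_mid_Istar_eq_zero hR ht hJ (by omega)) hs

theorem x_succ_mem_Icc (h : RoundInvariant σ δ R t) (hR : IsExecution σ β δ R) (ht : 2 ≤ t) :
    (R.Istar t).1 ≤ R.x (t + 1) ∧ R.x (t + 1) ≤ (R.Istar t).2 := by
  have hlt := (h.dyadic _ (hR.Istar_mem t ht)).lt
  have hm := mid_mem hlt
  have hx := hR.x_mem t ht
  simp only [mem_insert_iff, mem_singleton_iff] at hx
  rcases hx with hx | hx | hx <;> rw [hx] <;> constructor <;> linarith [hm.1, hm.2]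

/-- Sampling preserves the ratio of the widths at the midpoint and at an endpoint `e` of a leaf:
the midpoint is sampled only when its width is the largest of the three, and one sample reduces
the squared width by at most the factor `2`. -/
theorem phiSq_endpoint_le (h : RoundInvariant σ δ R t) (hR : IsExecution σ β δ R) (hδ : 0 < δ)
    (hδ' : δ < 1 / 2) (ht : 2 ≤ t) {I : ℝ × ℝ} (hI : I ∈ R.leaves t)
    (hm : 0 < R.count (t + 1) (mid I)) {e : ℝ} (he : e = I.1 ∨ e = I.2) :
    phiSq σ (R.count (t + 1) e) (R.dpnt t e)
      ≤ 2 * phiSq σ (R.count (t + 1) (mid I)) (R.dpnt t (mid I)) := by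
  have hlt := (h.dyadic _ hI).lt
  have hmid := mid_mem hlt
  have hec : 0 < R.count t e := by
    rcases he with rfl | rfl; exacts [(h.ends_pos I hI).1, (h.ends_pos I hI).2]
  have hem : e ≠ mid I := by rcases he with rfl | rfl; exacts [hmid.1.ne, hmid.2.ne']
  have hde := h.dpnt_mem hδ hδ' hec
  have hdm := h.dpnt_mid_mem hδ hδ' hI
  have hsq : R.dpnt t (mid I) ^ 2 ≤ R.dpnt t e := by
    rcases he with rfl | rfl; exacts [(h.dpnt_sq I hI).1, (h.dpnt_sq I hI).2]
  have hanti : phiSq σ (R.count (t + 1) e) (R.dpnt t e) ≤ phiSq σ (R.count t e) (R.dpnt t e) :=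
    phiSq_anti hec (R.count_mono e t.le_succ) hde.1 hde.2
  by_cases hx : R.x (t + 1) = mid I
  · have hstar : R.Istar t = I := by
      refine h.eq_of_interior hI (hR.Istar_mem t ht) hmid.1 hmid.2 ?_ ?_ <;> rw [← hx]
      exacts [(h.x_succ_mem_Icc hR ht).1, (h.x_succ_mem_Icc hR ht).2]
    rw [R.count_succ t (mid I), if_pos hx]
    rcases Nat.eq_zero_or_pos (R.count t (mid I)) with h0 | h0
    · rw [h0, zero_add]
      exact hanti.trans (phiSq_le_two_mul_one hec hde.1 hde.2 hdm.1 hsq)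
    · have hw := hR.x_max t ht e (by
        rw [hstar]; rcases he with rfl | rfl <;> simp)
      rw [hx, Transcript.width_of_pos hec, Transcript.width_of_pos h0, EReal.coe_le_coe_iff,
        Transcript.rwidth, Transcript.rwidth,
        Real.sqrt_le_sqrt_iff (phiSq_nonneg h0 hdm.1 hdm.2)] at hw
      exact hanti.trans (hw.trans (phiSq_le_two_mul_succ h0 hdm.1 hdm.2))
  · rw [R.count_succ t (mid I), if_neg hx, add_zero] at hm ⊢
    refine hanti.trans ?_
    rcases he with rfl | rfl; exacts [(h.width_ratio I hI hm).1, (h.width_ratio I hI hm).2]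

theorem succ_of_not_splits (h : RoundInvariant σ δ R t) (hR : IsExecution σ β δ R) (hδ : 0 < δ)
    (hδ' : δ < 1 / 2) (ht : 2 ≤ t) (hs : ¬ R.Splits σ β t) :
    RoundInvariant σ δ R (t + 1) := by
  have hl := hR.leaves_keep t ht hs
  have hd := hR.dpnt_keep t ht hs
  have hstar := hR.Istar_mem t ht
  have hx := hR.x_mem t ht
  simp only [mem_insert_iff, mem_singleton_iff] at hx
  have hmono : ∀ p, R.count t p ≤ R.count (t + 1) p := fun p => R.count_mono p t.le_succ
  have hsampled : ∀ i ∈ Finset.Icc 1 (t + 1),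
      ∃ I ∈ R.leaves t, R.x i = I.1 ∨ R.x i = I.2 ∨ R.x i = mid I := by
    intro i hi
    rw [Finset.mem_Icc] at hi
    rcases hi.2.lt_or_eq with hlt | rfl
    · exact h.sampled i (Finset.mem_Icc.2 ⟨hi.1, by omega⟩)
    · exact ⟨_, hstar, hx⟩
  have hdist := h.distinct
  have hule := h.unsampled_le
  -- One more distinct point exactly when there is one less unsampled midpoint.
  have hcases : (distinctCount R.x (t + 1)
      + ((R.leaves t).filter fun I => R.count (t + 1) (mid I) = 0).card
        = 2 * (R.leaves t).card + 1) ∧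
      ((R.leaves t).filter fun I => R.count (t + 1) (mid I) = 0).card ≤ 2 ∧
      (Fresh R.x (t + 1) →
        R.dpnt t (R.x (t + 1)) = rankParam δ (distinctCount R.x (t + 1))) := by
    rcases Nat.eq_zero_or_pos (R.count t (mid (R.Istar t))) with h0 | h0
    · have hxm := h.x_succ_of_unsampled hR ht h0
      have hfr : Fresh R.x (t + 1) := by rw [Transcript.fresh_succ_iff, hxm, h0]
      have hfil : ((R.leaves t).filter fun I => R.count (t + 1) (mid I) = 0)
          = ((R.leaves t).filter fun I => R.count t (mid I) = 0).erase (R.Istar t) := by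
        ext I
        simp only [Finset.mem_filter, Finset.mem_erase]
        rw [R.count_succ, hxm]
        constructor
        · rintro ⟨hI, hc⟩
          refine ⟨?_, hI, by omega⟩
          rintro rfl
          simp at hc
        · rintro ⟨hne, hI, hc⟩
          refine ⟨hI, ?_⟩
          rw [if_neg, hc]
          intro heq
          have hm1 := mid_mem (h.dyadic _ hstar).lt
          have hm2 := mid_mem (h.dyadic _ hI).lt
          exact hne (h.eq_of_interior hstar hI hm1.1 hm1.2 (heq ▸ hm2.1.le) (heq ▸ hm2.2.le))
      have hmemU : R.Istar t ∈ (R.leaves t).filter fun I => R.count t (mid I) = 0 :=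
        Finset.mem_filter.2 ⟨hstar, h0⟩
      have hUpos := Finset.card_pos.2 ⟨_, hmemU⟩
      rw [hfil, Finset.card_erase_of_mem hmemU, distinctCount_succ_of_fresh hfr]
      refine ⟨by omega, by omega, fun _ => ?_⟩
      rw [hxm, h.dpnt_unsampled _ hstar h0]
      have htwo := h.two_le
      have hcp := h.card_pos
      have : distinctCount R.x t + 1 = 2 * (R.leaves t).card + 1 ∨
          (distinctCount R.x t + 1 = 2 * (R.leaves t).card ∧ 2 ≤ (R.leaves t).card) := by omega
      rcases this with h' | ⟨h', h2⟩
      · rw [h']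
      · rw [h', rankParam_two_mul h2]
    · have hall : ∀ J ∈ R.leaves t, R.count t (mid J) ≠ 0 := fun J hJ hJ0 =>
        h0.ne' (h.count_mid_Istar_eq_zero hR ht hJ hJ0)
      have hfr : ¬ Fresh R.x (t + 1) := by
        rw [Transcript.fresh_succ_iff]
        exact (h.count_x_succ_pos hR ht h0).ne'
      have hU : ((R.leaves t).filter fun I => R.count t (mid I) = 0) = ∅ :=
        Finset.filter_eq_empty_iff.2 fun J hJ => hall J hJ
      have hU' : ((R.leaves t).filter fun I => R.count (t + 1) (mid I) = 0) = ∅ :=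
        Finset.filter_eq_empty_iff.2 fun J hJ h' => hall J hJ (by have := hmono (mid J); omega)
      rw [hU, Finset.card_empty] at hdist
      rw [hU', Finset.card_empty, distinctCount_succ_of_not_fresh hfr]
      exact ⟨hdist, by omega, fun hf => absurd hf hfr⟩
  constructor <;> try rw [hl]
  all_goals try rw [hd]
  · exact h.dyadic
  · exact h.disjoint
  · exact h.cover
  · exact fun I hI =>
      ⟨(h.ends_pos I hI).1.trans_le (hmono _), (h.ends_pos I hI).2.trans_le (hmono _)⟩
  · exact hsampled
  · exact hcases.1
  · exact hcases.2.1
  · exact h.two_le.trans (distinctCount_mono _ t.le_succ)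
  · exact fun I hI h0 => h.dpnt_unsampled I hI (by have := hmono (mid I); omega)
  · intro j hj hf
    rw [Finset.mem_Icc] at hj
    rcases hj.2.lt_or_eq with hlt | rfl
    · exact h.dpnt_fresh j (Finset.mem_Icc.2 ⟨hj.1, by omega⟩) hf
    · exact hcases.2.2 hf
  · exact h.dpnt_sq
  · exact fun I hI hm => ⟨h.phiSq_endpoint_le hR hδ hδ' ht hI hm (Or.inl rfl),
      h.phiSq_endpoint_le hR hδ hδ' ht hI hm (Or.inr rfl)⟩

theorem succ_of_splits (h : RoundInvariant σ δ R t) (hR : IsExecution σ β δ R) (hβ : 0 < β)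
    (hδ : 0 < δ) (hδ' : δ < 1 / 2) (ht : 2 ≤ t) (hs : R.Splits σ β t) :
    RoundInvariant σ δ R (t + 1) ∧ (R.leaves (t + 1)).card = (R.leaves t).card + 1 := by
  classical
  set S := R.Istar t with hS
  set m := mid S with hm
  set q₁ := mid (S.1, m) with hq₁
  set q₂ := mid (m, S.2) with hq₂
  set L := (R.leaves t).card with hL
  have hl : R.leaves (t + 1) = insert (S.1, m) (insert (m, S.2) ((R.leaves t).erase S)) :=
    hR.leaves_split t ht hs
  have hd : R.dpnt (t + 1) = Function.update (Function.update (R.dpnt t) q₁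
      (δ / (2 * (L : ℝ) ^ 2))) q₂ (δ / (2 * (L : ℝ) ^ 2)) := hR.dpnt_split t ht hs
  have hstar : S ∈ R.leaves t := hR.Istar_mem t ht
  have hlt := (h.dyadic _ hstar).lt
  have hmid : S.1 < m ∧ m < S.2 := mid_mem hlt
  have hm1 : S.1 < q₁ ∧ q₁ < m := mid_mem (I := (S.1, m)) hmid.1
  have hm2 : m < q₂ ∧ q₂ < S.2 := mid_mem (I := (m, S.2)) hmid.2
  have hall : ∀ J ∈ R.leaves t, 0 < R.count t (mid J) :=
    fun J hJ => h.mid_sampled_of_splits hR hβ ht hs hJ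
  have hmono : ∀ p, R.count t p ≤ R.count (t + 1) p := fun p => R.count_mono p t.le_succ
  have hx : R.x (t + 1) = S.1 ∨ R.x (t + 1) = S.2 ∨ R.x (t + 1) = m := by
    have := hR.x_mem t ht
    simpa only [mem_insert_iff, mem_singleton_iff] using this
  have hfr : ¬ Fresh R.x (t + 1) := by
    rw [Transcript.fresh_succ_iff]
    exact (h.count_x_succ_pos hR ht (hall _ hstar)).ne'
  have hD := distinctCount_succ_of_not_fresh hfr
  -- The new midpoints are interior to the bisected leaf and differ from its midpoint.
  have hnew : ∀ q, q = q₁ ∨ q = q₂ → S.1 < q ∧ q < S.2 ∧ q ≠ m := by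
    rintro q (rfl | rfl)
    · exact ⟨hm1.1, hm1.2.trans hmid.2, hm1.2.ne⟩
    · exact ⟨hmid.1.trans hm2.1, hm2.2, hm2.1.ne'⟩
  have hsamp : ∀ i ∈ Finset.Icc 1 (t + 1),
      ∃ I ∈ R.leaves t, R.x i = I.1 ∨ R.x i = I.2 ∨ R.x i = mid I := by
    intro i hi
    rw [Finset.mem_Icc] at hi
    rcases hi.2.lt_or_eq with hlt' | rfl
    · exact h.sampled i (Finset.mem_Icc.2 ⟨hi.1, by omega⟩)
    · exact ⟨S, hstar, hx⟩
  have hpnt : ∀ q, q = q₁ ∨ q = q₂ → ∀ I ∈ R.leaves t, q ≠ I.1 ∧ q ≠ I.2 ∧ q ≠ mid I := by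
    intro q hq I hI
    obtain ⟨a1, a2, a3⟩ := hnew q hq
    have hI' := mid_mem (h.dyadic _ hI).lt
    have hIlt := (h.dyadic _ hI).lt
    have key : I.1 ≤ q → q ≤ I.2 → I = S := fun b1 b2 => h.eq_of_interior hstar hI a1 a2 b1 b2
    refine ⟨?_, ?_, ?_⟩ <;> intro heq
    · have := key heq.ge (by rw [heq]; exact hIlt.le)
      subst this; exact a1.ne' heq
    · have := key (by rw [heq]; exact hIlt.le) heq.le
      subst this; exact a2.ne heq
    · have := key (by rw [heq]; exact hI'.1.le) (by rw [heq]; exact hI'.2.le)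
      subst this; exact a3 heq
  have hnc : ∀ q, q = q₁ ∨ q = q₂ → R.count (t + 1) q = 0 := by
    intro q hq
    by_contra hne
    obtain ⟨i, hi, hxi⟩ := Transcript.count_pos_iff.1 (Nat.pos_of_ne_zero hne)
    obtain ⟨I, hI, hc⟩ := hsamp i hi
    obtain ⟨b1, b2, b3⟩ := hpnt q hq I hI
    rw [hxi] at hc
    rcases hc with hc | hc | hc
    exacts [b1 hc, b2 hc, b3 hc]
  have hdold : ∀ p, 0 < R.count (t + 1) p → R.dpnt (t + 1) p = R.dpnt t p := by
    intro p hp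
    have n1 : p ≠ q₁ := by rintro rfl; rw [hnc _ (Or.inl rfl)] at hp; omega
    have n2 : p ≠ q₂ := by rintro rfl; rw [hnc _ (Or.inr rfl)] at hp; omega
    rw [hd, Function.update_of_ne n2, Function.update_of_ne n1]
  have hdnew : ∀ q, q = q₁ ∨ q = q₂ → R.dpnt (t + 1) q = δ / (2 * (L : ℝ) ^ 2) := by
    rintro q (rfl | rfl)
    · rw [hd, Function.update_of_ne (hm1.2.trans hm2.1).ne, Function.update_self]
    · rw [hd, Function.update_self]
  have hLpos : 1 ≤ L := h.card_pos
  have hL' : (1 : ℝ) ≤ L := by exact_mod_cast hLpos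
  have hcov : ∀ I ∈ R.leaves (t + 1), I = (S.1, m) ∨ I = (m, S.2) ∨ (I ≠ S ∧ I ∈ R.leaves t) := by
    intro I hI
    rw [hl] at hI
    simpa only [Finset.mem_insert, Finset.mem_erase] using hI
  have hn1 : (m, S.2) ∉ (R.leaves t).erase S := by
    intro hmem
    have := h.eq_of_interior hstar (Finset.mem_of_mem_erase hmem) (hmid.1.trans hm2.1) hm2.2
      hm2.1.le hm2.2.le
    exact Finset.ne_of_mem_erase hmem this
  have hn2 : (S.1, m) ∉ insert (m, S.2) ((R.leaves t).erase S) := by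
    rw [Finset.mem_insert, not_or]
    refine ⟨fun heq => hmid.1.ne (congrArg Prod.fst heq), fun hmem => ?_⟩
    have := h.eq_of_interior hstar (Finset.mem_of_mem_erase hmem) hm1.1 (hm1.2.trans hmid.2)
      hm1.1.le hm1.2.le
    exact Finset.ne_of_mem_erase hmem this
  have hcard : (R.leaves (t + 1)).card = L + 1 := by
    rw [hl, Finset.card_insert_of_notMem hn2, Finset.card_insert_of_notMem hn1,
      Finset.card_erase_of_mem hstar]
    omega
  have hends : ∀ p, p = S.1 ∨ p = S.2 ∨ p = m → 0 < R.count t p := by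
    rintro p (rfl | rfl | rfl)
    exacts [(h.ends_pos S hstar).1, (h.ends_pos S hstar).2, hall S hstar]
  have hfil : ((R.leaves (t + 1)).filter fun I => R.count (t + 1) (mid I) = 0)
      = {(S.1, m), (m, S.2)} := by
    ext I
    rw [Finset.mem_filter, Finset.mem_insert, Finset.mem_singleton]
    constructor
    · rintro ⟨hI, h0⟩
      rcases hcov I hI with h' | h' | ⟨-, h'⟩
      · exact Or.inl h'
      · exact Or.inr h'
      · have := hall I h'
        have := hmono (mid I)
        omega
    · rintro (rfl | rfl)
      · exact ⟨by rw [hl]; simp, hnc _ (Or.inl rfl)⟩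
      · exact ⟨by rw [hl]; simp, hnc _ (Or.inr rfl)⟩
  have hfilc : ((R.leaves (t + 1)).filter fun I => R.count (t + 1) (mid I) = 0).card = 2 := by
    rw [hfil, Finset.card_pair]
    exact fun heq => hmid.1.ne (congrArg Prod.fst heq)
  have hends' : ∀ I ∈ R.leaves (t + 1), 0 < R.count t I.1 ∧ 0 < R.count t I.2 := by
    intro I hI
    rcases hcov I hI with rfl | rfl | ⟨-, h'⟩
    · exact ⟨hends _ (by simp), hends _ (by simp)⟩
    · exact ⟨hends _ (by simp), hends _ (by simp)⟩
    · exact h.ends_pos I h'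
  have hsqnew : ∀ p, 0 < R.count t p → (δ / (2 * (L : ℝ) ^ 2)) ^ 2 ≤ R.dpnt (t + 1) p := by
    intro p hp
    rw [hdold p (hp.trans_le (hmono p))]
    refine le_trans ?_ (h.dpnt_ge hδ hp)
    rw [div_pow, div_le_div_iff₀ (by positivity) (by positivity)]
    have h2 : (1 : ℝ) ≤ (L : ℝ) ^ 2 := one_le_pow₀ hL'
    have e : δ * (2 * (L : ℝ) ^ 2) ^ 2 - δ ^ 2 * (6 * (L : ℝ) ^ 2)
        = δ * (L : ℝ) ^ 2 * (4 * (L : ℝ) ^ 2 - 6 * δ) := by ring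
    have : 0 ≤ δ * (L : ℝ) ^ 2 * (4 * (L : ℝ) ^ 2 - 6 * δ) :=
      mul_nonneg (by positivity) (by linarith)
    linarith
  refine ⟨?_, hcard⟩
  constructor
  · intro I hI
    rcases hcov I hI with rfl | rfl | ⟨-, h'⟩
    · exact (h.dyadic _ hstar).left_half
    · exact (h.dyadic _ hstar).right_half
    · exact h.dyadic _ h'
  · intro I hI J hJ hne
    rcases hcov I hI with rfl | rfl | ⟨hI1, hI2⟩ <;> rcases hcov J hJ with rfl | rfl | ⟨hJ1, hJ2⟩
    · exact absurd rfl hne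
    · exact Or.inl le_rfl
    · rcases h.disjoint _ hstar _ hJ2 hJ1.symm with h' | h'
      · exact Or.inl (hmid.2.le.trans h')
      · exact Or.inr h'
    · exact Or.inr le_rfl
    · exact absurd rfl hne
    · rcases h.disjoint _ hstar _ hJ2 hJ1.symm with h' | h'
      · exact Or.inl h'
      · exact Or.inr (h'.trans hmid.1.le)
    · rcases h.disjoint _ hI2 _ hstar hI1 with h' | h'
      · exact Or.inl h'
      · exact Or.inr (hmid.2.le.trans h')
    · rcases h.disjoint _ hI2 _ hstar hI1 with h' | h'
      · exact Or.inl (h'.trans hmid.1.le)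
      · exact Or.inr h'
    · exact h.disjoint _ hI2 _ hJ2 hne
  · intro y hy
    obtain ⟨I, hI, hyI⟩ := h.cover y hy
    by_cases hIS : I = S
    · subst hIS
      rcases le_total y m with hym | hym
      · exact ⟨(S.1, m), by rw [hl]; simp, hyI.1, hym⟩
      · exact ⟨(m, S.2), by rw [hl]; simp, hym, hyI.2⟩
    · exact ⟨I, by rw [hl]; simp [hIS, hI], hyI⟩
  · exact fun I hI => ⟨(hends' I hI).1.trans_le (hmono _), (hends' I hI).2.trans_le (hmono _)⟩
  · intro i hi
    obtain ⟨I, hI, hc⟩ := hsamp i hi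
    by_cases hIS : I = S
    · subst hIS
      rcases hc with hc | hc | hc
      · exact ⟨(S.1, m), by rw [hl]; simp, Or.inl hc⟩
      · exact ⟨(m, S.2), by rw [hl]; simp, Or.inr (Or.inl hc)⟩
      · exact ⟨(S.1, m), by rw [hl]; simp, Or.inr (Or.inl hc)⟩
    · exact ⟨I, by rw [hl]; simp [hIS, hI], hc⟩
  · have hU : ((R.leaves t).filter fun I => R.count t (mid I) = 0) = ∅ :=
      Finset.filter_eq_empty_iff.2 fun J hJ => (hall J hJ).ne'
    have hdist := h.distinct
    rw [hU, Finset.card_empty] at hdist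
    rw [hfilc, hcard, hD]
    omega
  · exact hfilc.le
  · exact h.two_le.trans (distinctCount_mono _ t.le_succ)
  · intro I hI h0
    have hImem : I ∈ (R.leaves (t + 1)).filter fun I => R.count (t + 1) (mid I) = 0 :=
      Finset.mem_filter.2 ⟨hI, h0⟩
    rw [hfil, Finset.mem_insert, Finset.mem_singleton] at hImem
    rw [hcard, show 2 * (L + 1) + 1 = 2 * L + 3 by ring, rankParam_two_mul_add_three hLpos]
    rcases hImem with rfl | rfl
    · exact hdnew _ (Or.inl rfl)
    · exact hdnew _ (Or.inr rfl)
  · intro j hj hf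
    rw [hdold _ (Transcript.count_pos_iff.2 ⟨j, hj, rfl⟩)]
    rw [Finset.mem_Icc] at hj
    rcases hj.2.lt_or_eq with hlt' | rfl
    · exact h.dpnt_fresh j (Finset.mem_Icc.2 ⟨hj.1, by omega⟩) hf
    · exact absurd hf hfr
  · intro I hI
    obtain ⟨b1, b2⟩ := hends' I hI
    rcases hcov I hI with rfl | rfl | ⟨-, h'⟩
    · rw [hdnew (mid (S.1, m)) (Or.inl rfl)]
      exact ⟨hsqnew _ b1, hsqnew _ b2⟩
    · rw [hdnew (mid (m, S.2)) (Or.inr rfl)]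
      exact ⟨hsqnew _ b1, hsqnew _ b2⟩
    · rw [hdold _ ((hall I h').trans_le (hmono _)), hdold _ (b1.trans_le (hmono _)),
        hdold _ (b2.trans_le (hmono _))]
      exact h.dpnt_sq I h'
  · intro I hI hpos
    obtain ⟨b1, b2⟩ := hends' I hI
    rcases hcov I hI with rfl | rfl | ⟨-, h'⟩
    · rw [hnc _ (Or.inl rfl)] at hpos
      omega
    · rw [hnc _ (Or.inr rfl)] at hpos
      omega
    · rw [hdold _ hpos, hdold _ (b1.trans_le (hmono _)), hdold _ (b2.trans_le (hmono _))]
      exact ⟨h.phiSq_endpoint_le hR hδ hδ' ht h' hpos (Or.inl rfl),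
        h.phiSq_endpoint_le hR hδ hδ' ht h' hpos (Or.inr rfl)⟩

end RoundInvariant

namespace IsExecution

variable {σ β δ : ℝ} {R : Transcript}

theorem invariant (hR : IsExecution σ β δ R) (hβ : 0 < β) (hδ : 0 < δ) (hδ' : δ < 1 / 2) {t : ℕ}
    (ht : 2 ≤ t) : RoundInvariant σ δ R t := by
  induction t, ht using Nat.le_induction with
  | base => exact RoundInvariant.base hR hδ hδ'
  | succ t ht ih =>
    by_cases hs : R.Splits σ β t
    · exact (ih.succ_of_splits hR hβ hδ hδ' ht hs).1
    · exact ih.succ_of_not_splits hR hδ hδ' ht hs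

open Classical in
/-- The rounds before `t` that end with a bisection. -/
def splitRounds (σ β : ℝ) (R : Transcript) (t : ℕ) : Finset ℕ :=
  (Finset.Ico 2 t).filter fun s => R.Splits σ β s

theorem card_leaves (hR : IsExecution σ β δ R) (hβ : 0 < β) (hδ : 0 < δ) (hδ' : δ < 1 / 2)
    {t : ℕ} (ht : 2 ≤ t) : (R.leaves t).card = (splitRounds σ β R t).card + 1 := by
  classical
  induction t, ht using Nat.le_induction with
  | base => rw [hR.leaves_two]; simp [splitRounds]
  | succ t ht ih =>
    have e : splitRounds σ β R (t + 1) = if R.Splits σ β t then insert t (splitRounds σ β R t)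
        else splitRounds σ β R t := by
      unfold splitRounds
      rw [show Finset.Ico 2 (t + 1) = insert t (Finset.Ico 2 t) by ext i; simp; omega,
        Finset.filter_insert]
    rw [e]
    split_ifs with hs
    · rw [((hR.invariant hβ hδ hδ' ht).succ_of_splits hR hβ hδ hδ' ht hs).2, ih,
        Finset.card_insert_of_notMem (by simp [splitRounds])]
    · rw [hR.leaves_keep t ht hs, ih]

theorem card_leaves_mono (hR : IsExecution σ β δ R) (hβ : 0 < β) (hδ : 0 < δ) (hδ' : δ < 1 / 2)
    {s t : ℕ} (hs : 2 ≤ s) (hst : s ≤ t) : (R.leaves s).card ≤ (R.leaves t).card := by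
  classical
  rw [hR.card_leaves hβ hδ hδ' hs, hR.card_leaves hβ hδ hδ' (hs.trans hst)]
  refine Nat.succ_le_succ (Finset.card_le_card ?_)
  exact Finset.filter_subset_filter _ (Finset.Ico_subset_Ico_right hst)

/-- A bisected interval is not contained in a later leaf. -/
theorem not_subset_leaf (hR : IsExecution σ β δ R) (hβ : 0 < β) (hδ : 0 < δ) (hδ' : δ < 1 / 2)
    {s t : ℕ} (hs : 2 ≤ s) (hst : s + 1 ≤ t) (hsp : R.Splits σ β s) :
    ∀ J ∈ R.leaves t, ¬ (J.1 ≤ (R.Istar s).1 ∧ (R.Istar s).2 ≤ J.2) := by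
  induction t, hst using Nat.le_induction with
  | base =>
    have h := hR.invariant hβ hδ hδ' hs
    have hstar := hR.Istar_mem s hs
    have hm := mid_mem (h.dyadic _ hstar).lt
    intro J hJ
    rw [hR.leaves_split s hs hsp] at hJ
    simp only [Finset.mem_insert, Finset.mem_erase] at hJ
    rcases hJ with rfl | rfl | ⟨hne, hJ⟩
    · exact fun hc => absurd hc.2 (not_le.2 hm.2)
    · exact fun hc => absurd hc.1 (not_le.2 hm.1)
    · exact fun hc => hne (h.eq_of_interior hstar hJ hm.1 hm.2 (hc.1.trans hm.1.le)
        (hm.2.le.trans hc.2))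
  | succ t hst ih =>
    have ht : 2 ≤ t := by omega
    by_cases hsp' : R.Splits σ β t
    · have h := hR.invariant hβ hδ hδ' ht
      have hstar := hR.Istar_mem t ht
      have hm := mid_mem (h.dyadic _ hstar).lt
      intro J hJ
      rw [hR.leaves_split t ht hsp'] at hJ
      simp only [Finset.mem_insert, Finset.mem_erase] at hJ
      rcases hJ with rfl | rfl | ⟨-, hJ⟩
      · exact fun hc => ih _ hstar ⟨hc.1, hc.2.trans hm.2.le⟩
      · exact fun hc => ih _ hstar ⟨hm.1.le.trans hc.1, hc.2⟩
      · exact ih J hJ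
    · rw [hR.leaves_keep t ht hsp']
      exact ih

theorem injOn_Istar (hR : IsExecution σ β δ R) (hβ : 0 < β) (hδ : 0 < δ) (hδ' : δ < 1 / 2)
    (t : ℕ) : Set.InjOn R.Istar (splitRounds σ β R t) := by
  have key : ∀ s ∈ splitRounds σ β R t, ∀ s' ∈ splitRounds σ β R t, s < s' →
      R.Istar s ≠ R.Istar s' := by
    intro s hs s' hs' hlt heq
    simp only [splitRounds, Finset.mem_filter, Finset.mem_Ico] at hs hs'
    exact hR.not_subset_leaf hβ hδ hδ' hs.1.1 hlt hs.2 _ (hR.Istar_mem s' hs'.1.1)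
      ⟨heq ▸ le_rfl, heq ▸ le_rfl⟩
  intro s hs s' hs' heq
  rcases lt_trichotomy s s' with hlt | h | hlt
  · exact absurd heq (key s hs s' hs' hlt)
  · exact h
  · exact absurd heq.symm (key s' hs' s hs hlt)

end IsExecution

/-! ### Accuracy of the estimators -/

/-- The secant through perturbed values at the endpoints of an interval is within twice the score
of the interval from the convex function. Above the function, this compares the secant on one half
of the interval with the line through the midpoint and the opposite endpoint. -/
theorem ConvexClass.abs_sec_sub_le {f g : ℝ → ℝ} (hf : ConvexClass f) {I : ℝ × ℝ} (h0 : 0 ≤ I.1)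
    (hI : I.1 < I.2) (h1 : I.2 ≤ 1) {wl wr wm : ℝ} (hl : |g I.1 - f I.1| ≤ wl)
    (hr : |g I.2 - f I.2| ≤ wr) (hm : |g (mid I) - f (mid I)| ≤ wm) {x : ℝ}
    (hx : x ∈ Icc I.1 I.2) :
    |sec g I x - f x| ≤ 2 * (wm + 1 / 2 * max wl wr + max 0 (secErr g I)) := by
  obtain ⟨l, r⟩ := I
  simp only at h0 hI h1 hl hr hx
  have hpos : 0 < r - l := sub_pos.2 hI
  set u := (x - l) / (r - l) with hu
  have hu0 : 0 ≤ u := div_nonneg (sub_nonneg.2 hx.1) hpos.le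
  have hu1 : u ≤ 1 := (div_le_one hpos).2 (by linarith [hx.2])
  have hxu : x = (1 - u) * l + u * r := by rw [hu]; field_simp; ring
  have hsec : sec g (l, r) x = (1 - u) * g l + u * g r := by
    simp only [sec]
    have : (r - x) / (r - l) = 1 - u := by rw [hu]; field_simp; ring
    rw [this]
  have hmid : mid (l, r) = (l + r) / 2 := rfl
  have hD : g l + g r - 2 * g ((l + r) / 2) ≤ 2 * max 0 (secErr g (l, r)) := by
    have := le_max_right 0 (secErr g (l, r))
    simp only [secErr, hmid] at this ⊢
    linarith
  have hD0 : 0 ≤ max 0 (secErr g (l, r)) := le_max_left _ _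
  rw [hmid] at hm
  have al := abs_le.1 hl
  have ar := abs_le.1 hr
  have am := abs_le.1 hm
  have wl0 := (abs_nonneg _).trans hl
  have wr0 := (abs_nonneg _).trans hr
  have wm0 := (abs_nonneg _).trans hm
  have ml := le_max_left wl wr
  have mr := le_max_right wl wr
  rw [hsec, abs_le]
  constructor
  · have hc := hf.le_combination (a := l) (b := r) (x := x) (θ := 1 - u) h0 (by linarith)
      (by linarith) h1 (by linarith) (by linarith) (by rw [hxu]; ring)
    nlinarith [mul_le_mul_of_nonneg_left al.1 (sub_nonneg.2 hu1), mul_le_mul_of_nonneg_left ar.1 hu0,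
      mul_le_mul_of_nonneg_left ml (sub_nonneg.2 hu1), mul_le_mul_of_nonneg_left mr hu0]
  · rcases le_total u (1 / 2) with hh | hh
    · have hv : 0 < 2 * (1 - u) := by linarith
      have hu1' : 1 - u ≠ 0 := by linarith
      have hc := hf.le_combination (a := x) (b := r) (x := (l + r) / 2) (θ := 1 / (2 * (1 - u)))
        (by linarith [hx.1]) (by linarith [hx.2]) (by linarith) h1 (by positivity)
        ((div_le_one hv).2 (by linarith)) (by rw [hxu]; field_simp; ring)
      have hc' : 2 * (1 - u) * f ((l + r) / 2) ≤ f x + (1 - 2 * u) * f r := by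
        calc _ ≤ 2 * (1 - u) * (1 / (2 * (1 - u)) * f x + (1 - 1 / (2 * (1 - u))) * f r) := by
              gcongr
          _ = _ := by field_simp; ring
      have hp2 : 0 ≤ 1 - 2 * u := by linarith
      nlinarith [mul_le_mul_of_nonneg_left ar.1 hp2, mul_le_mul_of_nonneg_left am.2 hv.le,
        mul_le_mul_of_nonneg_left hD (sub_nonneg.2 hu1), mul_nonneg hu0 wr0, mul_nonneg hu0 wm0,
        mul_nonneg hu0 hD0]
    · have hv : 0 < 2 * u := by linarith
      have hc := hf.le_combination (a := x) (b := l) (x := (l + r) / 2) (θ := 1 / (2 * u))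
        (by linarith [hx.1]) (by linarith [hx.2]) h0 (by linarith) (by positivity)
        ((div_le_one hv).2 (by linarith)) (by rw [hxu]; field_simp; ring)
      have hc' : 2 * u * f ((l + r) / 2) ≤ f x + (2 * u - 1) * f l := by
        calc _ ≤ 2 * u * (1 / (2 * u) * f x + (1 - 1 / (2 * u)) * f l) := by gcongr
          _ = _ := by field_simp
      have hp2 : 0 ≤ 2 * u - 1 := by linarith
      have hu1' := sub_nonneg.2 hu1
      nlinarith [mul_le_mul_of_nonneg_left al.1 hp2, mul_le_mul_of_nonneg_left am.2 hv.le,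
        mul_le_mul_of_nonneg_left hD hu0, mul_nonneg hu1' wl0, mul_nonneg hu1' wm0,
        mul_nonneg hu1' hD0]

theorem IsConvexProjection.abs_sub_le {h g f : ℝ → ℝ} (hp : IsConvexProjection h g)
    (hf : ConvexClass f) {B : ℝ} (hB : ∀ x ∈ Icc (0 : ℝ) 1, |g x - f x| ≤ B) {x : ℝ}
    (hx : x ∈ Icc (0 : ℝ) 1) : |h x - f x| ≤ 2 * B := by
  have hB0 : 0 ≤ B := (abs_nonneg _).trans (hB x hx)
  have h1 : supDist f g ≤ ENNReal.ofReal B := by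
    refine iSup₂_le fun y hy => ?_
    rw [edist_dist, dist_comm, Real.dist_eq]
    exact ENNReal.ofReal_le_ofReal (hB y hy)
  have h2 : edist (h x) (g x) ≤ ENNReal.ofReal B :=
    (le_iSup₂ (f := fun y (_ : y ∈ Icc (0 : ℝ) 1) => edist (h y) (g y)) x hx).trans
      ((hp.2 f hf).trans h1)
  rw [edist_dist, ENNReal.ofReal_le_ofReal_iff hB0, Real.dist_eq] at h2
  have h3 := hB x hx
  calc |h x - f x| ≤ |h x - g x| + |g x - f x| := _root_.abs_sub_le _ _ _
    _ ≤ 2 * B := by linarith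

/-- Every average is within `1 / √2` times its confidence width of the regression function. -/
def Accurate (σ : ℝ) (f : ℝ → ℝ) (R : Transcript) : Prop :=
  ∀ t, 2 ≤ t → ∀ p, 0 < R.count t p →
    2 * (R.fpnt t p - f p) ^ 2 ≤ phiSq σ (R.count t p) (R.dpnt t p)

namespace IsExecution

variable {σ β δ : ℝ} {R : Transcript} {f : ℝ → ℝ}

theorem accurate (hR : IsExecution σ β δ R) (hβ : 0 < β) (hδ : 0 < δ) (hδ' : δ < 1 / 2)
    {w : ℕ → ℝ} (hy : ∀ i, 1 ≤ i → R.y i = f (R.x i) + w i)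
    (hw : ∀ t j, j ∈ Finset.Icc 1 t → Fresh R.x j →
      (∑ i ∈ (Finset.Icc 1 t).filter (fun i => R.x i = R.x j), w i) ^ 2 ≤
        8 * σ ^ 2 * ((Finset.Icc 1 t).filter fun i => R.x i = R.x j).card *
          Real.log (Real.logb 2 (2 * (((Finset.Icc 1 t).filter fun i => R.x i = R.x j).card : ℝ))
            / rankParam δ (distinctCount R.x j))) : Accurate σ f R := by
  intro t ht p hp
  obtain ⟨i, hi, hip⟩ := Transcript.count_pos_iff.1 hp
  rw [Finset.mem_Icc] at hi
  obtain ⟨j, hj, hf, hji⟩ := exists_fresh (x := R.x) hi.1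
  rw [Finset.mem_Icc] at hj
  have hj' : j ∈ Finset.Icc 1 t := Finset.mem_Icc.2 ⟨hj.1, hj.2.trans hi.2⟩
  obtain rfl : R.x j = p := hji.trans hip
  have hd := (hR.invariant hβ hδ hδ' ht).dpnt_fresh j hj' hf
  have hb := hw t j hj' hf
  have hc : (0 : ℝ) < R.count t (R.x j) := by exact_mod_cast hp
  have hcard : ((Finset.Icc 1 t).filter fun i => R.x i = R.x j).card = R.count t (R.x j) := rfl
  rw [hcard] at hb
  have hfp : R.fpnt t (R.x j) - f (R.x j)
      = (∑ i ∈ (Finset.Icc 1 t).filter (fun i => R.x i = R.x j), w i) / R.count t (R.x j) := by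
    have : ∑ i ∈ (Finset.Icc 1 t).filter (fun i => R.x i = R.x j), R.y i
        = R.count t (R.x j) * f (R.x j)
          + ∑ i ∈ (Finset.Icc 1 t).filter (fun i => R.x i = R.x j), w i := by
      rw [← hcard, ← nsmul_eq_mul, ← Finset.sum_const, ← Finset.sum_add_distrib]
      refine Finset.sum_congr rfl fun k hk => ?_
      rw [Finset.mem_filter, Finset.mem_Icc] at hk
      rw [hy k hk.1.1, hk.2]
    rw [Transcript.fpnt, this]
    field_simp
    ring
  rw [hfp, hd, phiSq, div_pow, ← mul_div_assoc, div_le_div_iff₀ (by positivity) hc]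
  nlinarith

theorem eps_le_of_le (hR : IsExecution σ β δ R) {s t : ℕ} (hs : 1 ≤ s) (hst : s ≤ t) :
    R.eps t ≤ R.eps s := by
  induction t, hst using Nat.le_induction with
  | base => exact le_rfl
  | succ t hst ih =>
    rw [hR.eps_succ t (hs.trans hst)]
    exact (min_le_left _ _).trans ih

theorem eps_le_score (hR : IsExecution σ β δ R) {s t : ℕ} (hs : 2 ≤ s) (hst : s ≤ t) :
    R.eps t ≤ ((4 : ℝ) : EReal) * R.score σ s (R.Istar s) := by
  refine (hR.eps_le_of_le (by omega) hst).trans ?_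
  obtain ⟨s, rfl⟩ : ∃ u, s = u + 1 := ⟨s - 1, by omega⟩
  rw [hR.eps_succ s (by omega)]
  refine (min_le_right _ _).trans (Finset.sup_le fun I hI => ?_)
  exact mul_le_mul_of_nonneg_left (hR.Istar_max _ hs I hI) (by exact_mod_cast (by norm_num))

/-- The current confidence level and estimator were both set in the last round that lowered the
level. -/
theorem eps_eq_top_or (hR : IsExecution σ β δ R) {t : ℕ} (ht : 1 ≤ t) :
    R.eps t = ⊤ ∨ ∃ s, 2 ≤ s ∧
      R.eps t = ((R.leaves s).sup fun I => ((4 : ℝ) : EReal) * R.score σ s I) ∧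
      IsConvexProjection (R.fhat t) (R.fsec s) := by
  induction t, ht using Nat.le_induction with
  | base => exact Or.inl hR.eps_one
  | succ t ht ih =>
    by_cases hlt : R.eps (t + 1) < R.eps t
    · refine Or.inr ⟨t + 1, by omega, ?_, hR.fhat_new t ht hlt⟩
      have he := hR.eps_succ t ht
      rw [he] at hlt ⊢
      rcases min_choice (R.eps t)
        ((R.leaves (t + 1)).sup fun I => ((4 : ℝ) : EReal) * R.score σ (t + 1) I) with h | h
      · rw [h] at hlt; exact absurd hlt (lt_irrefl _)
      · exact h
    · have heq : R.eps (t + 1) = R.eps t :=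
        le_antisymm (hR.eps_le_of_le ht t.le_succ) (not_lt.1 hlt)
      rw [heq, hR.fhat_old t ht hlt]
      exact ih

/-- On an accurate execution the level `ε_t`, once finite, bounds the error of the estimator. -/
theorem fhat_accurate (hR : IsExecution σ β δ R) (hβ : 0 < β) (hδ : 0 < δ) (hδ' : δ < 1 / 2)
    (hf : ConvexClass f) (hA : Accurate σ f R) {t : ℕ} (ht : 1 ≤ t) (hfin : R.eps t ≠ ⊤) :
    ConvexClass (R.fhat t) ∧
      ∀ x ∈ Icc (0 : ℝ) 1, ((|R.fhat t x - f x| : ℝ) : EReal) ≤ R.eps t := by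
  obtain ⟨s, hs, heq, hproj⟩ := (hR.eps_eq_top_or ht).resolve_left hfin
  refine ⟨hproj.1, fun x hx => ?_⟩
  have h := hR.invariant hβ hδ hδ' hs
  have hle : ∀ I ∈ R.leaves s, ((4 : ℝ) : EReal) * R.score σ s I ≤ R.eps t := fun I hI => by
    rw [heq]; exact Finset.le_sup (f := fun I => ((4 : ℝ) : EReal) * R.score σ s I) hI
  have hsamp : ∀ I ∈ R.leaves s, 0 < R.count s (mid I) := by
    intro I hI
    by_contra hne
    have := hle I hI
    rw [Transcript.score_of_zero (h.ends_pos I hI).1 (h.ends_pos I hI).2 (by omega),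
      EReal.coe_mul_top_of_pos (by norm_num), top_le_iff] at this
    exact hfin this
  obtain ⟨I₀, hI₀, -⟩ := h.cover 0 (by simp)
  have hbot : R.eps t ≠ ⊥ := by
    intro hb
    have := hle I₀ hI₀
    rw [h.score_sampled hI₀ (hsamp I₀ hI₀), ← EReal.coe_mul, hb, le_bot_iff] at this
    exact EReal.coe_ne_bot _ this
  obtain ⟨e, he⟩ : ∃ e : ℝ, R.eps t = (e : EReal) :=
    ⟨(R.eps t).toReal, (EReal.coe_toReal hfin hbot).symm⟩
  rw [he] at hle ⊢
  have hclose : ∀ p, 0 < R.count s p → |R.fpnt s p - f p| ≤ R.rwidth σ s p := by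
    intro p hp
    refine Real.abs_le_sqrt ?_
    have := hA s hs p hp
    have := sq_nonneg (R.fpnt s p - f p)
    linarith
  have hsec : ∀ y ∈ Icc (0 : ℝ) 1, |R.fsec s y - f y| ≤ e / 2 := by
    intro y hy
    obtain ⟨I, hI, hyI⟩ := h.cover y hy
    have hd := h.dyadic I hI
    have hb := hf.abs_sec_sub_le hd.nonneg hd.lt hd.le_one (hclose _ (h.ends_pos I hI).1)
      (hclose _ (h.ends_pos I hI).2) (hclose _ (hsamp I hI)) hyI
    have := hle I hI
    rw [h.score_sampled hI (hsamp I hI), ← EReal.coe_mul, EReal.coe_le_coe_iff,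
      Transcript.rbound] at this
    rw [hR.fsec_eq s hs I hI y hyI]
    linarith
  have := hproj.abs_sub_le hf hsec hx
  rw [EReal.coe_le_coe_iff]
  linarith

end IsExecution

/-! ### Counting the rounds before a given accuracy is reached -/

namespace IsExecution

variable {σ β δ ε : ℝ} {R : Transcript} {f : ℝ → ℝ}

/-- An interval that is bisected while the confidence level is above `ε` has a large secant error.
The noise in its secant error is at most `rbound`, because the width at the midpoint is at least
`1 / √2` times those at the endpoints while the averages are accurate up to the same factor. -/
theorem le_secErr_of_splits (hR : IsExecution σ β δ R) (hβ : 0 < β) (hδ : 0 < δ) (hδ' : δ < 1 / 2)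
    (hA : Accurate σ f R) {s : ℕ} (hs : 2 ≤ s) (hsp : R.Splits σ β s)
    (hε : (ε : EReal) < ((4 : ℝ) : EReal) * R.score σ s (R.Istar s)) :
    β / (4 * (2 + β)) * ε ≤ secErr f (R.Istar s) := by
  have h := hR.invariant hβ hδ hδ' hs
  set I := R.Istar s with hIs
  have hI : I ∈ R.leaves s := hR.Istar_mem s hs
  have hm := h.mid_sampled_of_splits hR hβ hs hsp hI
  obtain ⟨hc1, hc2⟩ := h.ends_pos I hI
  rw [h.score_sampled hI hm, ← EReal.coe_mul, EReal.coe_lt_coe_iff] at hε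
  have hsp' : (1 + β) * R.rbound σ s I < secErr (R.fpnt s) I := by
    have := hsp
    rw [Transcript.Splits, ← hIs, Transcript.bound_of_pos hc1 hc2 hm,
      Transcript.secErrHat_of_pos hm, ← EReal.coe_mul, EReal.coe_lt_coe_iff] at this
    exact this
  have hB0 := R.rbound_nonneg σ s I
  have hD0 : 0 < secErr (R.fpnt s) I := lt_of_le_of_lt (by positivity) hsp'
  rw [max_eq_right hD0.le] at hε
  set k : ℝ := √(1 / 2) with hk
  have hk2 : k ^ 2 = 1 / 2 := Real.sq_sqrt (by norm_num)
  have hk0 : 0 < k := Real.sqrt_pos.2 (by norm_num)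
  have hkh : 1 / 2 ≤ k := by nlinarith
  have hclose : ∀ p, 0 < R.count s p → |R.fpnt s p - f p| ≤ k * R.rwidth σ s p := by
    intro p hp
    have h1 := hA s hs p hp
    rw [Transcript.rwidth, hk, ← Real.sqrt_mul (by norm_num)]
    exact Real.abs_le_sqrt (by linarith)
  have hratio : ∀ e, phiSq σ (R.count s e) (R.dpnt s e)
      ≤ 2 * phiSq σ (R.count s (mid I)) (R.dpnt s (mid I)) →
      R.rwidth σ s e ≤ 2 * k * R.rwidth σ s (mid I) := by
    intro e he
    have h2 : 2 * k = √2 := by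
      refine (Real.sqrt_eq_iff_mul_self_eq_of_pos (by positivity)).2 ?_ |>.symm
      nlinarith
    rw [h2, Transcript.rwidth, Transcript.rwidth, ← Real.sqrt_mul (by norm_num)]
    exact Real.sqrt_le_sqrt he
  have hM : max (R.rwidth σ s I.1) (R.rwidth σ s I.2) ≤ 2 * k * R.rwidth σ s (mid I) :=
    max_le (hratio _ (h.width_ratio I hI hm).1) (hratio _ (h.width_ratio I hI hm).2)
  have a1 := abs_le.1 (hclose _ hc1)
  have a2 := abs_le.1 (hclose _ hc2)
  have am := abs_le.1 (hclose _ hm)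
  have m1 := mul_le_mul_of_nonneg_left (le_max_left (R.rwidth σ s I.1) (R.rwidth σ s I.2)) hk0.le
  have m2 := mul_le_mul_of_nonneg_left (le_max_right (R.rwidth σ s I.1) (R.rwidth σ s I.2)) hk0.le
  have hnoise : k * R.rwidth σ s (mid I) + k * max (R.rwidth σ s I.1) (R.rwidth σ s I.2)
      ≤ R.rbound σ s I := by
    have e1 := mul_le_mul_of_nonneg_left hM (sub_nonneg.2 hkh)
    have e2 : (k - 1 / 2) * (2 * k * R.rwidth σ s (mid I)) = (1 - k) * R.rwidth σ s (mid I) := by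
      linear_combination 2 * R.rwidth σ s (mid I) * hk2
    rw [e2] at e1
    unfold Transcript.rbound
    linarith
  have hdiff : secErr (R.fpnt s) I - R.rbound σ s I ≤ secErr f I := by
    unfold secErr
    linarith [a1.1, a1.2, a2.1, a2.2, am.1, am.2]
  refine le_trans ?_ hdiff
  rw [div_mul_eq_mul_div, div_le_iff₀ (by positivity)]
  nlinarith

/-- A point sampled in a round without bisection, while the confidence level is above `ε`, still
has a large confidence width. -/
theorem lt_width_of_not_splits (hR : IsExecution σ β δ R) (hβ : 0 < β) (hδ : 0 < δ)
    (hδ' : δ < 1 / 2) (hε0 : 0 < ε) {s : ℕ} (hs : 2 ≤ s) (hsp : ¬ R.Splits σ β s)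
    (hε : (ε : EReal) < ((4 : ℝ) : EReal) * R.score σ s (R.Istar s))
    (hpos : 0 < R.count s (R.x (s + 1))) :
    ε ^ 2 < 36 * (2 + β) ^ 2 * phiSq σ (R.count s (R.x (s + 1))) (R.dpnt s (R.x (s + 1))) := by
  have h := hR.invariant hβ hδ hδ' hs
  set I := R.Istar s with hIs
  have hI : I ∈ R.leaves s := hR.Istar_mem s hs
  have hm : 0 < R.count s (mid I) := by
    by_contra hne
    have h0 : R.count s (mid I) = 0 := by omega
    rw [h.x_succ_of_unsampled hR hs h0, h0] at hpos
    exact lt_irrefl _ hpos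
  obtain ⟨hc1, hc2⟩ := h.ends_pos I hI
  rw [h.score_sampled hI hm, ← EReal.coe_mul, EReal.coe_lt_coe_iff] at hε
  have hsp' : secErr (R.fpnt s) I ≤ (1 + β) * R.rbound σ s I := by
    have := hsp
    rw [Transcript.Splits, ← hIs, Transcript.bound_of_pos hc1 hc2 hm,
      Transcript.secErrHat_of_pos hm, ← EReal.coe_mul, EReal.coe_lt_coe_iff, not_lt] at this
    exact this
  have hB0 := R.rbound_nonneg σ s I
  have hmax : max 0 (secErr (R.fpnt s) I) ≤ (1 + β) * R.rbound σ s I :=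
    max_le (by positivity) hsp'
  have hw : ∀ p ∈ ({I.1, I.2, mid I} : Set ℝ), 0 < R.count s p →
      R.rwidth σ s p ≤ R.rwidth σ s (R.x (s + 1)) := by
    intro p hp hp0
    have := hR.x_max s hs p hp
    rwa [Transcript.width_of_pos hp0, Transcript.width_of_pos hpos, EReal.coe_le_coe_iff] at this
  have hM := max_le (hw I.1 (by simp) hc1) (hw I.2 (by simp) hc2)
  have hmid := hw (mid I) (by simp) hm
  set W := R.rwidth σ s (R.x (s + 1)) with hW
  have hB : R.rbound σ s I ≤ 3 / 2 * W := by
    unfold Transcript.rbound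
    linarith
  have hlt : ε < 6 * (2 + β) * W := by nlinarith
  have hd := h.dpnt_mem hδ hδ' hpos
  have hWsq : W ^ 2 = phiSq σ (R.count s (R.x (s + 1))) (R.dpnt s (R.x (s + 1))) :=
    Real.sq_sqrt (phiSq_nonneg hpos hd.1 hd.2)
  rw [← hWsq]
  calc ε ^ 2 < (6 * (2 + β) * W) ^ 2 := by gcongr
    _ = _ := by ring

theorem card_image_x_le (R : Transcript) (t : ℕ) :
    ((Finset.Icc 1 t).image R.x).card ≤ distinctCount R.x t := by
  classical
  refine (Finset.card_le_card fun p hp => ?_).trans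
    (Finset.card_image_le (s := (Finset.Icc 1 t).filter (Fresh R.x)) (f := R.x))
  obtain ⟨i, hi, rfl⟩ := Finset.mem_image.1 hp
  rw [Finset.mem_Icc] at hi
  obtain ⟨j, hj, hf, hji⟩ := exists_fresh (x := R.x) hi.1
  rw [Finset.mem_Icc] at hj
  exact Finset.mem_image.2
    ⟨j, Finset.mem_filter.2 ⟨Finset.mem_Icc.2 ⟨hj.1, hj.2.trans hi.2⟩, hf⟩, hji⟩

/-- If the confidence level is above `ε` after `t` samples, then `t` is controlled by the number
of leaves `L` and by a bound on the sample size `n` at which a confidence width with parameter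
`δ / (6 * L ^ 2)` drops below the scale of `ε`. -/
theorem le_of_lt_eps (hR : IsExecution σ β δ R) (hβ : 0 < β) (hδ : 0 < δ) (hδ' : δ < 1 / 2)
    (hε0 : 0 < ε) {t N : ℕ} (ht : 2 ≤ t) (hε : (ε : EReal) < R.eps t)
    (hN : ∀ n : ℕ, 1 ≤ n →
      ε ^ 2 < 36 * (2 + β) ^ 2 * phiSq σ n (δ / (6 * ((R.leaves t).card : ℝ) ^ 2)) → n ≤ N) :
    t ≤ 1 + (R.leaves t).card + (N + 1) * (2 * (R.leaves t).card + 1) := by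
  classical
  set L := (R.leaves t).card with hL
  have hLt := hR.card_leaves hβ hδ hδ' ht
  have hinv := hR.invariant hβ hδ hδ' ht
  set T := (Finset.Ico 2 t).filter fun s => ¬ R.Splits σ β s with hT
  have hsplit : (splitRounds σ β R t).card + T.card = t - 2 := by
    have := Finset.card_filter_add_card_filter_not (s := Finset.Ico 2 t)
      (fun s => R.Splits σ β s)
    rw [Nat.card_Ico] at this
    rw [← this, hT, splitRounds]
  have hTi : ∀ s ∈ T, 2 ≤ s ∧ s < t ∧ ¬ R.Splits σ β s := by
    intro s hs
    rw [hT, Finset.mem_filter, Finset.mem_Ico] at hs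
    exact ⟨hs.1.1, hs.1.2, hs.2⟩
  -- All rounds at `p` but the last one are counted among the samples at `p` before that last one.
  have hfib : ∀ p ∈ T.image (fun s => R.x (s + 1)),
      (T.filter fun s => R.x (s + 1) = p).card ≤ N + 1 := by
    intro p hp
    set F := T.filter fun s => R.x (s + 1) = p with hF
    have hFne : F.Nonempty := by
      obtain ⟨s, hs, rfl⟩ := Finset.mem_image.1 hp
      exact ⟨s, Finset.mem_filter.2 ⟨hs, rfl⟩⟩
    set s₁ := F.max' hFne with hs₁
    have hs₁F : s₁ ∈ F := F.max'_mem hFne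
    obtain ⟨hs₁T, hs₁p⟩ := Finset.mem_filter.1 hs₁F
    obtain ⟨b1, b2, b3⟩ := hTi s₁ hs₁T
    have hcount : (F.erase s₁).card ≤ R.count s₁ p := by
      refine Finset.card_le_card_of_injOn (fun s => s + 1) ?_
        (fun a _ b _ hab => by simpa using hab)
      intro s hs
      obtain ⟨hne, hsF⟩ := Finset.mem_erase.1 hs
      have hlt : s < s₁ := lt_of_le_of_ne (F.le_max' s hsF) hne
      simp only [Finset.coe_filter, Finset.mem_Icc, mem_ofPred_eq]
      exact ⟨⟨by omega, by omega⟩, (Finset.mem_filter.1 hsF).2⟩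
    rw [Finset.card_erase_of_mem hs₁F] at hcount
    have hle : R.count s₁ p ≤ N := by
      rcases Nat.eq_zero_or_pos (R.count s₁ p) with h0 | h0
      · omega
      · have hinv₁ := hR.invariant hβ hδ hδ' b1
        have hw := hR.lt_width_of_not_splits hβ hδ hδ' hε0 b1 b3
          (hε.trans_le (hR.eps_le_score b1 b2.le)) (by rw [hs₁p]; exact h0)
        rw [hs₁p] at hw
        refine hN _ h0 (hw.trans_le ?_)
        have hge := hinv₁.dpnt_ge hδ h0
        have hL1 : (1 : ℝ) ≤ ((R.leaves s₁).card : ℝ) := by exact_mod_cast hinv₁.card_pos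
        have hLL : ((R.leaves s₁).card : ℝ) ≤ L := by
          exact_mod_cast hR.card_leaves_mono hβ hδ hδ' b1 b2.le
        have hge' : δ / (6 * (L : ℝ) ^ 2) ≤ R.dpnt s₁ p := by
          refine le_trans ?_ hge
          gcongr
        have hL0 : (0 : ℝ) < L := by linarith
        have hη : 0 < δ / (6 * (L : ℝ) ^ 2) := by positivity
        have hlb := one_le_logb_two_mul h0
        unfold phiSq
        gcongr
        exact div_pos (by linarith) (hinv₁.dpnt_mem hδ hδ' h0).1
    omega
  have hcardT : T.card ≤ (N + 1) * (T.image fun s => R.x (s + 1)).card :=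
    Finset.card_le_mul_card_image T (N + 1) hfib
  have himg : (T.image fun s => R.x (s + 1)).card ≤ 2 * L + 1 := by
    have h1 : (T.image fun s => R.x (s + 1)) ⊆ (Finset.Icc 1 t).image R.x := by
      intro p hp
      obtain ⟨s, hs, rfl⟩ := Finset.mem_image.1 hp
      obtain ⟨b1, b2, -⟩ := hTi s hs
      exact Finset.mem_image.2 ⟨s + 1, Finset.mem_Icc.2 ⟨by omega, by omega⟩, rfl⟩
    have h2 := (Finset.card_le_card h1).trans (card_image_x_le R t)
    have h3 := hinv.distinct
    omega
  have := hcardT.trans (Nat.mul_le_mul_left (N + 1) himg)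
  omega

/-- While the confidence level is above `ε`, the number of leaves is controlled by the average
modulus of the regression function. -/
theorem card_leaves_le (hR : IsExecution σ β δ R) (hβ : 0 < β) (hδ : 0 < δ) (hδ' : δ < 1 / 2)
    (hf : ConvexClass f) (hA : Accurate σ f R) {α : ℝ} (hα : 0 < α) (hα' : α < 1) (hε0 : 0 < ε)
    {t : ℕ} (ht : 2 ≤ t) (hε : (ε : EReal) < R.eps t) :
    ((R.leaves t).card : ℝ≥0∞) ≤ 1 + ENNReal.ofReal (8 / α) * lambdaAvg f (cScale α β * ε) := by
  classical
  rw [hR.card_leaves hβ hδ hδ' ht]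
  rcases (splitRounds σ β R t).eq_empty_or_nonempty with he | hne
  · rw [he]
    simp
  have hmem : ∀ s ∈ splitRounds σ β R t, 2 ≤ s ∧ s < t ∧ R.Splits σ β s := by
    intro s hs
    rw [splitRounds, Finset.mem_filter, Finset.mem_Ico] at hs
    exact ⟨hs.1.1, hs.1.2, hs.2⟩
  have hlarge : ∀ s ∈ splitRounds σ β R t, β / (4 * (2 + β)) * ε ≤ secErr f (R.Istar s) := by
    intro s hs
    obtain ⟨b1, b2, b3⟩ := hmem s hs
    exact hR.le_secErr_of_splits hβ hδ hδ' hA b1 b3 (hε.trans_le (hR.eps_le_score b1 b2.le))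
  -- The first interval to be bisected is `[0,1]`.
  have hroot : β / (4 * (2 + β)) * ε ≤ secErr f (0, 1) := by
    set s₀ := (splitRounds σ β R t).min' hne with hs₀
    have hs₀m := (splitRounds σ β R t).min'_mem hne
    obtain ⟨b1, b2, b3⟩ := hmem s₀ hs₀m
    have hempty : splitRounds σ β R s₀ = ∅ := by
      rw [Finset.eq_empty_iff_forall_notMem]
      intro s hs
      rw [splitRounds, Finset.mem_filter, Finset.mem_Ico] at hs
      have : s ∈ splitRounds σ β R t := by
        rw [splitRounds, Finset.mem_filter, Finset.mem_Ico]
        exact ⟨⟨hs.1.1, by omega⟩, hs.2⟩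
      have := (splitRounds σ β R t).min'_le s this
      omega
    have hcard := hR.card_leaves hβ hδ hδ' b1
    rw [hempty, Finset.card_empty, zero_add, Finset.card_eq_one] at hcard
    obtain ⟨I, hI⟩ := hcard
    have hinv := hR.invariant hβ hδ hδ' b1
    have hstar := hR.Istar_mem s₀ b1
    have h0 := hinv.cover 0 (by simp)
    have h1 := hinv.cover 1 (by simp)
    have hd := hinv.dyadic _ hstar
    rw [hI, Finset.mem_singleton] at hstar
    simp only [hI, Finset.mem_singleton, exists_eq_left] at h0 h1
    have hlast := hlarge s₀ hs₀m
    have : R.Istar s₀ = (0, 1) := by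
      have e1 := hd.nonneg
      have e2 := hd.le_one
      rw [hstar] at e1 e2 ⊢
      exact Prod.ext (le_antisymm h0.1 e1) (le_antisymm e2 h1.2)
    rwa [this] at hlast
  have hK := hf.card_le_lambdaAvg hα hα' (e := β / (4 * (2 + β)) * ε) (by positivity) hroot
    (K := (splitRounds σ β R t).image R.Istar)
    (by
      intro I hI
      obtain ⟨s, hs, rfl⟩ := Finset.mem_image.1 hI
      obtain ⟨b1, -, -⟩ := hmem s hs
      exact (hR.invariant hβ hδ hδ' b1).dyadic _ (hR.Istar_mem s b1))
    (by
      intro I hI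
      obtain ⟨s, hs, rfl⟩ := Finset.mem_image.1 hI
      exact hlarge s hs)
  rw [Finset.card_image_of_injOn (hR.injOn_Istar hβ hδ hδ' t)] at hK
  have hscale : (1 - α) * (β / (4 * (2 + β)) * ε) = cScale α β * ε := by
    unfold cScale; ring
  rw [hscale] at hK
  push_cast
  rw [add_comm]
  gcongr

end IsExecution

/-! ### The sample complexity -/

/-- Inversion of the confidence width: the implicit bound on the sample size, in which the sample
size reappears inside an iterated logarithm, implies an explicit one. -/
theorem le_of_lt_phiSq {σ β ε η : ℝ} (hσ : 0 ≤ σ) (hβ : 0 < β) (hε : 0 < ε) (hη : 0 < η)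
    (hη' : η ≤ 1 / 4) {n : ℕ} (hn : 1 ≤ n)
    (h : ε ^ 2 < 36 * (2 + β) ^ 2 * phiSq σ n η) :
    (n : ℝ) ≤ 50000000 * max 1 ((1 + β) ^ 2 * σ ^ 2 / ε ^ 2) *
      Real.log (Real.log (Real.exp 1 + σ * (1 + β) / ε) / η) := by
  set v := (1 + β) ^ 2 * σ ^ 2 / ε ^ 2 with hv
  set V := max 1 v with hV
  set a := σ * (1 + β) / ε with ha
  set u := Real.log (Real.exp 1 + a) with hu
  have ha0 : 0 ≤ a := by positivity
  have hva : v = a ^ 2 := by rw [hv, ha]; field_simp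
  have hn0 : (0 : ℝ) < n := by exact_mod_cast hn
  have hV1 : 1 ≤ V := le_max_left _ _
  have hV0 : 0 < V := by linarith
  have he : (2 : ℝ) ≤ Real.exp 1 := by have := Real.add_one_le_exp (1 : ℝ); linarith
  have hu1 : 1 ≤ u := by
    rw [hu, Real.le_log_iff_exp_le (by positivity)]
    linarith
  have hℓ : 1 ≤ Real.log (u / η) := by
    have h2 := Real.log_two_gt_d9
    have : 2 * Real.log 2 ≤ Real.log (u / η) := by
      rw [show 2 * Real.log 2 = Real.log 4 by
        rw [show (4 : ℝ) = 2 ^ 2 by norm_num, Real.log_pow]; norm_num]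
      refine Real.log_le_log (by norm_num) ?_
      rw [le_div_iff₀ hη]
      linarith
    linarith
  set X := Real.log (Real.logb 2 (2 * (n : ℝ)) / η) with hX
  have hX0 : 0 ≤ X := by
    have := log_two_le_log_div hn hη hη'
    have := Real.log_pos one_lt_two
    linarith
  have hlb := one_le_logb_two_mul hn
  have hmain : (n : ℝ) ≤ 2304 * V * X := by
    have h1 : ε ^ 2 * n < 36 * (2 + β) ^ 2 * (16 * σ ^ 2 * X) := by
      unfold phiSq at h
      rw [← hX, ← mul_div_assoc, lt_div_iff₀ hn0] at h
      exact h
    have h2 : (2 + β) ^ 2 ≤ 4 * (1 + β) ^ 2 := by nlinarith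
    have h3 : 36 * (2 + β) ^ 2 * (16 * σ ^ 2 * X) ≤ ε ^ 2 * (2304 * v * X) := by
      calc 36 * (2 + β) ^ 2 * (16 * σ ^ 2 * X) ≤ 36 * (4 * (1 + β) ^ 2) * (16 * σ ^ 2 * X) := by
            gcongr
        _ = ε ^ 2 * (2304 * v * X) := by rw [hv]; field_simp; ring
    have h4 : (n : ℝ) ≤ 2304 * v * X := le_of_mul_le_mul_left (h1.le.trans h3) (by positivity)
    refine h4.trans ?_
    gcongr
    exact le_max_right _ _
  set y := (n : ℝ) / V with hy
  have hny : (n : ℝ) = y * V := by rw [hy]; field_simp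
  have hy0 : 0 < y := by positivity
  suffices hgoal : y ≤ 50000000 * Real.log (u / η) by
    rw [hny]
    calc y * V ≤ 50000000 * Real.log (u / η) * V := by gcongr
      _ = _ := by ring
  rcases le_total y 1 with hy1 | hy1
  · linarith
  have hlogy : 0 ≤ Real.log y := Real.log_nonneg hy1
  have hyX : y ≤ 2304 * X := by
    have : y * V ≤ 2304 * X * V := by rw [← hny]; linarith
    exact le_of_mul_le_mul_right this hV0
  have hlogV : Real.log V ≤ 2 * u := by
    have : V ≤ (Real.exp 1 + a) ^ 2 := max_le (by nlinarith) (by rw [hva]; gcongr; linarith)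
    calc Real.log V ≤ Real.log ((Real.exp 1 + a) ^ 2) := Real.log_le_log hV0 this
      _ = 2 * u := by rw [Real.log_pow, hu]; norm_num
  have hlogb : Real.logb 2 (2 * (n : ℝ)) ≤ u * (4 + 3 / 2 * Real.log y) := by
    have h1 : Real.logb 2 (2 * (n : ℝ)) = 1 + (Real.log y + Real.log V) / Real.log 2 := by
      rw [Real.logb_mul (by norm_num) hn0.ne', Real.logb_self_eq_one (by norm_num), Real.logb, hny,
        Real.log_mul hy0.ne' hV0.ne']
    have h2 : (Real.log y + Real.log V) / Real.log 2 ≤ 3 / 2 * (Real.log y + 2 * u) := by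
      have hl := Real.log_two_gt_d9
      rw [div_le_iff₀ (by linarith)]
      nlinarith
    rw [h1]
    nlinarith
  have hXle : X ≤ Real.log (u / η) + (3 + 3 / 2 * Real.log y) := by
    have h1 : X ≤ Real.log (u / η * (4 + 3 / 2 * Real.log y)) := by
      refine Real.log_le_log (by positivity) ?_
      rw [div_mul_eq_mul_div]
      gcongr
    rw [Real.log_mul (by positivity) (by positivity)] at h1
    have h2 := Real.log_le_sub_one_of_pos (x := 4 + 3 / 2 * Real.log y) (by positivity)
    linarith
  -- `2304 * (3 / 2) = 6912 / 2`, so half of `y` can be absorbed.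
  have hylog : Real.log y ≤ y / 6912 + 6912 := by
    have h1 := Real.log_le_sub_one_of_pos (x := y / 6912) (by positivity)
    have h2 := Real.log_le_sub_one_of_pos (x := (6912 : ℝ)) (by norm_num)
    rw [Real.log_div hy0.ne' (by norm_num)] at h1
    linarith
  linarith

/-- The bound of `IsExecution.le_of_lt_eps`, for `L ≤ κ * Λ` leaves and at most `M ≤ B * z` samples
per point, is below a multiple of `Λ * z`. -/
theorem rounds_lt_of_le {t L M κ Λ B z : ℝ} (hκ : 0 < κ) (hL : 1 ≤ L) (hLΛ : L ≤ κ * Λ)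
    (hΛ : 0 < Λ) (hz : 1 / 2 ≤ z) (hM : 0 ≤ M) (hMB : M ≤ B * z)
    (ht : t ≤ 1 + L + (M + 1) * (2 * L + 1)) : t < (10 * κ + 3 * κ * B + 1) * Λ * z := by
  have hz0 : 0 < z := by linarith
  have h1 : t ≤ 5 * L + 3 * L * M := by nlinarith
  have h2 : 5 * L + 3 * L * M ≤ 5 * (κ * Λ) + 3 * (κ * Λ) * (B * z) := by gcongr
  have h3 : 0 ≤ (κ * Λ) * (z - 1 / 2) := mul_nonneg (by positivity) (by linarith)
  have h4 : 0 < Λ * z := by positivity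
  nlinarith

set_option maxHeartbeats 1000000 in
/-- On an accurate execution, the confidence level is at most `ε` once the number of samples
exceeds the sample complexity. -/
theorem IsExecution.eps_le_of_nBar_le {α : ℝ} (hα : 0 < α) (hα' : α < 1) {σ β δ ε : ℝ}
    {R : Transcript} {f : ℝ → ℝ} (hR : IsExecution σ β δ R) (hσ : 0 ≤ σ) (hβ : 0 < β)
    (hδ : 0 < δ) (hδ' : δ < 1 / 2) (hf : ConvexClass f) (hA : Accurate σ f R) (hε : 0 < ε)
    {t : ℕ} (ht : 2 ≤ t) {C : ℝ}
    (hC : C = 10 * (9 / α) + 3 * (9 / α) * (50000000 * (2 + 2 * Real.log (6 * (9 / α) ^ 2))) + 1)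
    (hn : nBar C (cScale α β) σ β δ f ε ≤ (t : ℝ≥0∞)) : R.eps t ≤ (ε : EReal) := by
  by_contra hlt
  rw [not_le] at hlt
  set Λ' := lambdaAvg f (cScale α β * ε) with hΛ'
  have htop : Λ' ≠ ⊤ := by
    intro h
    rw [nBar, if_pos h, top_le_iff] at hn
    exact ENNReal.natCast_ne_top t hn
  set Λ := Λ'.toReal with hΛ
  have hΛ1 : 1 ≤ Λ := by
    have : (1 : ℝ≥0∞) ≤ Λ' := le_self_add
    have := ENNReal.toReal_mono htop this
    simpa using this
  set L := (R.leaves t).card with hL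
  have hinv := hR.invariant hβ hδ hδ' ht
  have hL1 : (1 : ℝ) ≤ L := by exact_mod_cast hinv.card_pos
  set κ := 9 / α with hκ
  have hκ9 : 9 ≤ κ := by rw [hκ, le_div_iff₀ hα]; linarith
  have hκ0 : 0 < κ := by linarith
  have hΛ0 : 0 < Λ := by linarith
  have hLΛ : (L : ℝ) ≤ κ * Λ := by
    have h1 := hR.card_leaves_le hβ hδ hδ' hf hA hα hα' hε ht hlt
    have h2 := ENNReal.toReal_mono (ENNReal.add_ne_top.2 ⟨ENNReal.one_ne_top,
      ENNReal.mul_ne_top ENNReal.ofReal_ne_top htop⟩) h1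
    rw [ENNReal.toReal_natCast, ENNReal.toReal_add ENNReal.one_ne_top
      (ENNReal.mul_ne_top ENNReal.ofReal_ne_top htop), ENNReal.toReal_mul,
      ENNReal.toReal_ofReal (by positivity), ENNReal.toReal_one] at h2
    have h3 : 1 ≤ 1 / α * Λ := by
      have : 1 ≤ 1 / α := by rw [le_div_iff₀ hα]; linarith
      nlinarith
    calc (L : ℝ) ≤ 1 + 8 / α * Λ := h2
      _ ≤ 1 / α * Λ + 8 / α * Λ := by linarith
      _ = κ * Λ := by rw [hκ]; ring
  set u := Real.log (Real.exp 1 + σ * (1 + β) / ε) with hu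
  have hu1 : 1 ≤ u := by
    have : 0 ≤ σ * (1 + β) / ε := by positivity
    rw [hu, Real.le_log_iff_exp_le (by positivity)]
    linarith
  set V := max 1 ((1 + β) ^ 2 * σ ^ 2 / ε ^ 2) with hV
  have hV1 : 1 ≤ V := le_max_left _ _
  set q := Real.log (1 / δ * Λ * u) with hq
  have hδ2 : 2 ≤ 1 / δ := by rw [le_div_iff₀ hδ]; linarith
  have hΛu : 1 ≤ Λ * u := by nlinarith
  have hq2 : 1 / 2 ≤ q := by
    have h2 := Real.log_two_gt_d9
    have : Real.log 2 ≤ q := by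
      refine Real.log_le_log (by norm_num) ?_
      rw [mul_assoc]
      nlinarith
    linarith
  have hK0 : 0 ≤ Real.log (6 * κ ^ 2) := Real.log_nonneg (by nlinarith)
  set η := δ / (6 * (L : ℝ) ^ 2) with hη
  have hη0 : 0 < η := by positivity
  have hη4 : η ≤ 1 / 4 := by
    rw [hη, div_le_iff₀ (by positivity)]
    nlinarith
  have hlog : Real.log (u / η) ≤ (2 + 2 * Real.log (6 * κ ^ 2)) * q := by
    have h1 : u / η ≤ 6 * κ ^ 2 * (1 / δ * Λ * u) ^ 2 := by
      calc u / η = 6 * (L : ℝ) ^ 2 * (1 / δ * u) := by rw [hη]; field_simp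
        _ ≤ 6 * (κ * Λ) ^ 2 * (1 / δ * u) ^ 2 := by
            have : 1 ≤ 1 / δ * u := by nlinarith
            have : 1 / δ * u ≤ (1 / δ * u) ^ 2 := by nlinarith
            gcongr
        _ = _ := by ring
    calc Real.log (u / η) ≤ Real.log (6 * κ ^ 2 * (1 / δ * Λ * u) ^ 2) :=
          Real.log_le_log (by positivity) h1
      _ = Real.log (6 * κ ^ 2) + 2 * q := by
          rw [Real.log_mul (by positivity) (by positivity), Real.log_pow, hq]
          norm_num
      _ ≤ _ := by nlinarith
  set M := 50000000 * V * Real.log (u / η) with hM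
  have hlogpos : 0 ≤ Real.log (u / η) := Real.log_nonneg (by
    rw [le_div_iff₀ hη0]; linarith)
  have hM0 : 0 ≤ M := by positivity
  have hbound := hR.le_of_lt_eps hβ hδ hδ' hε (N := ⌊M⌋₊) ht hlt (fun n hn1 hlt' =>
    Nat.le_floor (le_of_lt_phiSq hσ hβ hε hη0 hη4 hn1 hlt'))
  have hbound' : (t : ℝ) ≤ 1 + L + (M + 1) * (2 * L + 1) := by
    have h1 : (t : ℝ) ≤ 1 + L + ((⌊M⌋₊ : ℝ) + 1) * (2 * L + 1) := by exact_mod_cast hbound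
    have h2 := Nat.floor_le hM0
    refine h1.trans ?_
    gcongr
  have hMq : M ≤ 50000000 * (2 + 2 * Real.log (6 * κ ^ 2)) * (V * q) := by
    calc M ≤ 50000000 * V * ((2 + 2 * Real.log (6 * κ ^ 2)) * q) := by rw [hM]; gcongr
      _ = _ := by ring
  have hVq : 1 / 2 ≤ V * q := by nlinarith
  have hsmall : (t : ℝ) < C * Λ * V * q := by
    clear_value M
    rw [hC]
    refine (rounds_lt_of_le hκ0 hL1 hLΛ hΛ0 hVq hM0 hMq hbound').trans_eq ?_
    ring
  rw [nBar, if_neg htop, ← ENNReal.ofReal_natCast,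
    ENNReal.ofReal_le_ofReal_iff (by positivity)] at hn
  exact absurd hn (not_le.2 hsmall)

end ConvexRegression

end

theorem theorem1 (α : ℝ) (hα0 : 0 < α) (hα1 : α < 1) :
    ∃ C : ℝ, 0 < C ∧
      ∀ (Ω : Type*) [mΩ : MeasurableSpace Ω] (μ : Measure Ω) [IsProbabilityMeasure μ]
        (ℱ : Filtration ℕ mΩ) (σ β δ : ℝ) (f : ℝ → ℝ) (w : ℕ → Ω → ℝ)
        (R : Ω → ConvexRegression.Transcript),
        0 ≤ σ → 0 < β → 0 < δ → δ < 1 / 2 →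
        ConvexRegression.ConvexClass f →
        ConvexRegression.IsSubgaussianNoise μ ℱ σ w →
        ConvexRegression.IsRunOnOracle ℱ f w σ β δ R →
        ∃ G : Set Ω, MeasurableSet G ∧ ENNReal.ofReal (1 - δ) ≤ μ G ∧
          ∀ ω ∈ G, ∀ (t : ℕ) (ε : ℝ), 2 ≤ t → 0 < ε →
            ConvexRegression.nBar C (ConvexRegression.cScale α β) σ β δ f ε ≤ (t : ℝ≥0∞) →
              ConvexRegression.ConvexClass ((R ω).fhat t) ∧
              (∀ x ∈ Icc (0 : ℝ) 1,
                ((|(R ω).fhat t x - f x| : ℝ) : EReal) ≤ (R ω).eps t) ∧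
              (R ω).eps t ≤ (ε : EReal) := by
  refine ⟨10 * (9 / α) + 3 * (9 / α) * (50000000 * (2 + 2 * Real.log (6 * (9 / α) ^ 2))) + 1,
    ?_, ?_⟩
  · have h9 : 9 ≤ 9 / α := by rw [le_div_iff₀ hα0]; linarith
    have : 0 ≤ Real.log (6 * (9 / α) ^ 2) := Real.log_nonneg (by nlinarith)
    positivity
  intro Ω mΩ μ _ ℱ σ β δ f w R hσ hβ hδ hδ' hf hw hR
  have hx : ∀ n, Measurable[ℱ n] fun ω => (R ω).x (n + 1) := by
    intro n
    match n with
    | 0 =>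
      simp only [zero_add, fun ω => (hR.execution ω).x_one]
      exact measurable_const
    | 1 =>
      simp only [Nat.reduceAdd, fun ω => (hR.execution ω).x_two]
      exact measurable_const
    | n + 2 => exact hR.x_predictable (n + 2) (by omega)
  obtain ⟨G, hGm, hGμ, hG⟩ := hw.exists_good_event (x := fun i ω => (R ω).x i) hσ hδ hδ' hx
  refine ⟨G, hGm, hGμ, fun ω hω t ε ht hε hn => ?_⟩
  have hE := hR.execution ω
  have hA : ConvexRegression.Accurate σ f (R ω) := hE.accurate hβ hδ hδ' (w := fun i => w i ω)
    (fun i hi => hR.oracle ω i hi) (fun t j hj hfr => by convert hG ω hω t j hj hfr)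
  have heps := hE.eps_le_of_nBar_le hα0 hα1 hσ hβ hδ hδ' hf hA hε ht rfl hn
  have hacc := hE.fhat_accurate hβ hδ hδ' hf hA (by omega : 1 ≤ t)
    (fun h => by rw [h, top_le_iff] at heps; exact EReal.coe_ne_top _ heps)
  exact ⟨hacc.1, hacc.2, heps⟩
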